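/- **Setting.** Let $n,d\ge 1$, let $\mathbb X,\mathbb W\subseteq\mathbb R^n$, $\mathbb U\subseteq\mathbb R^m$, $\mathbb S\subseteq\mathbb R^q$, let $f:\mathbb X\times\mathbb U\to\mathbb R^n$, $\psi:\mathbb X\times\mathbb U\to\mathbb R^d$, $\alpha:\mathbb X\times\mathbb S\times\mathbb R^{d\times n}\to\mathbb U$, and let $\theta_*,\vartheta_0\in\mathbb R^{d\times n}$, $\gamma>0$. Put $g(x,u,w)=f(x,u)+\theta_*^\top\psi(x,u)+w$ and assume $g(x,u,w)\in\mathbb X$ for all $x\in\mathbb X$, $u\in\mathbb U$ and $w\in\mathbb W\cup\{0\}$. On a probability space $(\Omega,\mathcal F,\mathbb P)$ let $W(t)$, $t\ge 1$, and $S(t)$, $t\ge 0$, be random vectors with values in $\mathbb W$ and $\mathbb S$; the $S(t)$ are i.i.d. with law $\mu_s$. Consider, for $x_0\in\mathbb X$ and $t\ge0$, $$X(0)=x_0,\quad U(t)=\alpha(X(t),S(t),\hat\theta(t-1)),\quad X(t+1)=g(X(t),U(t),W(t+1)),\quad Z(t+1)=\psi(X(t),U(t)),$$ where $\hat\theta(-1)=\hat\theta(0)=\vartheta_0$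 and, for $t\ge1$, $\hat\theta(t)$ is the minimiser over $\theta\in\mathbb R^{d\times n}$ of $\sum_{s=1}^t|X(s)-\theta^\top Z(s)-f(X(s-1),U(s-1))|^2+\gamma|\theta|_F^2$. Here $|\cdot|$ is the Euclidean norm of vectors and the induced 2-norm of matrices, and $|\cdot|_F$ is the Frobenius norm. Let $\phi(t,\xi,u,w)$ be the deterministic state at time $t$ obtained by iterating $g$ from $\xi\in\mathbb X$ with controls $u(0),\dots,u(t-1)\in\mathbb U$ and noise values $w(1),\dots,w(t)\in\mathbb W$. A function $h:\mathbb R_{\ge0}\to\mathbb R_{\ge0}$ is in $\mathcal K_\infty$ if it is continuous, strictly increasing, unbounded and $h(0)=0$; it is in $\mathcal K_\infty^{k\text{-SE}}$ if moreover $\ln h(r^k)=o(r)$ as $r\to\infty$; it is asymptotically polynomially bounded (APB) if $h(r)=O(r^k)$ as $r\to\infty$ for some $k\in\mathbb N$. **Assumptions.** 1. $f,\psi,\alpha$ are Borel measurable. 2. $\{W(t)\}_{t\ge1}$ is i.i.d. with law $\mu_w$ and independent of $\{S(t)\}_{t\ge0}$; each $W(t)$ has mean zero and is $\sigma_w^2$-sub-Gaussian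 ($\sigma_w\ge0$), i.e. $\mathbb E[\exp(\lambda\zeta^\top W(t))]\le\exp(\lambda^2\sigma_w^2/2)$ for all $\lambda\in\mathbb R$ and all unit vectors $\zeta$. 3. $|\alpha(x,s,\vartheta)|\le u_{\max}$ for all $x,s,\vartheta$, where $u_{\max}\ge0$ is a constant. 4. There is a nondecreasing APB function $\chi_5$ with $|\psi(x,u)|\le\chi_5\big(\sqrt{|x|^2+|u|^2}\big)$ for all $x\in\mathbb X$, $u\in\mathbb U$. 5. Global excitation: there are constants $c_{PE},p_{PE}>0$ such that for all $\vartheta\in\mathbb R^{d\times n}$, $x\in\mathbb X$ and unit vectors $\zeta\in\mathbb R^d$, $$(\mu_s\times\mu_w)\big\{(s,w):\ x+w\in\mathbb X,\ |\zeta^\top\psi(x+w,\alpha(x+w,s,\vartheta))|^2\ge c_{PE}\big\}\ge p_{PE}.$$ 6. There are $\chi_1,\chi_3,\sigma_2\in\mathcal K_\infty^{1\text{-SE}}$, $\chi_4\in\mathcal K_\infty^{2\text{-SE}}$, $\chi_2,\sigma_1\in\mathcal K_\infty$ and $c_1\ge0$, with $\chi_1,\chi_3,\chi_4,\sigma_2$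 APB, such that for all integers $t\ge0$ and all $\xi,u,w$, $$|\phi(t,\xi,u,w)|\le\chi_1(t)+\chi_2(|\xi|)+\chi_3\Big(\sum_{i=0}^{t-1}\sigma_1(|u(i)|)\Big)+\chi_4\Big(\sum_{i=1}^{t}\sigma_2(|w(i)|)\Big)+c_1.$$ **Bounds.** With these functions and constants put $\overline w(0,\delta)=0$, $\overline w(t,\delta)=\sigma_w\sqrt{2n\ln\frac{n\pi^2t^2}{3\delta}}$ for $t\ge1$, and $$\overline x(t,\delta,x_0)=\chi_1(t)+\chi_2(|x_0|)+\chi_3(t\,\sigma_1(u_{\max}))+\chi_4(t\,\sigma_2(\overline w(t,\delta)))+c_1,$$ $$\overline z(t,\delta,x_0)=\chi_5\Big(\sqrt{\overline x(t-1,\delta,x_0)^2+u_{\max}^2}\Big)\ (t\ge 1),\qquad \beta_{\max}(t,\delta,x_0)=\sum_{i=1}^t\overline z(i,\delta,x_0)^2+\gamma,$$ $$T_{\text{burn-in}}(\delta,x_0)=\inf\Big\{T\in\mathbb N:\ \forall t\ge T,\ t\ge\tfrac{2}{(1-\ln2)p_{PE}}\Big(d\ln\Big(1+\tfrac{16\sum_{i=1}^t\overline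 z(i,\delta/3,x_0)^2}{c_{PE}p_{PE}(t-1)}\Big)+\ln\tfrac{\pi^2(t-T+1)^2}{2\delta}\Big)+1\Big\},$$ (the inequality counts as false for $t=1$, and $\inf\emptyset=\infty$), $$T_{\text{excited}}(\delta,x_0)=\sup\big\{T\in\mathbb N:\ g(x,u,0)\in\mathbb X\ \text{ for all } x\in\mathbb X,\ u\in\mathbb U \text{ with } |x|\le\overline x(T-1,\delta/3,x_0),\ |u|\le u_{\max}\big\},$$ $$e(t,\delta,x_0)=\frac{\gamma^{1/2}|\theta_*|_F+\sigma_w\sqrt{2n\big(\ln(3n/\delta)+\tfrac d2\ln(\beta_{\max}(t,\delta/3,x_0)\gamma^{-1})\big)}}{\sqrt{\tfrac{c_{PE}p_{PE}}4(t-1)+\gamma}},$$ where $\mathbb N=\{1,2,\dots\}$. **Conclusion.** For every $x_0\in\mathbb X$ and $\delta\in(0,1)$: 1. $T_{\text{burn-in}}(\delta,x_0)<\infty$; 2. $T_{\text{excited}}(\delta,x_0)=\infty$; 3. $\mathbb P\big(|\hat\theta(t)-\theta_*|\le e(t,\delta,x_0)\ \text{for all integers } t\ge T_{\text{burn-in}}(\delta,x_0)\big)\ge1-\delta$;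 4. $\lim_{t\to\infty}e(t,\delta,x_0)=0$; 5. $e(t,\delta,x_0)=O\big(\sqrt{\ln(t)/t}\big)$ as $t\to\infty$. -/

import Mathlib

open MeasureTheory ProbabilityTheory Filter Topology Asymptotics
open scoped NNReal ENNReal

noncomputable section

namespace SysId

/-! ### Comparison functions -/

/-- Class `K`: continuous, strictly increasing, zero at zero. -/
def IsClassK (h : ℝ≥0 → ℝ≥0) : Prop :=
  Continuous h ∧ StrictMono h ∧ h 0 = 0

/-- Class `K∞`: class `K` and unbounded. -/
def IsClassKInf (h : ℝ≥0 → ℝ≥0) : Prop :=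
  IsClassK h ∧ Tendsto h atTop atTop

/-- `h` is `k`-order sub-exponential: `ln (h (r ^ k)) = o(r)` as `r → ∞`. -/
def IsSubExp (k : ℕ) (h : ℝ≥0 → ℝ≥0) : Prop :=
  (fun r : ℝ≥0 => Real.log (h (r ^ k))) =o[atTop] (fun r : ℝ≥0 => (r : ℝ))

/-- Class `K∞` and `k`-order sub-exponential. -/
def IsClassKInfSE (k : ℕ) (h : ℝ≥0 → ℝ≥0) : Prop :=
  IsClassKInf h ∧ IsSubExp k h

/-- Asymptotically polynomially bounded: `h r = O(r ^ k)` as `r → ∞`, for some `k`. -/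
def IsAPB (h : ℝ≥0 → ℝ≥0) : Prop :=
  ∃ k : ℕ, (fun r : ℝ≥0 => (h r : ℝ)) =O[atTop] (fun r : ℝ≥0 => (r : ℝ) ^ k)

/-! ### Vectors and matrices -/

/-- `ℝⁿ` with the Euclidean norm. -/
abbrev Vec (n : ℕ) : Type := EuclideanSpace ℝ (Fin n)

/-- Real `d × n` matrices. -/
abbrev Mat (d n : ℕ) : Type := Matrix (Fin d) (Fin n) ℝ

/-- Matrices carry the Borel sigma-algebra. -/
instance instMeasurableSpaceMat (d n : ℕ) : MeasurableSpace (Matrix (Fin d) (Fin n) ℝ) :=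
  borel _

instance instBorelSpaceMat (d n : ℕ) : BorelSpace (Matrix (Fin d) (Fin n) ℝ) := ⟨rfl⟩

/-- The product `Aᵀ z` of the transpose of a `d × n` matrix with a vector of `ℝᵈ`. -/
def tmul {d n : ℕ} (A : Mat d n) (z : Vec d) : Vec n :=
  WithLp.toLp 2 (A.transpose.mulVec (WithLp.ofLp z))

/-- The induced 2-norm of a matrix: the operator norm between Euclidean spaces. -/
def opNorm {d n : ℕ} (A : Mat d n) : ℝ :=
  ‖LinearMap.toContinuousLinearMap (Matrix.toEuclideanLin A)‖

/-- The Frobenius norm of a matrix. -/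
def frobNorm {d n : ℕ} (A : Mat d n) : ℝ :=
  √(∑ i, ∑ j, A i j ^ 2)

/-! ### The system, the control policy and the estimator -/

/-- The data of the closed loop: the sets of states, controls, exploratory noise values and process
noise values, the nominal model `f`, the basis functions `ψ`, the control policy `α`, the true
parameter `θ₀`, the initial estimate `ϑ₀` and the regularisation parameter `γ`. The field `maps_to`
says that `(x, u, w) ↦ f x u + θ₀ᵀ ψ x u + w` takes its values in the state space, both for the
values `w` of the process noise and for `w = 0`. -/
structure Plant (n m q d : ℕ) where
  𝕏 : Set (Vec n)
  𝕌 : Set (Vec m)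
  𝕊 : Set (Vec q)
  𝕎 : Set (Vec n)
  f : 𝕏 → 𝕌 → Vec n
  ψ : 𝕏 → 𝕌 → Vec d
  α : 𝕏 → 𝕊 → Mat d n → 𝕌
  θ₀ : Mat d n
  ϑ₀ : Mat d n
  γ : ℝ
  maps_to : ∀ (x : 𝕏) (u : 𝕌), ∀ w ∈ insert 0 𝕎, f x u + tmul θ₀ (ψ x u) + w ∈ 𝕏

variable {n m q d : ℕ}

namespace Plant

/-- `g x u w = f x u + θ₀ᵀ ψ x u + w`. -/
def g (P : Plant n m q d) (x : P.𝕏) (u : P.𝕌) (w : Vec n) : Vec n :=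
  P.f x u + tmul P.θ₀ (P.ψ x u) + w

/-- `g` with values in the state space. -/
def step (P : Plant n m q d) (x : P.𝕏) (u : P.𝕌) (w : P.𝕎) : P.𝕏 :=
  ⟨P.g x u w, P.maps_to x u w (Set.mem_insert_of_mem _ w.2)⟩

/-- The deterministic solution at time `t` from the initial state `ξ`, under the controls
`u 0, …, u (t - 1)` and the process noise values `w 1, …, w t`. -/
def flow (P : Plant n m q d) (ξ : P.𝕏) (u : ℕ → P.𝕌) (w : ℕ+ → P.𝕎) : ℕ → P.𝕏
  | 0 => ξ
  | t + 1 => P.step (flow P ξ u w t) (u t) (w t.succPNat)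

/-- The regressor `Z t = ψ (X (t - 1)) (U (t - 1))`, `t ≥ 1`, along the sequence
`h = (X 0, U 0), (X 1, U 1), …` of states and controls. -/
def regressor (P : Plant n m q d) (h : ℕ → P.𝕏 × P.𝕌) (t : ℕ) : Vec d :=
  P.ψ (h (t - 1)).1 (h (t - 1)).2

/-- The regularised least-squares cost of the parameter `θ` at time `t` along `h`. -/
def cost (P : Plant n m q d) (h : ℕ → P.𝕏 × P.𝕌) (t : ℕ) (θ : Mat d n) : ℝ :=
  ∑ s ∈ Finset.Icc 1 t,
      ‖((h s).1 : Vec n) - tmul θ (P.regressor h s) - P.f (h (s - 1)).1 (h (s - 1)).2‖ ^ 2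
    + P.γ * frobNorm θ ^ 2

/-- The regularised least-squares estimate at time `t` along `h`: the initial estimate for
`t = 0`, the minimiser of the cost for `t ≥ 1`. -/
def estimate (P : Plant n m q d) (h : ℕ → P.𝕏 × P.𝕌) (t : ℕ) : Mat d n :=
  if t = 0 then P.ϑ₀ else Classical.epsilon fun θ => ∀ θ' : Mat d n, P.cost h t θ ≤ P.cost h t θ'

/-- The closed loop driven by the noise values `s 0, s 1, …` and `w 1, w 2, …`. The sequence
`history P x₀ s w t` holds the pairs (state, control) of the times `0, …, t` at these indices (its
later entries play no role). The control at time `t + 1` uses the estimate of time `t`, and the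
control at time `0` uses `ϑ₀`. -/
def history (P : Plant n m q d) (x₀ : P.𝕏) (s : ℕ → P.𝕊) (w : ℕ+ → P.𝕎) :
    ℕ → ℕ → P.𝕏 × P.𝕌
  | 0 => fun _ => (x₀, P.α x₀ (s 0) P.ϑ₀)
  | t + 1 =>
    let h := history P x₀ s w t
    let x := P.step (h t).1 (h t).2 (w t.succPNat)
    Function.update h (t + 1) (x, P.α x (s (t + 1)) (P.estimate h t))

/-- The closed-loop sequence of pairs (state, control). -/
def path (P : Plant n m q d) (x₀ : P.𝕏) (s : ℕ → P.𝕊) (w : ℕ+ → P.𝕎) (t : ℕ) : P.𝕏 × P.𝕌 :=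
  P.history x₀ s w t t

/-- The state `X t`. -/
def state (P : Plant n m q d) (x₀ : P.𝕏) (s : ℕ → P.𝕊) (w : ℕ+ → P.𝕎) (t : ℕ) : P.𝕏 :=
  (P.path x₀ s w t).1

/-- The control `U t`. -/
def control (P : Plant n m q d) (x₀ : P.𝕏) (s : ℕ → P.𝕊) (w : ℕ+ → P.𝕎) (t : ℕ) : P.𝕌 :=
  (P.path x₀ s w t).2

/-- The parameter estimate of time `t`, for `t ≥ 0`. -/
def thetaHat (P : Plant n m q d) (x₀ : P.𝕏) (s : ℕ → P.𝕊) (w : ℕ+ → P.𝕎) (t : ℕ) : Mat d n :=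
  P.estimate (P.path x₀ s w) t

end Plant

/-! The closed-loop equations hold for these sequences. -/

theorem history_of_le (P : Plant n m q d) (x₀ : P.𝕏) (s : ℕ → P.𝕊) (w : ℕ+ → P.𝕎) {k t : ℕ}
    (h : k ≤ t) : P.history x₀ s w t k = P.path x₀ s w k := by
  induction t, h using Nat.le_induction with
  | base => rfl
  | succ t hkt ih =>
    rw [Plant.history, Function.update_of_ne (by omega), ih]

theorem estimate_congr (P : Plant n m q d) {h h' : ℕ → P.𝕏 × P.𝕌} {t : ℕ}
    (hh : ∀ k ≤ t, h k = h' k) : P.estimate h t = P.estimate h' t := by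
  have hc : P.cost h t = P.cost h' t := by
    funext θ
    unfold Plant.cost Plant.regressor
    congr 1
    refine Finset.sum_congr rfl fun k hk => ?_
    rw [Finset.mem_Icc] at hk
    rw [hh k hk.2, hh (k - 1) (by omega)]
  unfold Plant.estimate
  rw [hc]

theorem state_zero (P : Plant n m q d) (x₀ : P.𝕏) (s : ℕ → P.𝕊) (w : ℕ+ → P.𝕎) :
    P.state x₀ s w 0 = x₀ := rfl

theorem state_succ (P : Plant n m q d) (x₀ : P.𝕏) (s : ℕ → P.𝕊) (w : ℕ+ → P.𝕎) (t : ℕ) :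
    (P.state x₀ s w (t + 1) : Vec n)
      = P.f (P.state x₀ s w t) (P.control x₀ s w t)
        + tmul P.θ₀ (P.ψ (P.state x₀ s w t) (P.control x₀ s w t)) + w t.succPNat := by
  simp only [Plant.state, Plant.control, Plant.path, Plant.history, Function.update_self]
  rfl

/-- `U t = α (X t) (S t) (thetaHat (t - 1))`; as the estimates of the times `-1` and `0` are both
`ϑ₀`, the truncated subtraction at `t = 0` gives the right value. -/
theorem control_eq (P : Plant n m q d) (x₀ : P.𝕏) (s : ℕ → P.𝕊) (w : ℕ+ → P.𝕎) (t : ℕ) :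
    P.control x₀ s w t = P.α (P.state x₀ s w t) (s t) (P.thetaHat x₀ s w (t - 1)) := by
  cases t with
  | zero => simp [Plant.control, Plant.state, Plant.path, Plant.history, Plant.thetaHat,
      Plant.estimate]
  | succ t =>
    have he : P.estimate (P.history x₀ s w t) t = P.thetaHat x₀ s w t :=
      estimate_congr P fun k hk => history_of_le P x₀ s w hk
    simp only [Plant.control, Plant.state, Plant.path, Plant.history, Function.update_self,
      Nat.add_sub_cancel, he]

/-- For `γ > 0` the cost has a minimiser. -/
theorem exists_cost_min (P : Plant n m q d) (hγ : 0 < P.γ) (h : ℕ → P.𝕏 × P.𝕌) (t : ℕ) :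
    ∃ θ : Mat d n, ∀ θ' : Mat d n, P.cost h t θ ≤ P.cost h t θ' := by
  have hcont : Continuous (fun θ : Fin d → Fin n → ℝ => P.cost h t (Matrix.of θ)) := by
    unfold Plant.cost frobNorm tmul Matrix.mulVec dotProduct
    simp only [Matrix.transpose_apply, Matrix.of_apply]
    fun_prop
  have hlow : ∀ θ : Fin d → Fin n → ℝ, P.γ * ‖θ‖ ^ 2 ≤ P.cost h t (Matrix.of θ) := by
    intro θ
    have hf : ‖θ‖ ≤ frobNorm (Matrix.of θ) := by
      refine (pi_norm_le_iff_of_nonneg (Real.sqrt_nonneg _)).2 fun i => ?_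
      refine (pi_norm_le_iff_of_nonneg (Real.sqrt_nonneg _)).2 fun j => ?_
      refine Real.abs_le_sqrt ?_
      calc θ i j ^ 2 ≤ ∑ j, θ i j ^ 2 :=
            Finset.single_le_sum (f := fun j => θ i j ^ 2) (fun _ _ => sq_nonneg _)
              (Finset.mem_univ j)
        _ ≤ ∑ i, ∑ j, θ i j ^ 2 :=
            Finset.single_le_sum (f := fun i => ∑ j, θ i j ^ 2)
              (fun _ _ => Finset.sum_nonneg fun _ _ => sq_nonneg _) (Finset.mem_univ i)
    have h2 : P.γ * ‖θ‖ ^ 2 ≤ P.γ * frobNorm (Matrix.of θ) ^ 2 := by gcongr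
    refine h2.trans ?_
    unfold Plant.cost
    exact le_add_of_nonneg_left (Finset.sum_nonneg fun _ _ => by positivity)
  have htop : Tendsto (fun θ : Fin d → Fin n → ℝ => P.cost h t (Matrix.of θ))
      (cocompact _) atTop :=
    tendsto_atTop_mono hlow (((tendsto_pow_atTop two_ne_zero).comp
      (tendsto_norm_cocompact_atTop)).const_mul_atTop hγ)
  obtain ⟨θ, hθ⟩ := hcont.exists_forall_le htop
  exact ⟨Matrix.of θ, fun θ' => hθ θ'⟩

/-- For `γ > 0` and `t ≥ 1` the estimate minimises the cost. -/
theorem estimate_min (P : Plant n m q d) (hγ : 0 < P.γ) (h : ℕ → P.𝕏 × P.𝕌) {t : ℕ} (ht : t ≠ 0)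
    (θ' : Mat d n) : P.cost h t (P.estimate h t) ≤ P.cost h t θ' := by
  unfold Plant.estimate
  rw [if_neg ht]
  exact Classical.epsilon_spec (exists_cost_min P hγ h t) θ'

/-! ### Assumptions -/

/-- The maps `f`, `ψ` and `α` are Borel measurable. -/
structure MeasurableMaps (P : Plant n m q d) : Prop where
  f : Measurable fun p : P.𝕏 × P.𝕌 => P.f p.1 p.2
  ψ : Measurable fun p : P.𝕏 × P.𝕌 => P.ψ p.1 p.2
  α : Measurable fun p : P.𝕏 × P.𝕊 × Mat d n => P.α p.1 p.2.1 p.2.2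

/-- The exploratory noise `S 0, S 1, …` is i.i.d. with law `μs`, the process noise `W 1, W 2, …` is
i.i.d. with law `μw`, the two sequences are independent of each other, and each `W t` has mean zero
and is `σw ^ 2`-sub-Gaussian in every direction. -/
structure NoiseModel {Ω : Type*} [MeasurableSpace Ω] (μ : Measure Ω) (P : Plant n m q d)
    (S : ℕ → Ω → P.𝕊) (W : ℕ+ → Ω → P.𝕎) (μs : Measure P.𝕊) (μw : Measure P.𝕎) (σw : ℝ≥0) :
    Prop where
  measurable_S : ∀ t, Measurable (S t)
  measurable_W : ∀ t, Measurable (W t)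
  law_S : ∀ t, μ.map (S t) = μs
  law_W : ∀ t, μ.map (W t) = μw
  indep_S : iIndepFun S μ
  indep_W : iIndepFun W μ
  indep_W_S : IndepFun (fun ω t => W t ω) (fun ω t => S t ω) μ
  mean_W : ∀ t, ∫ ω, (W t ω : Vec n) ∂μ = 0
  subGaussian_W : ∀ t, ∀ ζ : Vec n, ‖ζ‖ = 1 →
    HasSubgaussianMGF (fun ω => inner ℝ ζ (W t ω : Vec n)) (σw ^ 2) μ

/-- The functions and constants that enter the error bound. -/
structure BoundData where
  χ₁ : ℝ≥0 → ℝ≥0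
  χ₂ : ℝ≥0 → ℝ≥0
  χ₃ : ℝ≥0 → ℝ≥0
  χ₄ : ℝ≥0 → ℝ≥0
  χ₅ : ℝ≥0 → ℝ≥0
  σ₁ : ℝ≥0 → ℝ≥0
  σ₂ : ℝ≥0 → ℝ≥0
  c₁ : ℝ≥0
  uMax : ℝ≥0
  σw : ℝ≥0
  cPE : ℝ
  pPE : ℝ

/-- Sub-exponential input-to-state bound on the reachable states. -/
structure InputToStateBound (P : Plant n m q d) (B : BoundData) : Prop where
  χ₁ : IsClassKInfSE 1 B.χ₁
  χ₂ : IsClassKInf B.χ₂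
  χ₃ : IsClassKInfSE 1 B.χ₃
  χ₄ : IsClassKInfSE 2 B.χ₄
  σ₁ : IsClassKInf B.σ₁
  σ₂ : IsClassKInfSE 1 B.σ₂
  bound : ∀ (t : ℕ) (ξ : P.𝕏) (u : ℕ → P.𝕌) (w : ℕ+ → P.𝕎),
    ‖(P.flow ξ u w t : Vec n)‖₊ ≤ B.χ₁ t + B.χ₂ ‖(ξ : Vec n)‖₊
      + B.χ₃ (∑ i ∈ Finset.range t, B.σ₁ ‖(u i : Vec m)‖₊)
      + B.χ₄ (∑ i ∈ Finset.range t, B.σ₂ ‖(w i.succPNat : Vec n)‖₊) + B.c₁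

/-- Polynomial input-to-state bound on the reachable states. -/
structure PolyInputToStateBound (P : Plant n m q d) (B : BoundData) : Prop
    extends InputToStateBound P B where
  apb_χ₁ : IsAPB B.χ₁
  apb_χ₃ : IsAPB B.χ₃
  apb_χ₄ : IsAPB B.χ₄
  apb_σ₂ : IsAPB B.σ₂

/-- The controls generated by the policy are bounded by `uMax`. -/
def ConstrainedControls (P : Plant n m q d) (B : BoundData) : Prop :=
  ∀ (x : P.𝕏) (s : P.𝕊) (ϑ : Mat d n), ‖(P.α x s ϑ : Vec m)‖₊ ≤ B.uMax

/-- The basis functions are bounded by a nondecreasing APB function `χ₅` of the Euclidean norm of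
the stacked vector of the state and the control. -/
structure PolyBasis (P : Plant n m q d) (B : BoundData) : Prop where
  mono : Monotone B.χ₅
  apb : IsAPB B.χ₅
  bound : ∀ (x : P.𝕏) (u : P.𝕌),
    ‖P.ψ x u‖₊ ≤ B.χ₅ (NNReal.sqrt (‖(x : Vec n)‖₊ ^ 2 + ‖(u : Vec m)‖₊ ^ 2))

/-- Regional excitation over `𝒳` with constants `c` and `p`. In the event, `x + w` is required to
be a state, since `ψ` and `α` are defined on states only. -/
def RegionallyExcited (P : Plant n m q d) (μs : Measure P.𝕊) (μw : Measure P.𝕎)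
    (𝒳 : Set (Vec n)) (c p : ℝ) : Prop :=
  0 < c ∧ 0 < p ∧
    ∀ (ϑ : Mat d n), ∀ x ∈ 𝒳, ∀ ζ : Vec d, ‖ζ‖ = 1 →
      ENNReal.ofReal p ≤ (μs.prod μw) {sw : P.𝕊 × P.𝕎 | ∃ hx : x + (sw.2 : Vec n) ∈ P.𝕏,
        c ≤ |inner ℝ ζ (P.ψ ⟨x + sw.2, hx⟩ (P.α ⟨x + sw.2, hx⟩ sw.1 ϑ))| ^ 2}

/-- Global excitation: regional excitation over the whole state space. -/
def GloballyExcited (P : Plant n m q d) (μs : Measure P.𝕊) (μw : Measure P.𝕎) (c p : ℝ) : Prop :=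
  RegionallyExcited P μs μw P.𝕏 c p

/-! ### The error bound -/

/-- The process noise bound. -/
def noiseBound (n : ℕ) (B : BoundData) (t : ℕ) (δ : ℝ) : ℝ≥0 :=
  if t = 0 then 0
  else B.σw * NNReal.sqrt (Real.toNNReal (2 * n * Real.log (n * Real.pi ^ 2 * t ^ 2 / (3 * δ))))

/-- The state bound. -/
def stateBound (n : ℕ) (B : BoundData) (t : ℕ) (δ : ℝ) (x₀ : Vec n) : ℝ≥0 :=
  B.χ₁ t + B.χ₂ ‖x₀‖₊ + B.χ₃ (t * B.σ₁ B.uMax) + B.χ₄ (t * B.σ₂ (noiseBound n B t δ)) + B.c₁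

/-- The regressor bound, for `t ≥ 1`. -/
def regressorBound (n : ℕ) (B : BoundData) (t : ℕ) (δ : ℝ) (x₀ : Vec n) : ℝ≥0 :=
  B.χ₅ (NNReal.sqrt (stateBound n B (t - 1) δ x₀ ^ 2 + B.uMax ^ 2))

/-- The sum of the squared regressor bounds of the times `1, …, t`. -/
def regressorSum (n : ℕ) (B : BoundData) (t : ℕ) (δ : ℝ) (x₀ : Vec n) : ℝ :=
  ∑ i ∈ Finset.Icc 1 t, (regressorBound n B i δ x₀ : ℝ) ^ 2

/-- The Gramian upper bound. -/
def gramBound (n : ℕ) (B : BoundData) (γ : ℝ) (t : ℕ) (δ : ℝ) (x₀ : Vec n) : ℝ :=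
  regressorSum n B t δ x₀ + γ

/-- The one-step predicted reachable set from `𝒳`. -/
def reachable (P : Plant n m q d) (B : BoundData) (𝒳 : Set (Vec n)) : Set (Vec n) :=
  {y | ∃ (x : P.𝕏) (u : P.𝕌), (x : Vec n) ∈ 𝒳 ∧ ‖(u : Vec m)‖ ≤ B.uMax ∧ y = P.g x u 0}

/-- The excited time bound for the exciting region `𝒳`, an element of `ℕ ∪ {∞}`. -/
def tExcited (P : Plant n m q d) (B : BoundData) (𝒳 : Set (Vec n)) (δ : ℝ) (x₀ : Vec n) : ℕ∞ :=
  ⨆ (T : ℕ) (_ : 1 ≤ T ∧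
    reachable P B (Metric.closedBall 0 (stateBound n B (T - 1) (δ / 3) x₀) ∩ P.𝕏) ⊆ 𝒳), (T : ℕ∞)

/-- The inequality at time `t` in the definition of the burn-in time bound with candidate `T`. For
`t = T = 1`, where the quotient by `t - 1` is not meaningful, it is false. -/
def BurnInIneq (n d : ℕ) (B : BoundData) (T t : ℕ) (δ : ℝ) (x₀ : Vec n) : Prop :=
  2 / ((1 - Real.log 2) * B.pPE) *
      (d * Real.log (1 + 16 * regressorSum n B t (δ / 3) x₀ / (B.cPE * B.pPE * ((t : ℝ) - 1)))
        + Real.log (Real.pi ^ 2 * ((t : ℝ) - T + 1) ^ 2 / (2 * δ)))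
    + 1 ≤ t

/-- The burn-in time bound, an element of `ℕ ∪ {∞}` (it is `∞` if there is no candidate). -/
def tBurnIn (n d : ℕ) (B : BoundData) (δ : ℝ) (x₀ : Vec n) : ℕ∞ :=
  ⨅ (T : ℕ) (_ : 1 ≤ T ∧ ∀ t : ℕ, T ≤ t → BurnInIneq n d B T t δ x₀), (T : ℕ∞)

/-- The bound on the estimation error. -/
def errorBound (P : Plant n m q d) (B : BoundData) (t : ℕ) (δ : ℝ) (x₀ : Vec n) : ℝ :=
  1 / √(B.cPE * B.pPE / 4 * ((t : ℝ) - 1) + P.γ) *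
    (√P.γ * frobNorm P.θ₀ +
      B.σw * √(2 * n * (Real.log (3 * n / δ)
        + (d : ℝ) / 2 * Real.log (gramBound n B P.γ t (δ / 3) x₀ * P.γ⁻¹))))

end SysId

end

open SysId

/-! Write V(t) = γI + ∑ Z(s)Z(s)ᵀ, and let N_j(t) = ∑ W_j(s) Z(s) be the regressors weighted by the
`j`-th noise coordinate. The normal equations give V(t)(θ̂(t) − θ_*)_j = N_j(t) − γ(θ_*)_j, column
by column. Hence, by Cauchy–Schwarz in the norm of V (`opNorm_estimate_sub_le`), the error is at
most λ_min(V)^(-1/2) (γ^(1/2)|θ_*|_F + R), where R² bounds the sum over `j` of N_jᵀ V⁻¹ N_j. What is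
needed is an upper bound for these self-normalised sums and a lower bound for λ_min(V), at all times
at once. Three bad events, each of probability at most δ/3, are excluded (`measure_error_le`).

Large noise: coordinatewise sub-Gaussian tails, weighted by 6/(π²t²), keep every W(t) below
`noiseBound` (`measure_noise_gt_le`). The input-to-state bound then makes ∑|Z(s)|², and with it det
V, deterministically bounded.

Large self-normalised sums: Z(t+1) is determined before W(t+1) is drawn, so the Gaussian mixture of
the exponential supermartingales of N_j is a supermartingale, equal in closed form to `mixture`.
Ville's inequality bounds it for all times, with δ/(3n) for each coordinate. Taking logarithms and
bounding det V gives the numerator of e (`selfNorm_le_of_mixture_lt`).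

Poor excitation: given the past, X(t+1) is a state x = g(X(t),U(t),0) plus fresh noise, so global
excitation gives conditional probability at least p_PE of exciting any fixed direction
(`lintegral_hit_le`). A Chernoff bound makes a deficit in that direction exponentially unlikely. A
union over a finite net of the sphere, fine enough for a Gram matrix of the known trace bound,
passes to all directions and gives λ_min(V) ≥ c_PE p_PE (t−1)/4 + γ. The burn-in inequality says
exactly that net size times Chernoff bound is at most a term of a series with sum δ/3
(`card_mul_exp_le`).

For the asymptotics, the APB hypotheses make ∑z̄² polynomial in t, so every logarithm is O(ln t)
while excitation grows linearly. This yields a finite burn-in time and e = O(√(ln t / t)). -/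

noncomputable section

namespace SysId

/-! ### Regularised Gram matrices -/

section Gram

open Matrix

variable {ι : Type*} [Fintype ι] [DecidableEq ι]

/-- The regularised Gram matrix `γ I + ∑ z s (z s)ᵀ` of the vectors `z 1, …, z t`. -/
def gram (γ : ℝ) (z : ℕ → ι → ℝ) (t : ℕ) : Matrix ι ι ℝ :=
  γ • (1 : Matrix ι ι ℝ) + ∑ s ∈ Finset.Icc 1 t, vecMulVec (z s) (z s)

/-- The weighted sum `∑ w s • z s` over the times `1, …, t`. -/
def weightedSum (z : ℕ → ι → ℝ) (w : ℕ → ℝ) (t : ℕ) : ι → ℝ :=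
  ∑ s ∈ Finset.Icc 1 t, w s • z s

omit [Fintype ι] in
theorem gram_succ (γ : ℝ) (z : ℕ → ι → ℝ) (t : ℕ) :
    gram γ z (t + 1) = gram γ z t + vecMulVec (z (t + 1)) (z (t + 1)) := by
  rw [gram, gram, Finset.sum_Icc_succ_top (by omega), add_assoc]

omit [Fintype ι] [DecidableEq ι] in
theorem weightedSum_succ (z : ℕ → ι → ℝ) (w : ℕ → ℝ) (t : ℕ) :
    weightedSum z w (t + 1) = weightedSum z w t + w (t + 1) • z (t + 1) := by
  rw [weightedSum, weightedSum, Finset.sum_Icc_succ_top (by omega)]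

theorem gram_mulVec (γ : ℝ) (z : ℕ → ι → ℝ) (t : ℕ) (x : ι → ℝ) :
    gram γ z t *ᵥ x = γ • x + ∑ s ∈ Finset.Icc 1 t, (z s ⬝ᵥ x) • z s := by
  rw [gram, add_mulVec, smul_mulVec, one_mulVec, sum_mulVec]
  congr 1
  refine Finset.sum_congr rfl fun s _ => ?_
  ext i
  simp [vecMulVec_mulVec, mul_comm]

theorem dotProduct_gram (γ : ℝ) (z : ℕ → ι → ℝ) (t : ℕ) (x : ι → ℝ) :
    x ⬝ᵥ gram γ z t *ᵥ x = γ * (x ⬝ᵥ x) + ∑ s ∈ Finset.Icc 1 t, (z s ⬝ᵥ x) ^ 2 := by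
  rw [gram_mulVec, dotProduct_add, dotProduct_smul, dotProduct_sum, smul_eq_mul]
  congr 1
  refine Finset.sum_congr rfl fun s _ => ?_
  rw [dotProduct_smul, smul_eq_mul, dotProduct_comm x, sq]

omit [Fintype ι] in
theorem gram_isHermitian (γ : ℝ) (z : ℕ → ι → ℝ) (t : ℕ) : (gram γ z t).IsHermitian := by
  refine Matrix.IsHermitian.ext fun i j => ?_
  simp [gram, Matrix.sum_apply, vecMulVec_apply, Matrix.one_apply, eq_comm, mul_comm]

theorem gram_posDef {γ : ℝ} (hγ : 0 < γ) (z : ℕ → ι → ℝ) (t : ℕ) : (gram γ z t).PosDef := by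
  refine Matrix.PosDef.of_dotProduct_mulVec_pos (gram_isHermitian γ z t) fun x hx => ?_
  rw [star_trivial, dotProduct_gram]
  have h1 : 0 < x ⬝ᵥ x := by
    have := Matrix.dotProduct_star_self_pos_iff.2 hx
    simpa using this
  have h2 : 0 ≤ ∑ s ∈ Finset.Icc 1 t, (z s ⬝ᵥ x) ^ 2 := Finset.sum_nonneg fun _ _ => sq_nonneg _
  positivity

/-! ### Positive definite forms: rank-one updates, duality and determinants. -/

section PosDef

variable {A : Matrix ι ι ℝ} (hA : A.PosDef)
include hA

theorem PosDef_mulVec_inv (x : ι → ℝ) : A *ᵥ (A⁻¹ *ᵥ x) = x := by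
  rw [mulVec_mulVec, Matrix.mul_nonsing_inv _ ((Matrix.isUnit_iff_isUnit_det _).1 hA.isUnit),
    one_mulVec]

theorem PosDef_inv_mulVec (x : ι → ℝ) : A⁻¹ *ᵥ (A *ᵥ x) = x := by
  rw [mulVec_mulVec, Matrix.nonsing_inv_mul _ ((Matrix.isUnit_iff_isUnit_det _).1 hA.isUnit),
    one_mulVec]

omit [DecidableEq ι] in
theorem PosDef_dotProduct_comm (x y : ι → ℝ) : x ⬝ᵥ A *ᵥ y = y ⬝ᵥ A *ᵥ x := by
  have h : Aᵀ = A := by simpa using hA.isHermitian.eq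
  rw [dotProduct_mulVec, ← mulVec_transpose, h, dotProduct_comm]

omit [DecidableEq ι] in
theorem PosDef_dotProduct_nonneg (x : ι → ℝ) : 0 ≤ x ⬝ᵥ A *ᵥ x := by
  simpa using hA.posSemidef.dotProduct_mulVec_nonneg x

theorem det_add_vecMulVec (z : ι → ℝ) :
    (A + vecMulVec z z).det = A.det * (1 + z ⬝ᵥ A⁻¹ *ᵥ z) := by
  have := Matrix.det_add_replicateCol_mul_replicateRow (ι := Unit)
    ((Matrix.isUnit_iff_isUnit_det _).1 hA.isUnit) z z
  rw [vecMulVec_eq Unit, this]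
  congr 1
  simp [Matrix.det_unique, replicateRow, replicateCol, Matrix.mul_apply, dotProduct, mulVec,
    Finset.sum_mul, Finset.mul_sum, mul_assoc]
  exact Finset.sum_comm

/-- Change of the inverse quadratic form under a rank-one update. -/
theorem inv_quadratic_add (z N : ι → ℝ) (w : ℝ) (hA' : (A + vecMulVec z z).PosDef) :
    (N + w • z) ⬝ᵥ (A + vecMulVec z z)⁻¹ *ᵥ (N + w • z)
      = N ⬝ᵥ A⁻¹ *ᵥ N + (2 * w * (z ⬝ᵥ A⁻¹ *ᵥ N) + w ^ 2 * (z ⬝ᵥ A⁻¹ *ᵥ z)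
          - (z ⬝ᵥ A⁻¹ *ᵥ N) ^ 2) / (1 + z ⬝ᵥ A⁻¹ *ᵥ z) := by
  set a := z ⬝ᵥ A⁻¹ *ᵥ z with ha
  set b := z ⬝ᵥ A⁻¹ *ᵥ N with hb
  have ha0 : 0 ≤ a := PosDef_dotProduct_nonneg hA.inv z
  -- Sherman–Morrison, checked by applying the updated matrix to the proposed solution.
  have hinv : ∀ x : ι → ℝ, (A + vecMulVec z z)⁻¹ *ᵥ x
      = A⁻¹ *ᵥ x - ((z ⬝ᵥ A⁻¹ *ᵥ x) / (1 + a)) • (A⁻¹ *ᵥ z) := by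
    intro x
    have : (A + vecMulVec z z) *ᵥ (A⁻¹ *ᵥ x - ((z ⬝ᵥ A⁻¹ *ᵥ x) / (1 + a)) • (A⁻¹ *ᵥ z)) = x := by
      rw [mulVec_sub, mulVec_smul, add_mulVec, add_mulVec, PosDef_mulVec_inv hA,
        PosDef_mulVec_inv hA, vecMulVec_mulVec, vecMulVec_mulVec, ← ha]
      ext i
      simp
      field_simp
      ring
    rw [← this, PosDef_inv_mulVec hA', this]
  have hsymm : N ⬝ᵥ A⁻¹ *ᵥ z = b := PosDef_dotProduct_comm hA.inv N z
  rw [hinv, mulVec_add, mulVec_smul]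
  simp only [dotProduct_sub, dotProduct_add, add_dotProduct, dotProduct_smul, smul_dotProduct,
    smul_eq_mul, ← ha, ← hb, hsymm]
  field_simp
  ring

/-- The Cauchy–Schwarz inequality between the quadratic forms of `A` and of `A⁻¹`. -/
theorem sq_dotProduct_le (x N : ι → ℝ) :
    (x ⬝ᵥ N) ^ 2 ≤ (x ⬝ᵥ A *ᵥ x) * (N ⬝ᵥ A⁻¹ *ᵥ N) := by
  -- The form of `A` at `x - s • A⁻¹N` is a nonnegative quadratic polynomial in `s`; its
  -- discriminant is the claim.
  have h : ∀ s : ℝ, 0 ≤ (N ⬝ᵥ A⁻¹ *ᵥ N) * (s * s) + (-2 * (x ⬝ᵥ N)) * s + x ⬝ᵥ A *ᵥ x := by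
    intro s
    have := PosDef_dotProduct_nonneg hA (x - s • (A⁻¹ *ᵥ N))
    rw [mulVec_sub, mulVec_smul, PosDef_mulVec_inv hA] at this
    simp only [dotProduct_sub, sub_dotProduct, dotProduct_smul, smul_dotProduct,
      smul_eq_mul] at this
    rw [PosDef_dotProduct_comm hA (A⁻¹ *ᵥ N) x, PosDef_mulVec_inv hA,
      dotProduct_comm (A⁻¹ *ᵥ N) N] at this
    linarith
  have := discrim_le_zero h
  rw [discrim] at this
  linarith

/-- Each eigenvalue is the value of the form at a unit eigenvector, so it lies between 0 and `β`;
the determinant is their product. -/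
theorem det_le_pow {β : ℝ} (h : ∀ x : ι → ℝ, x ⬝ᵥ A *ᵥ x ≤ β * (x ⬝ᵥ x)) :
    A.det ≤ β ^ Fintype.card ι := by
  rw [hA.isHermitian.det_eq_prod_eigenvalues, ← Finset.card_univ, ← Finset.prod_const]
  simp only [RCLike.ofReal_real_eq_id, id]
  refine Finset.prod_le_prod (fun i _ => hA.posSemidef.eigenvalues_nonneg i) fun i _ => ?_
  rw [hA.isHermitian.eigenvalues_eq]
  have h1 := h (hA.isHermitian.eigenvectorBasis i)
  have h2 : (hA.isHermitian.eigenvectorBasis i : ι → ℝ) ⬝ᵥ (hA.isHermitian.eigenvectorBasis i : ι → ℝ) = 1 := by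
    have := hA.isHermitian.eigenvectorBasis.orthonormal.1 i
    rw [EuclideanSpace.norm_eq, Real.sqrt_eq_one] at this
    simpa [dotProduct, sq] using this
  rw [h2, mul_one] at h1
  simpa using h1

end PosDef

end Gram

/-! ### Probabilistic tools -/

/-- Ville's maximal inequality, for a process that is a supermartingale as long as it stays below
the level `c`. -/
theorem ville {Ω : Type*} [MeasurableSpace Ω] (μ : Measure Ω) {M : ℕ → Ω → ℝ≥0∞}
    (hM : ∀ t, Measurable (M t)) (c : ℝ≥0∞)
    (hstep : ∀ t, ∫⁻ ω in {ω | ∀ s ≤ t, M s ω < c}, M (t + 1) ω ∂μ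
      ≤ ∫⁻ ω in {ω | ∀ s ≤ t, M s ω < c}, M t ω ∂μ) :
    c * μ {ω | ∃ t, c ≤ M t ω} ≤ ∫⁻ ω, M 0 ω ∂μ := by
  set A : ℕ → Set Ω := fun t => {ω | ∀ s ≤ t, M s ω < c} with hA
  have hAm : ∀ t, MeasurableSet (A t) := fun t => by
    have : A t = ⋂ s, ⋂ (_ : s ≤ t), {ω | M s ω < c} := by ext; simp [hA]
    rw [this]
    exact MeasurableSet.iInter fun s => MeasurableSet.iInter fun _ =>
      measurableSet_lt (hM s) measurable_const
  have hsub : ∀ t, A (t + 1) ⊆ A t := fun t ω h s hs => h s (by omega)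
  -- Optional stopping without filtrations: paths that have reached level `c` are frozen at the
  -- value `c`, the others carry `M t`. Paths leaving `A t` at time `t + 1` have `M (t + 1) ≥ c`, so
  -- freezing them does not increase the total.
  have key : ∀ t, c * μ (A t)ᶜ + ∫⁻ ω in A t, M t ω ∂μ ≤ ∫⁻ ω, M 0 ω ∂μ := by
    intro t
    induction t with
    | zero =>
      have h : c * μ (A 0)ᶜ ≤ ∫⁻ ω in (A 0)ᶜ, M 0 ω ∂μ := by
        rw [← setLIntegral_const]
        refine setLIntegral_mono (hM 0) fun ω hω => ?_
        simpa [hA] using hω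
      rw [← lintegral_add_compl (μ := μ) (M 0) (hAm 0), add_comm]
      exact add_le_add le_rfl h
    | succ t ih =>
      refine le_trans ?_ ih
      have h1 : (A (t + 1))ᶜ = (A t)ᶜ ∪ (A t \ A (t + 1)) := by
        ext ω
        have := @hsub t ω
        simp only [Set.mem_compl_iff, Set.mem_union, Set.mem_sdiff]
        tauto
      have h2 : c * μ (A t \ A (t + 1)) ≤ ∫⁻ ω in A t \ A (t + 1), M (t + 1) ω ∂μ := by
        rw [← setLIntegral_const]
        refine setLIntegral_mono (hM _) fun ω hω => ?_
        by_contra! hlt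
        refine hω.2 fun s hs => ?_
        rcases Nat.lt_or_ge s (t + 1) with h | h
        · exact hω.1 s (by omega)
        · rwa [le_antisymm hs h]
      calc c * μ (A (t + 1))ᶜ + ∫⁻ ω in A (t + 1), M (t + 1) ω ∂μ
          ≤ (c * μ (A t)ᶜ + c * μ (A t \ A (t + 1))) + ∫⁻ ω in A (t + 1), M (t + 1) ω ∂μ := by
            rw [h1, ← mul_add]
            gcongr
            exact measure_union_le _ _
        _ ≤ c * μ (A t)ᶜ + (∫⁻ ω in A t ∩ A (t + 1), M (t + 1) ω ∂μ
              + ∫⁻ ω in A t \ A (t + 1), M (t + 1) ω ∂μ) := by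
            rw [Set.inter_eq_self_of_subset_right (hsub t), add_assoc,
              add_comm (∫⁻ ω in A (t + 1), M (t + 1) ω ∂μ)]
            gcongr
        _ = c * μ (A t)ᶜ + ∫⁻ ω in A t, M (t + 1) ω ∂μ := by
            rw [lintegral_inter_add_sdiff _ _ (hAm _)]
        _ ≤ _ := add_le_add le_rfl (hstep t)
  have hU : {ω | ∃ t, c ≤ M t ω} = ⋃ t, (A t)ᶜ := by
    ext ω
    simp only [hA, Set.mem_ofPred_eq, Set.mem_iUnion, Set.mem_compl_iff, not_forall, not_lt]
    exact ⟨fun ⟨t, ht⟩ => ⟨t, t, le_rfl, ht⟩, fun ⟨_, s, _, hs⟩ => ⟨s, hs⟩⟩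
  have hmono : Monotone fun t => (A t)ᶜ :=
    monotone_nat_of_le_succ fun t => Set.compl_subset_compl.2 (hsub t)
  rw [hU, hmono.measure_iUnion, ENNReal.mul_iSup]
  exact iSup_le fun t => le_self_add.trans (key t)

/-- The law `ν` of a real random variable is sub-Gaussian with variance proxy `σ ^ 2`. -/
def IsSubGaussianLaw (ν : Measure ℝ) (σ : ℝ) : Prop :=
  ∀ l : ℝ, ∫⁻ w, ENNReal.ofReal (Real.exp (l * w)) ∂ν ≤ ENNReal.ofReal (Real.exp (σ ^ 2 * l ^ 2 / 2))

/-- Bayes' rule by completing the square in `l`: a normal prior with mean `m` and variance `v`,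
times the likelihood `exp (l w - σ² l² / 2)`, is the marginal factor times a normal density with
updated mean and variance. Integrating over `l` leaves only the marginal factor. -/
theorem gaussianPDFReal_mul_exp {σ : ℝ} (m : ℝ) {v : ℝ≥0} (hv : v ≠ 0) (w l : ℝ) :
    Real.exp ((2 * m * w + v * w ^ 2 - σ ^ 2 * m ^ 2) / (2 * (1 + σ ^ 2 * v)))
        * (√(1 + σ ^ 2 * v))⁻¹
        * gaussianPDFReal ((m + v * w) / (1 + σ ^ 2 * v))
          (v / (1 + Real.toNNReal (σ ^ 2) * v)) l
      = gaussianPDFReal m v l * Real.exp (l * w - σ ^ 2 * l ^ 2 / 2) := by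
  have hv' : (0 : ℝ) < v := by positivity
  have h1 : 0 < 1 + σ ^ 2 * (v : ℝ) := by positivity
  have hc : ((v / (1 + Real.toNNReal (σ ^ 2) * v) : ℝ≥0) : ℝ) = v / (1 + σ ^ 2 * v) := by
    push_cast
    rw [Real.coe_toNNReal _ (sq_nonneg σ)]
  simp only [gaussianPDFReal, hc]
  have h2 : √(2 * Real.pi * (v / (1 + σ ^ 2 * v))) = √(2 * Real.pi * v) / √(1 + σ ^ 2 * v) := by
    rw [← Real.sqrt_div (by positivity), mul_div_assoc]
  rw [h2]
  have h3 : √(1 + σ ^ 2 * (v : ℝ)) ≠ 0 := (Real.sqrt_pos.2 h1).ne'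
  have h4 : √(2 * Real.pi * (v : ℝ)) ≠ 0 := (Real.sqrt_pos.2 (by positivity)).ne'
  rw [show ∀ a b c e : ℝ, a * b * (c * e) = (b * c) * (a * e) from fun a b c e => by ring,
    ← Real.exp_add, mul_assoc _ (Real.exp _) (Real.exp _), ← Real.exp_add]
  congr 1
  · field_simp
  · congr 1
    field_simp
    ring

/-- One step of the method of mixtures. -/
theorem lintegral_exp_quadratic_le {ν : Measure ℝ} [IsProbabilityMeasure ν] {σ : ℝ}
    (hν : IsSubGaussianLaw ν σ) (m : ℝ) (v : ℝ≥0) :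
    ∫⁻ w, ENNReal.ofReal (Real.exp ((2 * m * w + v * w ^ 2 - σ ^ 2 * m ^ 2) / (2 * (1 + σ ^ 2 * v))))
      ∂ν ≤ ENNReal.ofReal √(1 + σ ^ 2 * v) := by
  have hexp : ∀ l : ℝ, ∫⁻ w, ENNReal.ofReal (Real.exp (l * w - σ ^ 2 * l ^ 2 / 2)) ∂ν ≤ 1 := by
    intro l
    have : ∀ w, ENNReal.ofReal (Real.exp (l * w - σ ^ 2 * l ^ 2 / 2))
        = ENNReal.ofReal (Real.exp (l * w)) * ENNReal.ofReal (Real.exp (-(σ ^ 2 * l ^ 2 / 2))) := by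
      intro w
      rw [← ENNReal.ofReal_mul (Real.exp_nonneg _), ← Real.exp_add, sub_eq_add_neg]
    simp_rw [this]
    rw [lintegral_mul_const _ (by fun_prop)]
    calc _ ≤ ENNReal.ofReal (Real.exp (σ ^ 2 * l ^ 2 / 2))
          * ENNReal.ofReal (Real.exp (-(σ ^ 2 * l ^ 2 / 2))) := by gcongr; exact hν l
      _ = 1 := by
        rw [← ENNReal.ofReal_mul (Real.exp_nonneg _), ← Real.exp_add]; simp
  -- For `v = 0` the prior is a point mass at `m`, without density, and the claim is `hexp m`.
  rcases eq_or_ne v 0 with rfl | hv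
  · refine le_trans (le_of_eq ?_) ((hexp m).trans ?_)
    · refine lintegral_congr fun w => ?_
      congr 2
      simp
      ring
    · simp
  set K := √(1 + σ ^ 2 * (v : ℝ)) with hK
  have hK0 : 0 < K := Real.sqrt_pos.2 (by positivity)
  -- The integrand is a Gaussian mixture over `l`; after exchanging the integrals, each inner
  -- integral over `w` is at most 1 by `hexp`.
  have hq : ∀ w : ℝ, ENNReal.ofReal (Real.exp ((2 * m * w + v * w ^ 2 - σ ^ 2 * m ^ 2)
        / (2 * (1 + σ ^ 2 * v))))
      = ENNReal.ofReal K * ∫⁻ l, ENNReal.ofReal (gaussianPDFReal m v l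
          * Real.exp (l * w - σ ^ 2 * l ^ 2 / 2)) := by
    intro w
    simp_rw [← gaussianPDFReal_mul_exp m hv w]
    have hv' : v / (1 + Real.toNNReal (σ ^ 2) * v) ≠ 0 := by positivity
    rw [← hK]
    simp_rw [ENNReal.ofReal_mul (show 0 ≤ Real.exp ((2 * m * w + v * w ^ 2 - σ ^ 2 * m ^ 2)
        / (2 * (1 + σ ^ 2 * v))) * K⁻¹ by positivity)]
    rw [lintegral_const_mul _ (measurable_gaussianPDFReal _ _).ennreal_ofReal]
    have := lintegral_gaussianPDF_eq_one ((m + v * w) / (1 + σ ^ 2 * v)) hv'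
    simp only [gaussianPDF] at this
    rw [this, mul_one, ← ENNReal.ofReal_mul hK0.le]
    congr 1
    field_simp
  simp_rw [hq]
  rw [lintegral_const_mul _ (by
    refine Measurable.lintegral_prod_right ?_
    have := measurable_gaussianPDFReal m v
    fun_prop)]
  rw [lintegral_lintegral_swap (by
    have := measurable_gaussianPDFReal m v
    fun_prop)]
  have hle : ∀ l, ∫⁻ w, ENNReal.ofReal (gaussianPDFReal m v l
      * Real.exp (l * w - σ ^ 2 * l ^ 2 / 2)) ∂ν ≤ gaussianPDF m v l := by
    intro l
    simp_rw [ENNReal.ofReal_mul (gaussianPDFReal_nonneg m v l)]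
    rw [lintegral_const_mul _ (by fun_prop)]
    exact (mul_le_mul_right (hexp l) _).trans (by rw [mul_one]; rfl)
  calc _ ≤ ENNReal.ofReal K * ∫⁻ l, gaussianPDF m v l := by
        gcongr with l; exact hle l
    _ = _ := by rw [lintegral_gaussianPDF_eq_one m hv, mul_one]

/-- Tonelli's theorem for a function of two independent random variables. -/
theorem lintegral_indepFun {Ω E F : Type*} [MeasurableSpace Ω] [MeasurableSpace E]
    [MeasurableSpace F] {μ : Measure Ω} [IsProbabilityMeasure μ] {X : Ω → E} {Y : Ω → F}
    (hX : Measurable X) (hY : Measurable Y) (h : IndepFun X Y μ) {φ : E × F → ℝ≥0∞}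
    (hφ : Measurable φ) :
    ∫⁻ ω, φ (X ω, Y ω) ∂μ = ∫⁻ ω, ∫⁻ y, φ (X ω, y) ∂(μ.map Y) ∂μ := by
  have := (indepFun_iff_map_prod_eq_prod_map_map hX.aemeasurable hY.aemeasurable).1 h
  have : IsProbabilityMeasure (μ.map Y) := Measure.isProbabilityMeasure_map hY.aemeasurable
  rw [← lintegral_map hφ (hX.prodMk hY), (indepFun_iff_map_prod_eq_prod_map_map hX.aemeasurable
    hY.aemeasurable).1 h, lintegral_prod _ hφ.aemeasurable,
    lintegral_map hφ.lintegral_prod_right' hX]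

/-- A separated finite subset of the unit sphere of `ℝᵈ` has at most `(1 + 2 / ε) ^ d` points. -/
theorem card_separated_sphere_le {d : ℕ} {ε : ℝ} (hε : 0 < ε) (s : Finset (Vec d))
    (hs : ∀ x ∈ s, ‖x‖ = 1) (hsep : ∀ x ∈ s, ∀ y ∈ s, x ≠ y → ε ≤ ‖x - y‖) :
    (s.card : ℝ) ≤ (1 + 2 / ε) ^ d := by
  let ν : Measure (Vec d) := volume
  -- Volume comparison: disjoint balls of radius `ε / 2` fit in one ball of radius `1 + ε / 2`.
  have hdisj : (s : Set (Vec d)).PairwiseDisjoint fun x => Metric.ball x (ε / 2) := by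
    intro x hx y hy hxy
    refine Metric.ball_disjoint_ball ?_
    rw [dist_eq_norm]
    linarith [hsep x hx y hy hxy]
  have hsub : (⋃ x ∈ s, Metric.ball x (ε / 2)) ⊆ Metric.ball (0 : Vec d) (1 + ε / 2) := by
    refine Set.iUnion₂_subset fun x hx => Metric.ball_subset_ball' ?_
    rw [dist_zero_right, hs x hx, add_comm]
  have hvol := measure_mono (μ := ν) hsub
  rw [measure_biUnion_finset hdisj fun _ _ => measurableSet_ball] at hvol
  simp_rw [Measure.addHaar_ball_of_pos ν _ (show 0 < ε / 2 by positivity)] at hvol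
  rw [Measure.addHaar_ball_of_pos ν _ (show 0 < 1 + ε / 2 by positivity), Finset.sum_const, nsmul_eq_mul,
    ← mul_assoc, ENNReal.mul_le_mul_iff_left (Metric.measure_ball_pos _ _ one_pos).ne'
      measure_ball_lt_top.ne, finrank_euclideanSpace, Fintype.card_fin,
    ← ENNReal.ofReal_natCast, ← ENNReal.ofReal_mul (by positivity),
    ENNReal.ofReal_le_ofReal_iff (by positivity)] at hvol
  have : (1 + ε / 2) ^ d = (1 + 2 / ε) ^ d * (ε / 2) ^ d := by
    rw [← mul_pow]; congr 1; field_simp; ring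
  rw [this] at hvol
  exact le_of_mul_le_mul_right hvol (by positivity)

/-- An `ε`-net of the unit sphere of `ℝᵈ` with at most `(1 + 2 / ε) ^ d` points. -/
theorem exists_net_sphere (d : ℕ) {ε : ℝ} (hε : 0 < ε) :
    ∃ s : Finset (Vec d), (∀ x ∈ s, ‖x‖ = 1) ∧ (s.card : ℝ) ≤ (1 + 2 / ε) ^ d ∧
      ∀ x : Vec d, ‖x‖ = 1 → ∃ y ∈ s, ‖x - y‖ ≤ ε := by
  classical
  let p : ℕ → Prop := fun k => ∃ s : Finset (Vec d), (∀ x ∈ s, ‖x‖ = 1) ∧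
    (∀ x ∈ s, ∀ y ∈ s, x ≠ y → ε ≤ ‖x - y‖) ∧ s.card = k
  have hb : ∀ k, p k → k ≤ ⌊(1 + 2 / ε) ^ d⌋₊ := fun k ⟨s, h1, h2, h3⟩ =>
    Nat.le_floor (h3 ▸ card_separated_sphere_le hε s h1 h2)
  have h0 : p 0 := ⟨∅, by simp, by simp, by simp⟩
  -- A separated set of maximal cardinality is a net: a point farther than `ε` from it could be
  -- added.
  obtain ⟨s, h1, h2, h3⟩ := Nat.findGreatest_spec (P := p) (Nat.zero_le _) h0
  refine ⟨s, h1, card_separated_sphere_le hε s h1 h2, fun x hx => ?_⟩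
  by_contra! hcon
  have hxs : x ∉ s := fun h => by simpa [hε.not_gt] using hcon x h
  have hp : p (s.card + 1) := by
    refine ⟨insert x s, ?_, ?_, Finset.card_insert_of_notMem hxs⟩
    · intro y hy
      rcases Finset.mem_insert.1 hy with rfl | hy
      exacts [hx, h1 y hy]
    · intro y hy z hz hyz
      rcases Finset.mem_insert.1 hy with h | h <;> rcases Finset.mem_insert.1 hz with h' | h'
      · exact absurd (h.trans h'.symm) hyz
      · rw [h]; exact (hcon z h').le
      · rw [h', norm_sub_rev]; exact (hcon y h).le
      · exact h2 y h z h' hyz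
  have h4 := Nat.le_findGreatest (hb _ hp) hp
  rw [← h3] at h4
  exact absurd h4 (by simp)

/-! ### Measurability of matrix operations -/

section MeasurableMatrix

open Matrix

variable {ι E : Type*} [Fintype ι] [DecidableEq ι] [MeasurableSpace E]

theorem measurable_matrix_det {A : E → Matrix ι ι ℝ} (hA : ∀ i j, Measurable fun x => A x i j) :
    Measurable fun x => (A x).det := by
  simp only [det_apply]
  refine Finset.measurable_sum _ fun p _ => Measurable.const_smul ?_ _
  exact Finset.measurable_prod _ fun i _ => hA _ _

/-- Cramer's formula: the entries are polynomials divided by the determinant. Singular matrices need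
no separate treatment, as inversion on ℝ with `0⁻¹ = 0` is measurable. -/
theorem measurable_matrix_inv {A : E → Matrix ι ι ℝ} (hA : ∀ i j, Measurable fun x => A x i j)
    (i j : ι) : Measurable fun x => (A x)⁻¹ i j := by
  simp only [inv_def, Matrix.smul_apply, smul_eq_mul, adjugate_apply, Ring.inverse_eq_inv']
  refine (measurable_matrix_det hA).inv.mul (measurable_matrix_det fun k l => ?_)
  by_cases hk : k = j
  · subst hk
    simp
  · simpa [updateRow_ne hk] using hA k l

omit [DecidableEq ι] in
theorem measurable_matrix_mulVec {A : E → Matrix ι ι ℝ} {v : E → ι → ℝ}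
    (hA : ∀ i j, Measurable fun x => A x i j) (hv : Measurable v) :
    Measurable fun x => A x *ᵥ v x := by
  rw [measurable_pi_iff]
  intro i
  simp only [mulVec, dotProduct]
  exact Finset.measurable_sum _ fun j _ => (hA i j).mul ((measurable_pi_apply j).comp hv)

omit [DecidableEq ι] in
theorem measurable_dotProduct {u v : E → ι → ℝ} (hu : Measurable u) (hv : Measurable v) :
    Measurable fun x => u x ⬝ᵥ v x := by
  simp only [dotProduct]
  exact Finset.measurable_sum _ fun j _ =>
    ((measurable_pi_apply j).comp hu).mul ((measurable_pi_apply j).comp hv)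

omit [Fintype ι] in
theorem measurable_gram {z : E → ℕ → ι → ℝ} (hz : ∀ s, Measurable fun x => z x s) (γ : ℝ) (t : ℕ)
    (i j : ι) : Measurable fun x => gram γ (z x) t i j := by
  simp only [gram, Matrix.add_apply, Matrix.sum_apply, vecMulVec_apply]
  refine measurable_const.add (Finset.measurable_sum _ fun s _ => ?_)
  exact ((measurable_pi_apply i).comp (hz s)).mul ((measurable_pi_apply j).comp (hz s))

omit [DecidableEq ι] in
theorem measurable_weightedSum {z : E → ℕ → ι → ℝ} {w : E → ℕ → ℝ}
    (hz : ∀ s, Measurable fun x => z x s) (hw : ∀ s, Measurable fun x => w x s) (t : ℕ) :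
    Measurable fun x => weightedSum (z x) (w x) t := by
  simp only [weightedSum]
  exact Finset.measurable_sum _ fun s _ => (hw s).smul (hz s)

end MeasurableMatrix

variable {n m q d : ℕ}

/-! ### The least-squares estimate -/

section Estimate

open Matrix

/-- Completion of the square in the regularised least-squares cost of a scalar response. -/
theorem scalar_cost_eq {ι : Type*} [Fintype ι] [DecidableEq ι] {γ : ℝ} (hγ : 0 < γ)
    (z : ℕ → ι → ℝ) (y : ℕ → ℝ) (t : ℕ) (v : ι → ℝ) :
    ∑ s ∈ Finset.Icc 1 t, (y s - z s ⬝ᵥ v) ^ 2 + γ * (v ⬝ᵥ v)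
      = (∑ s ∈ Finset.Icc 1 t, y s ^ 2
          - ((gram γ z t)⁻¹ *ᵥ weightedSum z y t) ⬝ᵥ weightedSum z y t)
        + (v - (gram γ z t)⁻¹ *ᵥ weightedSum z y t) ⬝ᵥ
          gram γ z t *ᵥ (v - (gram γ z t)⁻¹ *ᵥ weightedSum z y t) := by
  have hA := gram_posDef hγ z t
  have h1 : ∑ s ∈ Finset.Icc 1 t, (y s - z s ⬝ᵥ v) ^ 2 + γ * (v ⬝ᵥ v)
      = ∑ s ∈ Finset.Icc 1 t, y s ^ 2 - 2 * (v ⬝ᵥ weightedSum z y t) + v ⬝ᵥ gram γ z t *ᵥ v := by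
    rw [dotProduct_gram, weightedSum, dotProduct_sum, Finset.mul_sum]
    simp only [sub_sq, Finset.sum_add_distrib, Finset.sum_sub_distrib, dotProduct_smul, smul_eq_mul]
    have : ∑ s ∈ Finset.Icc 1 t, 2 * y s * z s ⬝ᵥ v
        = ∑ s ∈ Finset.Icc 1 t, 2 * (y s * v ⬝ᵥ z s) :=
      Finset.sum_congr rfl fun s _ => by rw [dotProduct_comm v]; ring
    rw [this]
    ring
  rw [h1, mulVec_sub, PosDef_mulVec_inv hA]
  simp only [dotProduct_sub, sub_dotProduct]
  rw [PosDef_dotProduct_comm hA (_⁻¹ *ᵥ _) v, PosDef_mulVec_inv hA]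
  ring

variable (P : Plant n m q d)

/-- The coordinates of the regressor. -/
def regr (h : ℕ → P.𝕏 × P.𝕌) (s : ℕ) : Fin d → ℝ := WithLp.ofLp (P.regressor h s)

/-- The coordinates of the response of the regression. -/
def response (h : ℕ → P.𝕏 × P.𝕌) (j : Fin n) (s : ℕ) : ℝ :=
  ((h s).1 : Vec n) j - P.f (h (s - 1)).1 (h (s - 1)).2 j

theorem frobNorm_sq (θ : Mat d n) : frobNorm θ ^ 2 = ∑ j, (θ.col j) ⬝ᵥ (θ.col j) := by
  have h : 0 ≤ ∑ i, ∑ j, θ i j ^ 2 :=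
    Finset.sum_nonneg fun _ _ => Finset.sum_nonneg fun _ _ => sq_nonneg _
  rw [frobNorm, Real.sq_sqrt h, Finset.sum_comm]
  simp [dotProduct, sq]

theorem cost_eq_sum (h : ℕ → P.𝕏 × P.𝕌) (t : ℕ) (θ : Mat d n) :
    P.cost h t θ = ∑ j, (∑ s ∈ Finset.Icc 1 t, (response P h j s - regr P h s ⬝ᵥ θ.col j) ^ 2
      + P.γ * (θ.col j ⬝ᵥ θ.col j)) := by
  rw [Plant.cost, frobNorm_sq, Finset.sum_add_distrib, ← Finset.mul_sum, Finset.sum_comm]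
  congr 1
  refine Finset.sum_congr rfl fun s _ => ?_
  rw [EuclideanSpace.norm_sq_eq]
  refine Finset.sum_congr rfl fun j _ => ?_
  rw [Real.norm_eq_abs, sq_abs]
  congr 1
  simp only [PiLp.sub_apply, response, tmul, mulVec, regr]
  rw [dotProduct_comm]
  simp only [Matrix.transpose_apply, dotProduct, col]
  ring

/-- The least-squares estimate in closed form. -/
theorem estimate_col (hγ : 0 < P.γ) (h : ℕ → P.𝕏 × P.𝕌) {t : ℕ} (ht : t ≠ 0) (j : Fin n) :
    (P.estimate h t).col j
      = (gram P.γ (regr P h) t)⁻¹ *ᵥ weightedSum (regr P h) (response P h j) t := by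
  set v : Fin n → Fin d → ℝ := fun j =>
    (gram P.γ (regr P h) t)⁻¹ *ᵥ weightedSum (regr P h) (response P h j) t with hv
  have hmin := estimate_min P hγ h ht (Matrix.of fun i j => v j i)
  have hA := gram_posDef hγ (regr P h) t
  have hcol : ∀ j, (Matrix.of fun i j => v j i).col j = v j := fun j => rfl
  rw [cost_eq_sum, cost_eq_sum] at hmin
  simp only [scalar_cost_eq hγ, hcol] at hmin
  simp only [Finset.sum_add_distrib, hv, sub_self, zero_dotProduct,
    add_zero, add_le_iff_nonpos_right] at hmin
  -- Comparison with the candidate leaves a sum of nonnegative terms that is at most 0; definiteness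
  -- then identifies the column, so the minimiser is unique.
  have hz := (Finset.sum_eq_zero_iff_of_nonneg fun j _ => PosDef_dotProduct_nonneg hA _).1
    (le_antisymm hmin (Finset.sum_nonneg fun j _ => PosDef_dotProduct_nonneg hA _)) j
      (Finset.mem_univ j)
  by_contra hne
  have := hA.dotProduct_mulVec_pos (sub_ne_zero.2 hne)
  rw [star_trivial] at this
  exact this.ne' hz

end Estimate

/-! ### Measurability of the closed loop -/

section Measurability

variable {P : Plant n m q d}

theorem measurable_regr (hm : MeasurableMaps P) (s : ℕ) :
    Measurable fun h : ℕ → P.𝕏 × P.𝕌 => regr P h s := by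
  have : Measurable fun h : ℕ → P.𝕏 × P.𝕌 => P.regressor h s := hm.ψ.comp (measurable_pi_apply (s - 1))
  exact (WithLp.measurable_ofLp 2 _).comp this

theorem measurable_response (hm : MeasurableMaps P) (j : Fin n) (s : ℕ) :
    Measurable fun h : ℕ → P.𝕏 × P.𝕌 => response P h j s := by
  have h1 : Measurable fun h : ℕ → P.𝕏 × P.𝕌 => P.f (h (s - 1)).1 (h (s - 1)).2 :=
    hm.f.comp (measurable_pi_apply (s - 1))
  have h2 : Measurable fun h : ℕ → P.𝕏 × P.𝕌 => ((h s).1 : Vec n) :=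
    measurable_subtype_coe.comp (measurable_fst.comp (measurable_pi_apply s))
  unfold response
  fun_prop

/-- The estimate is defined by choice, so measurability has to come from its closed form. -/
theorem measurable_estimate (hm : MeasurableMaps P) (hγ : 0 < P.γ) (t : ℕ) :
    Measurable fun h : ℕ → P.𝕏 × P.𝕌 => P.estimate h t := by
  rcases eq_or_ne t 0 with rfl | ht
  · simp [Plant.estimate]
  have h1 : ∀ h : ℕ → P.𝕏 × P.𝕌, P.estimate h t = Matrix.of fun i j =>
      Matrix.mulVec (gram P.γ (regr P h) t)⁻¹ (weightedSum (regr P h) (response P h j) t) i := by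
    intro h
    ext i j
    exact congrFun (estimate_col P hγ h ht j) i
  simp_rw [h1]
  have hof : Measurable fun A : Fin d → Fin n → ℝ => (Matrix.of A : Mat d n) := by
    have hc : Continuous fun A : Fin d → Fin n → ℝ => (Matrix.of A : Mat d n) := continuous_id
    exact hc.measurable
  refine hof.comp ?_
  rw [measurable_pi_iff]; intro i
  rw [measurable_pi_iff]; intro j
  refine (measurable_pi_apply i).comp (measurable_matrix_mulVec ?_ ?_)
  · exact measurable_matrix_inv (measurable_gram (measurable_regr hm) _ _)
  · exact measurable_weightedSum (measurable_regr hm) (measurable_response hm j) t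

/-- The state and the control of time `t + 1` as a function of the history up to time `t`. -/
def next (P : Plant n m q d) (t : ℕ) (h : ℕ → P.𝕏 × P.𝕌) (sw : P.𝕊 × P.𝕎) : P.𝕏 × P.𝕌 :=
  (P.step (h t).1 (h t).2 sw.2,
    P.α (P.step (h t).1 (h t).2 sw.2) sw.1 (P.estimate h t))

theorem history_succ (P : Plant n m q d) (x₀ : P.𝕏) (s : ℕ → P.𝕊) (w : ℕ+ → P.𝕎) (t : ℕ) :
    P.history x₀ s w (t + 1) = Function.update (P.history x₀ s w t) (t + 1)
      (next P t (P.history x₀ s w t) (s (t + 1), w t.succPNat)) := rfl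

theorem measurable_tmul (A : Mat d n) : Measurable (tmul A) := by
  refine Continuous.measurable ?_
  unfold tmul
  fun_prop

theorem measurable_next (hm : MeasurableMaps P) (hγ : 0 < P.γ) (t : ℕ) :
    Measurable fun p : (ℕ → P.𝕏 × P.𝕌) × P.𝕊 × P.𝕎 => next P t p.1 p.2 := by
  have h1 : Measurable fun p : (ℕ → P.𝕏 × P.𝕌) × P.𝕊 × P.𝕎 => p.1 t :=
    (measurable_pi_apply t).comp measurable_fst
  have hstep : Measurable fun p : (ℕ → P.𝕏 × P.𝕌) × P.𝕊 × P.𝕎 =>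
      P.step (p.1 t).1 (p.1 t).2 p.2.2 := by
    refine Measurable.subtype_mk ?_
    exact ((hm.f.comp h1).add ((measurable_tmul P.θ₀).comp (hm.ψ.comp h1))).add
      (measurable_subtype_coe.comp (measurable_snd.comp measurable_snd))
  have hest : Measurable fun p : (ℕ → P.𝕏 × P.𝕌) × P.𝕊 × P.𝕎 => P.estimate p.1 t :=
    (measurable_estimate hm hγ t).comp measurable_fst
  exact hstep.prodMk (hm.α.comp (hstep.prodMk ((measurable_fst.comp measurable_snd).prodMk hest)))

/-- Only the noise up to time `t` is assumed measurable, and the σ-algebra on `Ω` is arbitrary: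
`indepFun_history` applies this with the σ-algebra generated by that noise. -/
theorem measurable_history (hm : MeasurableMaps P) (hγ : 0 < P.γ) {Ω : Type*}
    [MeasurableSpace Ω] {S : ℕ → Ω → P.𝕊} {W : ℕ+ → Ω → P.𝕎} (x₀ : P.𝕏) (t : ℕ)
    (hS : ∀ k ≤ t, Measurable (S k)) (hW : ∀ k < t, Measurable (W k.succPNat)) :
    Measurable fun ω => P.history x₀ (fun k => S k ω) (fun k => W k ω) t := by
  induction t with
  | zero =>
    rw [measurable_pi_iff]
    intro _
    exact measurable_const.prodMk
      (hm.α.comp (measurable_const.prodMk ((hS 0 le_rfl).prodMk measurable_const)))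
  | succ t ih =>
    have ih := ih (fun k hk => hS k (by omega)) (fun k hk => hW k (by omega))
    simp_rw [history_succ]
    rw [measurable_pi_iff]
    intro k
    rcases eq_or_ne k (t + 1) with rfl | hk
    · simp only [Function.update_self]
      exact (measurable_next hm hγ t).comp
        (ih.prodMk ((hS _ le_rfl).prodMk (hW t (Nat.lt_succ_self t))))
    · simp only [Function.update_of_ne hk]
      exact (measurable_pi_apply k).comp ih

end Measurability

/-! ### Independence of the future noise from the past -/

section Independence

/-- A finite intersection splits into one event of each family; independence between the families
separates the two, and independence within each family factors them. -/
theorem iIndep_sum_elim {Ω ι κ : Type*} [MeasurableSpace Ω] {μ : Measure Ω}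
    {m₁ : ι → MeasurableSpace Ω} {m₂ : κ → MeasurableSpace Ω} (h₁ : iIndep m₁ μ)
    (h₂ : iIndep m₂ μ) (h : Indep (⨆ i, m₁ i) (⨆ k, m₂ k) μ) :
    iIndep (Sum.elim m₁ m₂) μ := by
  classical
  rw [iIndep_iff]
  intro s f hf
  rw [← Finset.toLeft_disjSum_toRight (u := s), Finset.prod_disjSum]
  have hl : ∀ i ∈ s.toLeft, MeasurableSet[m₁ i] (f (Sum.inl i)) := fun i hi =>
    hf _ (Finset.mem_toLeft.1 hi)
  have hr : ∀ i ∈ s.toRight, MeasurableSet[m₂ i] (f (Sum.inr i)) := fun i hi =>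
    hf _ (Finset.mem_toRight.1 hi)
  rw [← (iIndep_iff m₁ μ).1 h₁ s.toLeft (f := fun i => f (Sum.inl i)) hl,
    ← (iIndep_iff m₂ μ).1 h₂ s.toRight (f := fun i => f (Sum.inr i)) hr]
  have : (⋂ i ∈ s.toLeft.disjSum s.toRight, f i)
      = (⋂ i ∈ s.toLeft, f (Sum.inl i)) ∩ ⋂ i ∈ s.toRight, f (Sum.inr i) := by
    ext ω
    simp
  rw [this]
  refine (Indep_iff _ _ μ).1 h _ _ ?_ ?_
  · exact Finset.measurableSet_biInter _ fun i hi => (le_iSup m₁ i) _ (hl i hi)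
  · exact Finset.measurableSet_biInter _ fun i hi => (le_iSup m₂ i) _ (hr i hi)

variable {P : Plant n m q d} {Ω : Type*} [MeasurableSpace Ω] {μ : Measure Ω}
  {S : ℕ → Ω → P.𝕊} {W : ℕ+ → Ω → P.𝕎} {μs : Measure P.𝕊} {μw : Measure P.𝕎} {σw : ℝ≥0}

theorem iIndep_noise (hN : NoiseModel μ P S W μs μw σw) :
    iIndep (Sum.elim (fun k => MeasurableSpace.comap (S k) inferInstance)
      (fun k => MeasurableSpace.comap (W k) inferInstance)) μ := by
  refine iIndep_sum_elim hN.indep_S hN.indep_W ?_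
  have h := hN.indep_W_S.symm
  rw [IndepFun_iff_Indep] at h
  simpa only [MeasurableSpace.pi, MeasurableSpace.comap_iSup, MeasurableSpace.comap_comp,
    Function.comp_def] using h

/-- The history up to `t` is a function of `S 0, …, S t` and `W 1, …, W t`; the pair of time `t + 1`
is generated by indices outside this set `A`. -/
theorem indepFun_history [IsProbabilityMeasure μ] (hN : NoiseModel μ P S W μs μw σw)
    (hm : MeasurableMaps P) (hγ : 0 < P.γ) (x₀ : P.𝕏) (t : ℕ) :
    IndepFun (fun ω => P.history x₀ (fun k => S k ω) (fun k => W k ω) t)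
      (fun ω => (S (t + 1) ω, W t.succPNat ω)) μ := by
  set mm : ℕ ⊕ ℕ+ → MeasurableSpace Ω :=
    Sum.elim (fun k => MeasurableSpace.comap (S k) inferInstance)
      (fun k => MeasurableSpace.comap (W k) inferInstance) with hmm
  set A : Set (ℕ ⊕ ℕ+) := {i | Sum.elim (· ≤ t) (fun k : ℕ+ => (k : ℕ) ≤ t) i} with hA
  have hind := indep_iSup_of_disjoint (m := mm) (S := A) (T := Aᶜ) ?_ (iIndep_noise hN)
    disjoint_compl_right
  · refine indep_of_indep_of_le_left (indep_of_indep_of_le_right hind ?_) ?_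
    · refine Measurable.comap_le (Measurable.prodMk ?_ ?_)
      · refine Measurable.mono (comap_measurable (S (t + 1))) ?_ le_rfl
        refine le_biSup mm (i := Sum.inl (t + 1)) ?_
        simp [hA]
      · refine Measurable.mono (comap_measurable (W t.succPNat)) ?_ le_rfl
        refine le_biSup mm (i := Sum.inr t.succPNat) ?_
        simp [hA]
    · refine Measurable.comap_le ?_
      -- The ambient σ-algebra is replaced by the one generated by the noise with indices in `A`.
      refine @measurable_history n m q d P hm hγ Ω (⨆ i ∈ A, mm i) S W x₀ t ?_ ?_
      · intro k hk
        refine Measurable.mono (comap_measurable (S k)) ?_ le_rfl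
        refine le_biSup mm (i := Sum.inl k) ?_
        simpa [hA, Nat.succ_le_iff] using hk
      · intro k hk
        refine Measurable.mono (comap_measurable (W k.succPNat)) ?_ le_rfl
        refine le_biSup mm (i := Sum.inr k.succPNat) ?_
        simpa [hA, Nat.succ_le_iff] using hk
  · rintro (k | k)
    · exact (hN.measurable_S k).comap_le
    · exact (hN.measurable_W k).comap_le

theorem map_noise_pair (hN : NoiseModel μ P S W μs μw σw) [IsProbabilityMeasure μ] (t : ℕ) :
    μ.map (fun ω => (S (t + 1) ω, W t.succPNat ω)) = μs.prod μw := by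
  have h : IndepFun (S (t + 1)) (W t.succPNat) μ :=
    hN.indep_W_S.symm.comp (measurable_pi_apply (t + 1)) (measurable_pi_apply t.succPNat)
  rw [(indepFun_iff_map_prod_eq_prod_map_map (hN.measurable_S _).aemeasurable
    (hN.measurable_W _).aemeasurable).1 h, hN.law_S, hN.law_W]

/-- Integration over the noise of time `t + 1` with the history up to time `t` frozen. -/
theorem lintegral_history [IsProbabilityMeasure μ] (hN : NoiseModel μ P S W μs μw σw)
    (hm : MeasurableMaps P) (hγ : 0 < P.γ) (x₀ : P.𝕏) (t : ℕ)
    {φ : (ℕ → P.𝕏 × P.𝕌) × P.𝕊 × P.𝕎 → ℝ≥0∞} (hφ : Measurable φ) :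
    ∫⁻ ω, φ (P.history x₀ (fun k => S k ω) (fun k => W k ω) t, S (t + 1) ω, W t.succPNat ω) ∂μ
      = ∫⁻ ω, ∫⁻ sw, φ (P.history x₀ (fun k => S k ω) (fun k => W k ω) t, sw)
          ∂(μs.prod μw) ∂μ := by
  have h := lintegral_indepFun (measurable_history hm hγ x₀ t (fun k _ => hN.measurable_S k)
    (fun k _ => hN.measurable_W _)) ((hN.measurable_S (t + 1)).prodMk (hN.measurable_W t.succPNat))
    (indepFun_history hN hm hγ x₀ t) hφ
  rw [map_noise_pair hN t] at h
  exact h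

end Independence

/-! ### Functionals of the closed loop -/

section OneStep

variable {P : Plant n m q d} {Ω : Type*} [MeasurableSpace Ω] {μ : Measure Ω}
  {S : ℕ → Ω → P.𝕊} {W : ℕ+ → Ω → P.𝕎} {μs : Measure P.𝕊} {μw : Measure P.𝕎} {σw : ℝ≥0}

/-- A functional of sequences of states and controls that depends on the times `0, …, t` only. -/
def DependsUpTo (P : Plant n m q d) {β : Type*} (t : ℕ) (G : (ℕ → P.𝕏 × P.𝕌) → β) : Prop :=
  ∀ h h' : ℕ → P.𝕏 × P.𝕌, (∀ k ≤ t, h k = h' k) → G h = G h'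

theorem path_succ_congr (x₀ : P.𝕏) (s : ℕ → P.𝕊) (w : ℕ+ → P.𝕎) (t : ℕ) :
    ∀ k ≤ t + 1, P.path x₀ s w k = Function.update (P.history x₀ s w t) (t + 1)
      (next P t (P.history x₀ s w t) (s (t + 1), w t.succPNat)) k := fun k hk => by
  rw [← history_succ, history_of_le P x₀ s w hk]

theorem measurable_path (hm : MeasurableMaps P) (hγ : 0 < P.γ)
    (hN : NoiseModel μ P S W μs μw σw) (x₀ : P.𝕏) :
    Measurable fun ω => P.path x₀ (fun k => S k ω) (fun k => W k ω) := by
  rw [measurable_pi_iff]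
  intro t
  exact (measurable_pi_apply t).comp (measurable_history hm hγ x₀ t
    (fun k _ => hN.measurable_S k) (fun k _ => hN.measurable_W _))

/-- A one-step conditional bound yields a bound between expectations of consecutive times. -/
theorem setLIntegral_path_succ_le [IsProbabilityMeasure μ] (hN : NoiseModel μ P S W μs μw σw)
    (hm : MeasurableMaps P) (hγ : 0 < P.γ) (x₀ : P.𝕏) (t : ℕ)
    {G G' : (ℕ → P.𝕏 × P.𝕌) → ℝ≥0∞} (hG : Measurable G) (hG' : Measurable G')
    (hGt : DependsUpTo P t G) (hGt' : DependsUpTo P (t + 1) G') {K : ℝ≥0∞}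
    (hstep : ∀ h, ∫⁻ sw, G' (Function.update h (t + 1) (next P t h sw)) ∂(μs.prod μw) ≤ K * G h)
    {B : Set (ℕ → P.𝕏 × P.𝕌)} (hB : MeasurableSet B) (hBt : DependsUpTo P t (· ∈ B)) :
    ∫⁻ ω in {ω | P.path x₀ (fun k => S k ω) (fun k => W k ω) ∈ B},
        G' (P.path x₀ (fun k => S k ω) (fun k => W k ω)) ∂μ
      ≤ K * ∫⁻ ω in {ω | P.path x₀ (fun k => S k ω) (fun k => W k ω) ∈ B},
        G (P.path x₀ (fun k => S k ω) (fun k => W k ω)) ∂μ := by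
  have hpath := measurable_path hm hγ hN x₀
  have hA : MeasurableSet {ω | P.path x₀ (fun k => S k ω) (fun k => W k ω) ∈ B} := hpath hB
  have hGm : Measurable fun ω => G (P.path x₀ (fun k => S k ω) (fun k => W k ω)) := hG.comp hpath
  have hcong : ∀ ω, ∀ k ≤ t, P.path x₀ (fun k => S k ω) (fun k => W k ω) k
      = P.history x₀ (fun k => S k ω) (fun k => W k ω) t k :=
    fun ω k hk => (history_of_le P x₀ _ _ hk).symm
  have hupd : Measurable fun p : (ℕ → P.𝕏 × P.𝕌) × P.𝕊 × P.𝕎 =>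
      Function.update p.1 (t + 1) (next P t p.1 p.2) := by
    rw [measurable_pi_iff]
    intro k
    rcases eq_or_ne k (t + 1) with rfl | hk
    · simpa using measurable_next hm hγ t
    · simp only [Function.update_of_ne hk]
      exact (measurable_pi_apply k).comp measurable_fst
  -- A function of the history and the fresh noise, as `lintegral_history` requires. Entries of the
  -- updated sequence after `t + 1` are not those of the path, but `G'` does not see them.
  let φ : (ℕ → P.𝕏 × P.𝕌) × P.𝕊 × P.𝕎 → ℝ≥0∞ := fun p =>
    (B.indicator 1 p.1) * G' (Function.update p.1 (t + 1) (next P t p.1 p.2))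
  have hφ : Measurable φ :=
    ((measurable_one.indicator hB).comp measurable_fst).mul (hG'.comp hupd)
  rw [← lintegral_indicator hA, ← lintegral_indicator hA,
    ← lintegral_const_mul _ (hGm.indicator hA)]
  calc _ = ∫⁻ ω, φ (P.history x₀ (fun k => S k ω) (fun k => W k ω) t, S (t + 1) ω,
          W t.succPNat ω) ∂μ := by
        refine lintegral_congr fun ω => ?_
        have h1 : (P.path x₀ (fun k => S k ω) (fun k => W k ω) ∈ B)
            = (P.history x₀ (fun k => S k ω) (fun k => W k ω) t ∈ B) := hBt _ _ (hcong ω)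
        have h2 := hGt' _ _ (path_succ_congr x₀ (fun k => S k ω) (fun k => W k ω) t)
        simp only [φ, ← h2]
        by_cases hω : P.path x₀ (fun k => S k ω) (fun k => W k ω) ∈ B
        · rw [Set.indicator_of_mem (by exact hω), Set.indicator_of_mem (h1.mp hω)]
          simp
        · rw [Set.indicator_of_notMem (by exact hω), Set.indicator_of_notMem (fun h => hω (h1.mpr h))]
          simp
    _ = ∫⁻ ω, ∫⁻ sw, φ (P.history x₀ (fun k => S k ω) (fun k => W k ω) t, sw)
          ∂(μs.prod μw) ∂μ := lintegral_history hN hm hγ x₀ t hφ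
    _ ≤ _ := by
        refine lintegral_mono fun ω => ?_
        have h1 : (P.path x₀ (fun k => S k ω) (fun k => W k ω) ∈ B)
            = (P.history x₀ (fun k => S k ω) (fun k => W k ω) t ∈ B) := hBt _ _ (hcong ω)
        have h2 := hGt _ _ (hcong ω)
        simp only [φ]
        have hGu : Measurable fun sw => G' (Function.update
            (P.history x₀ (fun k => S k ω) (fun k => W k ω) t) (t + 1)
            (next P t (P.history x₀ (fun k => S k ω) (fun k => W k ω) t) sw)) :=
          hG'.comp (hupd.comp measurable_prodMk_left)
        rw [lintegral_const_mul _ hGu]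
        by_cases hω : P.path x₀ (fun k => S k ω) (fun k => W k ω) ∈ B
        · rw [Set.indicator_of_mem (s := {ω | P.path x₀ _ _ ∈ B}) (by exact hω),
            Set.indicator_of_mem (h1.mp hω), h2]
          simpa using hstep _
        · rw [Set.indicator_of_notMem (s := {ω | P.path x₀ _ _ ∈ B}) (by exact hω),
            Set.indicator_of_notMem (fun h => hω (h1.mpr h))]
          simp

theorem isProbabilityMeasure_process [IsProbabilityMeasure μ]
    (hN : NoiseModel μ P S W μs μw σw) : IsProbabilityMeasure μw := by
  rw [← hN.law_W 1]
  exact Measure.isProbabilityMeasure_map (hN.measurable_W 1).aemeasurable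

theorem isProbabilityMeasure_exploration [IsProbabilityMeasure μ]
    (hN : NoiseModel μ P S W μs μw σw) : IsProbabilityMeasure μs := by
  rw [← hN.law_S 0]
  exact Measure.isProbabilityMeasure_map (hN.measurable_S 0).aemeasurable

end OneStep

/-! ### Persistence of excitation along the closed loop -/

section Excitation

variable {P : Plant n m q d} {Ω : Type*} [MeasurableSpace Ω] {μ : Measure Ω}
  {S : ℕ → Ω → P.𝕊} {W : ℕ+ → Ω → P.𝕎} {μs : Measure P.𝕊} {μw : Measure P.𝕎} {σw : ℝ≥0}

open scoped Classical in
/-- Whether the regressor generated by a state and a control is exciting in the direction `ζ`. -/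
def hit (P : Plant n m q d) (c : ℝ) (ζ : Vec d) (p : P.𝕏 × P.𝕌) : ℝ :=
  if c ≤ |inner ℝ ζ (P.ψ p.1 p.2)| ^ 2 then 1 else 0

theorem measurableSet_hit (hm : MeasurableMaps P) (c : ℝ) (ζ : Vec d) :
    MeasurableSet {p : P.𝕏 × P.𝕌 | c ≤ |inner ℝ ζ (P.ψ p.1 p.2)| ^ 2} := by
  have h : Measurable fun p : P.𝕏 × P.𝕌 => inner ℝ ζ (P.ψ p.1 p.2) :=
    (measurable_const.inner hm.ψ)
  refine measurableSet_le measurable_const ?_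
  simp only [sq_abs]
  exact h.pow_const 2

theorem measurable_hit (hm : MeasurableMaps P) (c : ℝ) (ζ : Vec d) : Measurable (hit P c ζ) := by
  classical
  unfold hit
  exact Measurable.ite (measurableSet_hit hm c ζ) measurable_const measurable_const

/-- The exponential weight `2 ^ (-K)`, where `K` is the number of exciting times in `1, …, N`. -/
def hitWeight (P : Plant n m q d) (c : ℝ) (ζ : Vec d) (N : ℕ) (h : ℕ → P.𝕏 × P.𝕌) : ℝ≥0∞ :=
  ENNReal.ofReal (Real.exp (-(Real.log 2 * ∑ k ∈ Finset.Icc 1 N, hit P c ζ (h k))))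

theorem measurable_hitWeight (hm : MeasurableMaps P) (c : ℝ) (ζ : Vec d) (N : ℕ) :
    Measurable (hitWeight P c ζ N) := by
  unfold hitWeight
  have : Measurable fun h : ℕ → P.𝕏 × P.𝕌 => ∑ k ∈ Finset.Icc 1 N, hit P c ζ (h k) :=
    Finset.measurable_sum _ fun k _ => (measurable_hit hm c ζ).comp (measurable_pi_apply k)
  fun_prop

theorem dependsUpTo_hitWeight (c : ℝ) (ζ : Vec d) (N : ℕ) :
    DependsUpTo P N (hitWeight P c ζ N) := by
  intro h h' hh
  unfold hitWeight
  congr 4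
  exact Finset.sum_congr rfl fun k hk => by rw [hh k (Finset.mem_Icc.1 hk).2]

/-- With conditional probability `a ≥ p` of a hit, the mean of `2 ^ (-hit)` is `1 - a / 2 ≤ 1 - p /
2 ≤ exp (-p / 2)`. The history is frozen, so the current estimate can serve as the `ϑ` of the
excitation condition. -/
theorem lintegral_hit_le [IsProbabilityMeasure μs] [IsProbabilityMeasure μw]
    (hm : MeasurableMaps P) (hγ : 0 < P.γ) {c p : ℝ} (hE : GloballyExcited P μs μw c p) {ζ : Vec d}
    (hζ : ‖ζ‖ = 1) (t : ℕ) (h : ℕ → P.𝕏 × P.𝕌) :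
    ∫⁻ sw, ENNReal.ofReal (Real.exp (-(Real.log 2 * hit P c ζ (next P t h sw)))) ∂(μs.prod μw)
      ≤ ENNReal.ofReal (Real.exp (-(p / 2))) := by
  set ν := μs.prod μw
  have hnext : Measurable (next P t h) := (measurable_next hm hγ t).comp measurable_prodMk_left
  set A : Set (P.𝕊 × P.𝕎) :=
    {sw | c ≤ |inner ℝ ζ (P.ψ (next P t h sw).1 (next P t h sw).2)| ^ 2} with hA
  have hAm : MeasurableSet A := hnext (measurableSet_hit hm c ζ)
  -- The point at which excitation is applied is the noise-free successor; that it is a state is the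
  -- case `w = 0` of `maps_to`.
  have hx : P.g (h t).1 (h t).2 0 ∈ P.𝕏 := P.maps_to _ _ _ (Set.mem_insert _ _)
  have hpA : ENNReal.ofReal p ≤ ν A := by
    refine (hE.2.2 (P.estimate h t) _ hx ζ hζ).trans (measure_mono ?_)
    rintro sw ⟨hxw, hc⟩
    have hs : (⟨P.g (h t).1 (h t).2 0 + sw.2, hxw⟩ : P.𝕏) = P.step (h t).1 (h t).2 sw.2 := by
      refine Subtype.ext ?_
      simp [Plant.step, Plant.g]
    rw [hs] at hc
    exact hc
  have hval : ∀ sw, ENNReal.ofReal (Real.exp (-(Real.log 2 * hit P c ζ (next P t h sw))))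
      = A.indicator (fun _ => 2⁻¹) sw + Aᶜ.indicator (fun _ => 1) sw := by
    intro sw
    by_cases hs : sw ∈ A
    · have h1 : hit P c ζ (next P t h sw) = 1 := if_pos hs
      rw [h1, mul_one, Real.exp_neg, Real.exp_log two_pos, Set.indicator_of_mem hs,
        Set.indicator_of_notMem (by simpa using hs), add_zero, ENNReal.ofReal_inv_of_pos two_pos]
      simp
    · have h1 : hit P c ζ (next P t h sw) = 0 := if_neg hs
      rw [h1, Set.indicator_of_notMem hs, Set.indicator_of_mem (by simpa using hs)]
      simp
  simp_rw [hval]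
  rw [lintegral_add_left (measurable_const.indicator hAm), lintegral_indicator_const hAm,
    lintegral_indicator_const hAm.compl, one_mul, prob_compl_eq_one_sub hAm]
  have hA1 : ν A ≤ 1 := prob_le_one
  have hfin : ν A ≠ ⊤ := measure_ne_top _ _
  lift ν A to ℝ≥0 using hfin with a ha
  have hp : p ≤ a := by
    have := ENNReal.toReal_mono ENNReal.coe_ne_top hpA
    rwa [ENNReal.toReal_ofReal hE.2.1.le, ENNReal.coe_toReal] at this
  have ha1 : (a : ℝ) ≤ 1 := by exact_mod_cast hA1
  have : (2⁻¹ : ℝ≥0∞) * a + (1 - a) = ENNReal.ofReal (1 - a / 2) := by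
    rw [← ENNReal.ofReal_coe_nnreal, ← ENNReal.ofReal_one, ← ENNReal.ofReal_sub _ a.coe_nonneg,
      ← ENNReal.ofReal_ofNat 2, ← ENNReal.ofReal_inv_of_pos two_pos, ← ENNReal.ofReal_mul (by simp),
      ← ENNReal.ofReal_add (by positivity) (by linarith)]
    congr 1
    ring
  rw [this]
  refine ENNReal.ofReal_le_ofReal ?_
  have := Real.add_one_le_exp (-(p / 2))
  linarith

/-- The one-step factor is uniform over all pasts, so it can be iterated although the hits are
dependent. -/
theorem lintegral_hitWeight_le [IsProbabilityMeasure μ] (hN : NoiseModel μ P S W μs μw σw)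
    (hm : MeasurableMaps P) (hγ : 0 < P.γ) (x₀ : P.𝕏) {c p : ℝ}
    (hE : GloballyExcited P μs μw c p) {ζ : Vec d} (hζ : ‖ζ‖ = 1) (N : ℕ) :
    ∫⁻ ω, hitWeight P c ζ N (P.path x₀ (fun k => S k ω) (fun k => W k ω)) ∂μ
      ≤ ENNReal.ofReal (Real.exp (-(p / 2))) ^ N := by
  have := isProbabilityMeasure_process hN
  have := isProbabilityMeasure_exploration hN
  induction N with
  | zero => simp [hitWeight]
  | succ N ih =>
    have hstep : ∀ h : ℕ → P.𝕏 × P.𝕌,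
        ∫⁻ sw, hitWeight P c ζ (N + 1) (Function.update h (N + 1) (next P N h sw)) ∂(μs.prod μw)
          ≤ ENNReal.ofReal (Real.exp (-(p / 2))) * hitWeight P c ζ N h := by
      intro h
      have hw : ∀ sw, hitWeight P c ζ (N + 1) (Function.update h (N + 1) (next P N h sw))
          = hitWeight P c ζ N h
            * ENNReal.ofReal (Real.exp (-(Real.log 2 * hit P c ζ (next P N h sw)))) := by
        intro sw
        rw [← dependsUpTo_hitWeight c ζ N (Function.update h (N + 1) (next P N h sw)) h
          fun k hk => Function.update_of_ne (by omega) _ _]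
        unfold hitWeight
        rw [Finset.sum_Icc_succ_top (by omega), Function.update_self,
          ← ENNReal.ofReal_mul (Real.exp_nonneg _), ← Real.exp_add]
        congr 2
        ring
      simp_rw [hw]
      rw [lintegral_const_mul']
      · rw [mul_comm]
        gcongr
        exact lintegral_hit_le hm hγ hE hζ N h
      · exact ENNReal.ofReal_ne_top
    have h := setLIntegral_path_succ_le hN hm hγ x₀ N (measurable_hitWeight hm c ζ N)
      (measurable_hitWeight hm c ζ (N + 1)) (dependsUpTo_hitWeight c ζ N)
      (dependsUpTo_hitWeight c ζ (N + 1)) hstep MeasurableSet.univ (fun _ _ _ => rfl)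
    simp only [Set.mem_univ, Set.ofPred_true, Measure.restrict_univ] at h
    rw [pow_succ, mul_comm]
    exact h.trans (by gcongr)

/-- Chernoff bound: the excitation in a fixed direction is unlikely to be small. -/
theorem measure_small_excitation_le [IsProbabilityMeasure μ] (hN : NoiseModel μ P S W μs μw σw)
    (hm : MeasurableMaps P) (hγ : 0 < P.γ) (x₀ : P.𝕏) {c p : ℝ}
    (hE : GloballyExcited P μs μw c p) {ζ : Vec d} (hζ : ‖ζ‖ = 1) (N : ℕ) :
    μ {ω | ∑ k ∈ Finset.Icc 1 N, (inner ℝ ζ (P.ψ (P.path x₀ (fun k => S k ω) (fun k => W k ω) k).1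
        (P.path x₀ (fun k => S k ω) (fun k => W k ω) k).2)) ^ 2 < c * p * N / 2}
      ≤ ENNReal.ofReal (Real.exp (-((1 - Real.log 2) * p * N / 2))) := by
  have hc := hE.1
  have hlog : 0 < Real.log 2 := Real.log_pos one_lt_two
  -- The value of the weight at `p N / 2` hits, half the guaranteed mean. Markov's inequality
  -- compares it with `exp (-p N / 2)`, and the quotient produces the constant `1 - log 2`.
  set a : ℝ≥0∞ := ENNReal.ofReal (Real.exp (-(Real.log 2 * (p * N / 2)))) with ha
  have ha0 : a ≠ 0 := by simp [ha, Real.exp_pos]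
  have hmark := mul_meas_ge_le_lintegral₀ (μ := μ) (((measurable_hitWeight hm c ζ N).comp
    (measurable_path hm hγ hN x₀)).aemeasurable) a
  have hsub : {ω | ∑ k ∈ Finset.Icc 1 N, (inner ℝ ζ (P.ψ (P.path x₀ (fun k => S k ω)
      (fun k => W k ω) k).1 (P.path x₀ (fun k => S k ω) (fun k => W k ω) k).2)) ^ 2 < c * p * N / 2}
      ⊆ {ω | a ≤ (hitWeight P c ζ N ∘ fun ω => P.path x₀ (fun k => S k ω) (fun k => W k ω)) ω} := by
    intro ω hω
    simp only [Set.mem_ofPred_eq, Function.comp_apply] at hω ⊢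
    unfold hitWeight
    refine ENNReal.ofReal_le_ofReal (Real.exp_le_exp.2 (neg_le_neg ?_))
    refine mul_le_mul_of_nonneg_left ?_ hlog.le
    have h1 : c * ∑ k ∈ Finset.Icc 1 N, hit P c ζ (P.path x₀ (fun k => S k ω) (fun k => W k ω) k)
        ≤ ∑ k ∈ Finset.Icc 1 N, (inner ℝ ζ (P.ψ (P.path x₀ (fun k => S k ω)
          (fun k => W k ω) k).1 (P.path x₀ (fun k => S k ω) (fun k => W k ω) k).2)) ^ 2 := by
      rw [Finset.mul_sum]
      refine Finset.sum_le_sum fun k _ => ?_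
      unfold hit
      split_ifs with h
      · rwa [mul_one, ← sq_abs]
      · rw [mul_zero]; positivity
    have h2 := h1.trans_lt hω
    rw [show c * p * N / 2 = c * (p * N / 2) by ring] at h2
    exact (lt_of_mul_lt_mul_left h2 hc.le).le
  have h1 : a * μ {ω | a ≤ (hitWeight P c ζ N ∘ fun ω => P.path x₀ (fun k => S k ω)
      (fun k => W k ω)) ω} ≤ ENNReal.ofReal (Real.exp (-(p * N / 2))) := by
    refine hmark.trans ((lintegral_hitWeight_le hN hm hγ x₀ hE hζ N).trans_eq ?_)
    rw [← ENNReal.ofReal_pow (Real.exp_nonneg _), ← Real.exp_nat_mul]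
    congr 2
    ring
  have h2 : ENNReal.ofReal (Real.exp (-(p * N / 2)))
      = a * ENNReal.ofReal (Real.exp (-((1 - Real.log 2) * p * N / 2))) := by
    rw [ha, ← ENNReal.ofReal_mul (Real.exp_nonneg _), ← Real.exp_add]
    congr 2
    ring
  rw [h2, ENNReal.mul_le_mul_iff_right ha0 ENNReal.ofReal_ne_top] at h1
  exact (measure_mono hsub).trans h1

end Excitation

/-! ### Self-normalised sums -/

section SelfNormalized

open Matrix

variable {ι : Type*} [Fintype ι] [DecidableEq ι]

/-- The squared norm of the weighted sum `∑ w s • z s` in the inverse of the Gram matrix. -/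
def selfNorm (γ : ℝ) (z : ℕ → ι → ℝ) (w : ℕ → ℝ) (t : ℕ) : ℝ :=
  weightedSum z w t ⬝ᵥ (gram γ z t)⁻¹ *ᵥ weightedSum z w t

/-- The mixture supermartingale of the self-normalised sums. -/
def mixture (γ σ : ℝ) (z : ℕ → ι → ℝ) (w : ℕ → ℝ) (t : ℕ) : ℝ :=
  Real.exp (selfNorm γ z w t / (2 * σ ^ 2)) / √((gram γ z t).det / γ ^ Fintype.card ι)

theorem mixture_zero {γ : ℝ} (hγ : 0 < γ) (σ : ℝ) (z : ℕ → ι → ℝ) (w : ℕ → ℝ) :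
    mixture γ σ z w 0 = 1 := by
  simp [mixture, selfNorm, weightedSum, gram, hγ.ne']

theorem mixture_nonneg (γ σ : ℝ) (z : ℕ → ι → ℝ) (w : ℕ → ℝ) (t : ℕ) : 0 ≤ mixture γ σ z w t := by
  unfold mixture
  positivity

/-- The rank-one update of the inverse form and the matrix determinant lemma make the increment
depend on the past through two scalars only. The multivariate Gaussian mixture thus reduces to a
one-dimensional integral at each step. -/
theorem mixture_succ {γ : ℝ} (hγ : 0 < γ) (σ : ℝ) (z : ℕ → ι → ℝ) (w : ℕ → ℝ) (t : ℕ) :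
    mixture γ σ z w (t + 1) = mixture γ σ z w t *
      (Real.exp ((2 * w (t + 1) * (z (t + 1) ⬝ᵥ (gram γ z t)⁻¹ *ᵥ weightedSum z w t)
        + w (t + 1) ^ 2 * (z (t + 1) ⬝ᵥ (gram γ z t)⁻¹ *ᵥ z (t + 1))
        - (z (t + 1) ⬝ᵥ (gram γ z t)⁻¹ *ᵥ weightedSum z w t) ^ 2)
        / (1 + z (t + 1) ⬝ᵥ (gram γ z t)⁻¹ *ᵥ z (t + 1)) / (2 * σ ^ 2))
        / √(1 + z (t + 1) ⬝ᵥ (gram γ z t)⁻¹ *ᵥ z (t + 1))) := by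
  have hA := gram_posDef hγ z t
  have hA' := gram_posDef hγ z (t + 1)
  rw [gram_succ] at hA'
  unfold mixture selfNorm
  rw [gram_succ, weightedSum_succ, inv_quadratic_add hA _ _ _ hA', det_add_vecMulVec hA,
    add_div, Real.exp_add, mul_div_right_comm (gram γ z t).det, Real.sqrt_mul (div_nonneg hA.det_pos.le (by positivity)),
    mul_div_mul_comm]

/-- One step of the mixture supermartingale, in integrated form. -/
theorem lintegral_mixture_step_le {ν : Measure ℝ} [IsProbabilityMeasure ν] {σ : ℝ}
    (hν : IsSubGaussianLaw ν σ) {a : ℝ} (ha : 0 ≤ a) (b : ℝ) :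
    ∫⁻ w, ENNReal.ofReal (Real.exp ((2 * w * b + w ^ 2 * a - b ^ 2) / (1 + a) / (2 * σ ^ 2))
      / √(1 + a)) ∂ν ≤ 1 := by
  have hs : 0 < √(1 + a) := Real.sqrt_pos.2 (by linarith)
  have hs1 : 1 ≤ √(1 + a) := Real.one_le_sqrt.2 (by linarith)
  -- For `σ = 0` division by zero makes the exponent 0, and only the factor `1 / √(1 + a) ≤ 1`
  -- remains.
  rcases eq_or_ne σ 0 with rfl | hσ
  · simp only [ne_eq, OfNat.ofNat_ne_zero, not_false_eq_true, zero_pow, mul_zero, div_zero,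
      Real.exp_zero, lintegral_const, measure_univ, mul_one]
    rw [← ENNReal.ofReal_one]
    exact ENNReal.ofReal_le_ofReal (div_le_one_of_le₀ hs1 hs.le)
  -- The mean and variance of the mixing variable in the direction of the new regressor, given the
  -- past; in particular `1 + σ² v = 1 + a`.
  have h := lintegral_exp_quadratic_le hν (b / σ ^ 2) (Real.toNNReal (a / σ ^ 2))
  rw [Real.coe_toNNReal _ (by positivity)] at h
  have h1 : σ ^ 2 * (a / σ ^ 2) = a := by field_simp
  have h2 : ∀ w : ℝ, (2 * (b / σ ^ 2) * w + a / σ ^ 2 * w ^ 2 - σ ^ 2 * (b / σ ^ 2) ^ 2)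
      / (2 * (1 + a)) = (2 * w * b + w ^ 2 * a - b ^ 2) / (1 + a) / (2 * σ ^ 2) := by
    intro w
    field_simp
  simp only [h1, h2] at h
  simp_rw [div_eq_mul_inv _ √(1 + a), ENNReal.ofReal_mul (Real.exp_nonneg _)]
  rw [lintegral_mul_const' _ _ ENNReal.ofReal_ne_top]
  calc _ ≤ ENNReal.ofReal √(1 + a) * ENNReal.ofReal (√(1 + a))⁻¹ := by gcongr
    _ = 1 := by
      rw [← ENNReal.ofReal_mul hs.le, mul_inv_cancel₀ hs.ne', ENNReal.ofReal_one]

end SelfNormalized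

/-! ### The noise along the closed loop: self-normalised sums and uniform tails. -/

section Noise

open Matrix

variable (P : Plant n m q d)

/-- The coordinates of the process noise, recovered from the states and controls. -/
def noiseCoord (h : ℕ → P.𝕏 × P.𝕌) (j : Fin n) (s : ℕ) : ℝ :=
  response P h j s - P.θ₀.col j ⬝ᵥ regr P h s

theorem regr_congr {h h' : ℕ → P.𝕏 × P.𝕌} {s : ℕ} (hh : h (s - 1) = h' (s - 1)) :
    regr P h s = regr P h' s := by
  simp only [regr, Plant.regressor, hh]

theorem noiseCoord_congr {h h' : ℕ → P.𝕏 × P.𝕌} (j : Fin n) {s : ℕ}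
    (hh : h (s - 1) = h' (s - 1)) (hh' : h s = h' s) : noiseCoord P h j s = noiseCoord P h' j s := by
  simp only [noiseCoord, response, regr_congr P hh, hh, hh']

theorem step_apply (x : P.𝕏) (u : P.𝕌) (w : P.𝕎) (j : Fin n) :
    (P.step x u w : Vec n) j = P.f x u j + P.θ₀.col j ⬝ᵥ WithLp.ofLp (P.ψ x u) + (w : Vec n) j := by
  simp only [Plant.step, Plant.g, tmul, PiLp.add_apply, mulVec]
  rfl

theorem noiseCoord_update (h : ℕ → P.𝕏 × P.𝕌) (j : Fin n) (t : ℕ) (sw : P.𝕊 × P.𝕎) :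
    noiseCoord P (Function.update h (t + 1) (next P t h sw)) j (t + 1) = (sw.2 : Vec n) j := by
  have h1 : Function.update h (t + 1) (next P t h sw) t = h t :=
    Function.update_of_ne (by omega) _ _
  simp only [noiseCoord, response, regr, Plant.regressor, Nat.add_sub_cancel, h1,
    Function.update_self]
  simp only [next, step_apply]
  ring

theorem noiseCoord_path (x₀ : P.𝕏) (s : ℕ → P.𝕊) (w : ℕ+ → P.𝕎) (j : Fin n) (t : ℕ) :
    noiseCoord P (P.path x₀ s w) j (t + 1) = (w t.succPNat : Vec n) j := by
  rw [noiseCoord_congr P j (path_succ_congr x₀ s w t t (by omega))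
    (path_succ_congr x₀ s w t (t + 1) le_rfl), noiseCoord_update]

theorem gram_congr {γ : ℝ} {z z' : ℕ → Fin d → ℝ} {t : ℕ} (hz : ∀ s ∈ Finset.Icc 1 t, z s = z' s) :
    gram γ z t = gram γ z' t := by
  unfold gram
  rw [Finset.sum_congr rfl fun s hs => by rw [hz s hs]]

theorem weightedSum_congr {z z' : ℕ → Fin d → ℝ} {w w' : ℕ → ℝ} {t : ℕ}
    (hz : ∀ s ∈ Finset.Icc 1 t, z s = z' s) (hw : ∀ s ∈ Finset.Icc 1 t, w s = w' s) :
    weightedSum z w t = weightedSum z' w' t := by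
  unfold weightedSum
  rw [Finset.sum_congr rfl fun s hs => by rw [hz s hs, hw s hs]]

/-- The mixture supermartingale of the `j`-th noise coordinate along the closed loop. -/
def loopMixture (σ : ℝ) (j : Fin n) (t : ℕ) (h : ℕ → P.𝕏 × P.𝕌) : ℝ≥0∞ :=
  ENNReal.ofReal (mixture P.γ σ (regr P h) (noiseCoord P h j) t)

theorem dependsUpTo_loopMixture (σ : ℝ) (j : Fin n) (t : ℕ) :
    DependsUpTo P t (loopMixture P σ j t) := by
  intro h h' hh
  have hz : ∀ s ∈ Finset.Icc 1 t, regr P h s = regr P h' s := fun s hs =>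
    regr_congr P (hh _ (by have := (Finset.mem_Icc.1 hs).2; omega))
  have hw : ∀ s ∈ Finset.Icc 1 t, noiseCoord P h j s = noiseCoord P h' j s := fun s hs => by
    have := (Finset.mem_Icc.1 hs).2
    exact noiseCoord_congr P j (hh _ (by omega)) (hh _ this)
  simp only [loopMixture, mixture, selfNorm, gram_congr hz, weightedSum_congr hz hw]

variable {P}

theorem measurable_noiseCoord (hm : MeasurableMaps P) (j : Fin n) (s : ℕ) :
    Measurable fun h : ℕ → P.𝕏 × P.𝕌 => noiseCoord P h j s :=
  (measurable_response hm j s).sub (measurable_dotProduct measurable_const (measurable_regr hm s))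

theorem measurable_loopMixture (hm : MeasurableMaps P) (σ : ℝ) (j : Fin n) (t : ℕ) :
    Measurable (loopMixture P σ j t) := by
  have hg : ∀ i k, Measurable fun h : ℕ → P.𝕏 × P.𝕌 => gram P.γ (regr P h) t i k :=
    measurable_gram (measurable_regr hm) _ _
  have hw : Measurable fun h : ℕ → P.𝕏 × P.𝕌 => weightedSum (regr P h) (noiseCoord P h j) t :=
    measurable_weightedSum (measurable_regr hm) (measurable_noiseCoord hm j) t
  have h1 := measurable_matrix_det hg
  have h2 := measurable_dotProduct hw (measurable_matrix_mulVec (measurable_matrix_inv hg) hw)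
  unfold loopMixture mixture selfNorm
  fun_prop

variable {Ω : Type*} [MeasurableSpace Ω] {μ : Measure Ω}
  {S : ℕ → Ω → P.𝕊} {W : ℕ+ → Ω → P.𝕎} {μs : Measure P.𝕊} {μw : Measure P.𝕎} {σw : ℝ≥0}

theorem hasSubgaussianMGF_coord (hN : NoiseModel μ P S W μs μw σw) (t : ℕ+) (j : Fin n) :
    HasSubgaussianMGF (fun ω => (W t ω : Vec n) j) (σw ^ 2) μ := by
  have h := hN.subGaussian_W t (EuclideanSpace.single j 1) (by simp)
  simpa [EuclideanSpace.inner_single_left] using h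

theorem isSubGaussianLaw_coord (hN : NoiseModel μ P S W μs μw σw) (j : Fin n) :
    IsSubGaussianLaw (μw.map fun w : P.𝕎 => (w : Vec n) j) σw := by
  intro l
  have hj : Measurable fun w : P.𝕎 => (w : Vec n) j := by fun_prop
  have h := hasSubgaussianMGF_coord hN 1 j
  rw [← hN.law_W 1, Measure.map_map hj (hN.measurable_W 1), lintegral_map (by fun_prop)
    (hj.comp (hN.measurable_W 1))]
  simp only [Function.comp_apply]
  rw [← ofReal_integral_eq_lintegral_ofReal
      (f := fun ω => Real.exp (l * (W 1 ω : Vec n) j)) (h.integrable_exp_mul l)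
      (ae_of_all _ fun _ => Real.exp_nonneg _)]
  refine ENNReal.ofReal_le_ofReal ?_
  simpa [mgf] using h.mgf_le l

/-- The regressor of time `t + 1` is determined by the state and control of time `t`. With the
history frozen, the only random quantity left is the noise coordinate of time `t + 1`, which enters
through the one-dimensional step. -/
theorem lintegral_loopMixture_succ_le [IsProbabilityMeasure μ] (hN : NoiseModel μ P S W μs μw σw)
    (hγ : 0 < P.γ) (j : Fin n) (t : ℕ) (h : ℕ → P.𝕏 × P.𝕌) :
    ∫⁻ sw, loopMixture P σw j (t + 1) (Function.update h (t + 1) (next P t h sw)) ∂(μs.prod μw)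
      ≤ 1 * loopMixture P σw j t h := by
  have := isProbabilityMeasure_process hN
  have := isProbabilityMeasure_exploration hN
  have hj : Measurable fun w : P.𝕎 => (w : Vec n) j := by fun_prop
  have hz : ∀ sw, regr P (Function.update h (t + 1) (next P t h sw)) (t + 1) = regr P h (t + 1) :=
    fun sw => regr_congr P (Function.update_of_ne (by omega) _ _)
  have hgr : ∀ sw, gram P.γ (regr P (Function.update h (t + 1) (next P t h sw))) t
      = gram P.γ (regr P h) t := fun sw => gram_congr fun s hs =>
    regr_congr P (Function.update_of_ne (by have := (Finset.mem_Icc.1 hs).2; omega) _ _)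
  have hws : ∀ sw, weightedSum (regr P (Function.update h (t + 1) (next P t h sw)))
      (noiseCoord P (Function.update h (t + 1) (next P t h sw)) j) t
      = weightedSum (regr P h) (noiseCoord P h j) t := fun sw => by
    refine weightedSum_congr (fun s hs => ?_) fun s hs => ?_ <;>
      have := (Finset.mem_Icc.1 hs).2
    · exact regr_congr P (Function.update_of_ne (by omega) _ _)
    · exact noiseCoord_congr P j (Function.update_of_ne (by omega) _ _)
        (Function.update_of_ne (by omega) _ _)
  have hmix : ∀ sw, mixture P.γ σw (regr P (Function.update h (t + 1) (next P t h sw)))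
      (noiseCoord P (Function.update h (t + 1) (next P t h sw)) j) t
      = mixture P.γ σw (regr P h) (noiseCoord P h j) t := fun sw => by
    unfold mixture selfNorm
    rw [hgr, hws]
  unfold loopMixture
  simp_rw [mixture_succ hγ, hmix, hgr, hws, hz, noiseCoord_update,
    ENNReal.ofReal_mul (mixture_nonneg _ _ _ _ _)]
  rw [lintegral_const_mul' _ _ ENNReal.ofReal_ne_top, mul_comm]
  gcongr
  set a := regr P h (t + 1) ⬝ᵥ (gram P.γ (regr P h) t)⁻¹ *ᵥ regr P h (t + 1)
  set b := regr P h (t + 1) ⬝ᵥ (gram P.γ (regr P h) t)⁻¹ *ᵥ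
    weightedSum (regr P h) (noiseCoord P h j) t
  have ha : 0 ≤ a := PosDef_dotProduct_nonneg (gram_posDef hγ _ t).inv _
  have : IsProbabilityMeasure (μw.map fun w : P.𝕎 => (w : Vec n) j) :=
    Measure.isProbabilityMeasure_map hj.aemeasurable
  have hstep := lintegral_mixture_step_le (isSubGaussianLaw_coord hN j) ha b
  rw [lintegral_map (by fun_prop) hj] at hstep
  have hmeas : Measurable fun w : P.𝕎 => ENNReal.ofReal (Real.exp ((2 * (w : Vec n) j * b
      + (w : Vec n) j ^ 2 * a - b ^ 2) / (1 + a) / (2 * (σw : ℝ) ^ 2)) / √(1 + a)) := by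
    fun_prop
  have hmeas' : Measurable fun sw : P.𝕊 × P.𝕎 => ENNReal.ofReal (Real.exp
      ((2 * (sw.2 : Vec n) j * b + (sw.2 : Vec n) j ^ 2 * a - b ^ 2) / (1 + a)
        / (2 * (σw : ℝ) ^ 2)) / √(1 + a)) := hmeas.comp measurable_snd
  rw [lintegral_prod _ hmeas'.aemeasurable]
  refine (lintegral_mono fun _ => hstep).trans ?_
  rw [lintegral_one, measure_univ]

/-- Uniform-in-time bound on the mixture supermartingale. -/
theorem measure_loopMixture_ge_le [IsProbabilityMeasure μ] (hN : NoiseModel μ P S W μs μw σw)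
    (hm : MeasurableMaps P) (hγ : 0 < P.γ) (x₀ : P.𝕏) (j : Fin n) {η : ℝ} (hη : 0 < η) :
    μ {ω | ∃ t, η⁻¹ ≤ mixture P.γ σw (regr P (P.path x₀ (fun k => S k ω) (fun k => W k ω)))
      (noiseCoord P (P.path x₀ (fun k => S k ω) (fun k => W k ω)) j) t} ≤ ENNReal.ofReal η := by
  have hpath := measurable_path hm hγ hN x₀
  have hV := ville μ (M := fun t ω => loopMixture P σw j t
    (P.path x₀ (fun k => S k ω) (fun k => W k ω)))
    (fun t => (measurable_loopMixture hm σw j t).comp hpath) (ENNReal.ofReal η⁻¹) (fun t => by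
      have hB : MeasurableSet {h : ℕ → P.𝕏 × P.𝕌 |
          ∀ s ≤ t, loopMixture P σw j s h < ENNReal.ofReal η⁻¹} := by
        have : {h : ℕ → P.𝕏 × P.𝕌 | ∀ s ≤ t, loopMixture P σw j s h < ENNReal.ofReal η⁻¹}
            = ⋂ s, ⋂ (_ : s ≤ t), {h | loopMixture P σw j s h < ENNReal.ofReal η⁻¹} := by
          ext; simp
        rw [this]
        exact MeasurableSet.iInter fun s => MeasurableSet.iInter fun _ =>
          measurableSet_lt (measurable_loopMixture hm σw j s) measurable_const
      have h := setLIntegral_path_succ_le hN hm hγ x₀ t (measurable_loopMixture hm σw j t)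
        (measurable_loopMixture hm σw j (t + 1)) (dependsUpTo_loopMixture P σw j t)
        (dependsUpTo_loopMixture P σw j (t + 1)) (lintegral_loopMixture_succ_le hN hγ j t) hB
        (fun h h' hh => by
          refine propext (forall₂_congr fun s hs => ?_)
          rw [dependsUpTo_loopMixture P σw j s h h' fun k hk => hh k (hk.trans hs)])
      rw [one_mul] at h
      exact h)
  simp only [loopMixture, mixture_zero hγ, ENNReal.ofReal_one, lintegral_one, measure_univ,
    ENNReal.ofReal_le_ofReal_iff (mixture_nonneg _ _ _ _ _)] at hV
  rw [ENNReal.ofReal_inv_of_pos hη] at hV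
  rwa [ENNReal.inv_mul_le_iff (by simpa using hη) ENNReal.ofReal_ne_top, mul_one] at hV

/-! ### Uniform bound on the noise -/

theorem noiseBound_succ (B : BoundData) (t : ℕ) (δ : ℝ) :
    (noiseBound n B (t + 1) δ : ℝ)
      = B.σw * √(2 * n * Real.log (n * Real.pi ^ 2 * ((t : ℝ) + 1) ^ 2 / (3 * δ))) := by
  rw [noiseBound, if_neg (Nat.succ_ne_zero t), NNReal.coe_mul, Nat.cast_succ, Real.sqrt]

theorem log_noiseBound_pos (hn : 0 < n) (t : ℕ) {δ : ℝ} (hδ : 0 < δ) (hδ1 : δ < 1) :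
    0 < Real.log (n * Real.pi ^ 2 * ((t : ℝ) + 1) ^ 2 / (3 * δ)) := by
  refine Real.log_pos ?_
  rw [lt_div_iff₀ (by positivity), one_mul]
  have h1 : (1 : ℝ) ≤ n := by exact_mod_cast hn
  have h2 : 3 ≤ Real.pi ^ 2 := by nlinarith [Real.pi_gt_three]
  have h3 : (1 : ℝ) ≤ (t + 1) ^ 2 := by nlinarith [(Nat.cast_nonneg t : (0 : ℝ) ≤ t)]
  have h4 : 1 * 3 * 1 ≤ (n : ℝ) * Real.pi ^ 2 * ((t : ℝ) + 1) ^ 2 := by gcongr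
  linarith

/-- If every coordinate is below `r = σw √(2 L)` in absolute value, the norm is at most `√n r`,
which is the noise bound. The `2 n` one-sided tails are each at most `exp (-L)`, and `L` is the
logarithm that makes their sum equal to the right-hand side. -/
theorem measure_noise_gt_le [IsProbabilityMeasure μ] {B : BoundData} (hn : 0 < n)
    (hN : NoiseModel μ P S W μs μw B.σw) {δ : ℝ} (hδ : 0 < δ) (hδ1 : δ < 1) (t : ℕ) :
    μ {ω | (noiseBound n B (t + 1) δ : ℝ) < ‖(W t.succPNat ω : Vec n)‖}
      ≤ ENNReal.ofReal (6 * δ / Real.pi ^ 2 * (1 / ((t : ℝ) + 1) ^ 2)) := by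
  have hn' : (0 : ℝ) < n := by exact_mod_cast hn
  set L := Real.log (n * Real.pi ^ 2 * ((t : ℝ) + 1) ^ 2 / (3 * δ)) with hL
  have hL0 : 0 < L := log_noiseBound_pos hn t hδ hδ1
  -- With zero variance proxy the tail exponent would be `0 / 0`; instead the noise vanishes almost
  -- surely.
  rcases eq_or_ne B.σw 0 with hσ | hσ
  · have hae : ∀ j, ∀ᵐ ω ∂μ, (W t.succPNat ω : Vec n) j = 0 := fun j => by
      have h := hasSubgaussianMGF_coord hN t.succPNat j
      rw [hσ, zero_pow two_ne_zero] at h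
      exact h.ae_eq_zero_of_hasSubgaussianMGF_zero
    refine le_trans (le_of_eq ?_) zero_le
    rw [noiseBound_succ, hσ]
    have : ∀ᵐ ω ∂μ, (W t.succPNat ω : Vec n) = 0 := by
      filter_upwards [ae_all_iff.2 hae] with ω hω
      ext j
      exact hω j
    refine measure_mono_null ?_ this
    intro ω hω (h0 : (W t.succPNat ω : Vec n) = 0)
    simp [h0] at hω
  have hσ' : (0 : ℝ) < B.σw := by positivity
  set r : ℝ := B.σw * √(2 * L) with hr
  have hr0 : 0 ≤ r := by positivity
  have hbound : (noiseBound n B (t + 1) δ : ℝ) ^ 2 = n * r ^ 2 := by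
    rw [noiseBound_succ, ← hL, mul_pow, Real.sq_sqrt (by positivity), hr, mul_pow,
      Real.sq_sqrt (by positivity)]
    ring
  have hsub : {ω | (noiseBound n B (t + 1) δ : ℝ) < ‖(W t.succPNat ω : Vec n)‖}
      ⊆ ⋃ j ∈ (Finset.univ : Finset (Fin n)), ({ω | r ≤ (W t.succPNat ω : Vec n) j} ∪
        {ω | r ≤ (-fun ω => (W t.succPNat ω : Vec n) j) ω}) := by
    intro ω hω
    by_contra hcon
    simp only [Finset.mem_univ, Set.iUnion_true, Set.mem_iUnion, Set.mem_union, Set.mem_ofPred_eq,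
      Pi.neg_apply, not_exists, not_or, not_le] at hcon
    have h1 : ‖(W t.succPNat ω : Vec n)‖ ^ 2 ≤ n * r ^ 2 := by
      rw [EuclideanSpace.norm_sq_eq]
      calc _ ≤ ∑ _j : Fin n, r ^ 2 := by
            refine Finset.sum_le_sum fun j _ => ?_
            rw [Real.norm_eq_abs]
            gcongr
            exact abs_le.2 ⟨by linarith [(hcon j).2], (hcon j).1.le⟩
        _ = _ := by simp
    rw [← hbound] at h1
    exact absurd ((pow_le_pow_iff_left₀ (norm_nonneg _) (NNReal.coe_nonneg _) two_ne_zero).1 h1)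
      (not_le.2 hω)
  have htail : ∀ X : Ω → ℝ, HasSubgaussianMGF X (B.σw ^ 2) μ →
      μ {ω | r ≤ X ω} ≤ ENNReal.ofReal (Real.exp (-L)) := by
    intro X hX
    rw [← ofReal_measureReal]
    refine ENNReal.ofReal_le_ofReal ((hX.measure_ge_le hr0).trans_eq ?_)
    congr 1
    rw [hr, mul_pow, Real.sq_sqrt (by positivity)]
    push_cast
    field_simp
  calc _ ≤ ∑ _j : Fin n, ENNReal.ofReal (2 * Real.exp (-L)) := by
        refine (measure_mono hsub).trans ((measure_biUnion_finset_le _ _).trans ?_)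
        refine Finset.sum_le_sum fun j _ => (measure_union_le _ _).trans ?_
        have h := hasSubgaussianMGF_coord hN t.succPNat j
        rw [two_mul, ENNReal.ofReal_add (Real.exp_nonneg _) (Real.exp_nonneg _)]
        exact add_le_add (htail _ h) (htail _ h.neg)
    _ = _ := by
        rw [Finset.sum_const, Finset.card_univ, Fintype.card_fin, nsmul_eq_mul,
          ← ENNReal.ofReal_natCast, ← ENNReal.ofReal_mul (by positivity)]
        congr 1
        rw [hL, Real.exp_neg, Real.exp_log (by positivity)]
        field_simp
        ring

/-- Euler's series for `π² / 6`. The weights distribute a failure probability over all times, both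
for the noise and for the excitation. -/
theorem tsum_ofReal_inv_sq {δ : ℝ} (hδ : 0 < δ) :
    ∑' t : ℕ, ENNReal.ofReal (6 * δ / Real.pi ^ 2 * (1 / ((t : ℝ) + 1) ^ 2))
      = ENNReal.ofReal δ := by
  have h := hasSum_zeta_two
  have h' : HasSum (fun t : ℕ => 1 / ((t : ℝ) + 1) ^ 2) (Real.pi ^ 2 / 6) := by
    have := (hasSum_nat_add_iff' 1).2 h
    simpa using this
  have h2 := h'.mul_left (6 * δ / Real.pi ^ 2)
  rw [← ENNReal.ofReal_tsum_of_nonneg (fun t => by positivity) h2.summable, h2.tsum_eq]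
  congr 1
  have := Real.pi_pos
  field_simp

/-- With high probability the noise never exceeds the noise bound. -/
theorem measure_exists_noise_gt_le [IsProbabilityMeasure μ] {B : BoundData} (hn : 0 < n)
    (hN : NoiseModel μ P S W μs μw B.σw) {δ : ℝ} (hδ : 0 < δ) (hδ1 : δ < 1) :
    μ {ω | ∃ t : ℕ, (noiseBound n B (t + 1) δ : ℝ) < ‖(W t.succPNat ω : Vec n)‖}
      ≤ ENNReal.ofReal δ := by
  have : {ω | ∃ t : ℕ, (noiseBound n B (t + 1) δ : ℝ) < ‖(W t.succPNat ω : Vec n)‖}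
      = ⋃ t : ℕ, {ω | (noiseBound n B (t + 1) δ : ℝ) < ‖(W t.succPNat ω : Vec n)‖} := by
    ext; simp
  rw [this, ← tsum_ofReal_inv_sq hδ]
  exact (measure_iUnion_le _).trans
    (ENNReal.tsum_le_tsum fun t => measure_noise_gt_le hn hN hδ hδ1 t)

end Noise

/-! ### Error of the least-squares estimate -/

section Error

open Matrix

/-- The normal equations: substituting response = signal + noise, the signal cancels against the
Gram matrix up to the regularisation bias. -/
theorem gram_mulVec_estimate_sub (P : Plant n m q d) (hγ : 0 < P.γ) (h : ℕ → P.𝕏 × P.𝕌) {t : ℕ}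
    (ht : t ≠ 0) (j : Fin n) :
    gram P.γ (regr P h) t *ᵥ (P.estimate h t - P.θ₀).col j
      = weightedSum (regr P h) (noiseCoord P h j) t - P.γ • P.θ₀.col j := by
  have h1 : (P.estimate h t - P.θ₀).col j = (P.estimate h t).col j - P.θ₀.col j := rfl
  rw [h1, mulVec_sub, estimate_col P hγ h ht, PosDef_mulVec_inv (gram_posDef hγ _ _), gram_mulVec]
  have h2 : weightedSum (regr P h) (response P h j) t
      = weightedSum (regr P h) (noiseCoord P h j) t
        + ∑ s ∈ Finset.Icc 1 t, (regr P h s ⬝ᵥ P.θ₀.col j) • regr P h s := by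
    simp only [weightedSum]
    rw [← Finset.sum_add_distrib]
    refine Finset.sum_congr rfl fun s _ => ?_
    rw [← add_smul, noiseCoord, dotProduct_comm (regr P h s)]
    congr 1
    ring
  rw [h2]
  abel

theorem sq_norm_toLp (y : Fin d → ℝ) : ‖(WithLp.toLp 2 y : Vec d)‖ ^ 2 = y ⬝ᵥ y := by
  rw [EuclideanSpace.norm_sq_eq]
  simp [dotProduct, sq]

theorem sq_le_mul_of_le {a u v w : ℝ} (h : a ^ 2 ≤ u * v) (hu : 0 ≤ u) (hv : v ≤ w) :
    a ^ 2 ≤ u * w := h.trans (mul_le_mul_of_nonneg_left hv hu)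

/-- For `y = E x` with `E` the error matrix, `Q = yᵀ V y` is linear in the columns of `V E`. Testing
against `y` itself gives `Q ≤ ‖x‖ √Q (√γ F + R)`; cancel `√Q` and use `√l ‖y‖ ≤ √Q`. No square root
of `V` is needed. -/
theorem opNorm_estimate_sub_le (P : Plant n m q d) (hγ : 0 < P.γ) (h : ℕ → P.𝕏 × P.𝕌) {t : ℕ}
    (ht : t ≠ 0) {l R : ℝ} (hl : 0 < l) (hR : 0 ≤ R)
    (hlow : ∀ y : Fin d → ℝ, l * (y ⬝ᵥ y) ≤ y ⬝ᵥ gram P.γ (regr P h) t *ᵥ y)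
    (hQ : ∑ j, selfNorm P.γ (regr P h) (noiseCoord P h j) t ≤ R ^ 2) :
    opNorm (P.estimate h t - P.θ₀) ≤ 1 / √l * (√P.γ * frobNorm P.θ₀ + R) := by
  set V := gram P.γ (regr P h) t with hV
  have hpos : V.PosDef := gram_posDef hγ _ _
  set F := frobNorm P.θ₀ with hF
  have hF0 : 0 ≤ F := Real.sqrt_nonneg _
  refine ContinuousLinearMap.opNorm_le_bound _ (by positivity) fun x => ?_
  rw [LinearMap.coe_toContinuousLinearMap']
  set E := P.estimate h t - P.θ₀ with hE
  set y : Fin d → ℝ := E *ᵥ WithLp.ofLp x with hy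
  have hlin : Matrix.toEuclideanLin E x = WithLp.toLp 2 y := rfl
  rw [hlin]
  set X := ‖x‖ with hX
  have hX2 : ∑ j, x j ^ 2 = X ^ 2 := by
    rw [hX, EuclideanSpace.norm_sq_eq]; simp
  set Q := y ⬝ᵥ V *ᵥ y with hQdef
  have hQ0 : 0 ≤ Q := PosDef_dotProduct_nonneg hpos y
  set a := ∑ j, x j * (y ⬝ᵥ weightedSum (regr P h) (noiseCoord P h j) t) with ha
  set b := ∑ j, x j * (y ⬝ᵥ P.θ₀.col j) with hb
  have hsum : Q = a - P.γ * b := by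
    have h1 : y = ∑ j, x j • E.col j := by
      ext i
      simp [hy, mulVec, dotProduct, mul_comm]
    have h2 : V *ᵥ y = ∑ j, x j •
        (weightedSum (regr P h) (noiseCoord P h j) t - P.γ • P.θ₀.col j) := by
      rw [h1, mulVec_sum]
      refine Finset.sum_congr rfl fun j _ => ?_
      rw [mulVec_smul, hV, hE, gram_mulVec_estimate_sub P hγ h ht]
    rw [hQdef, h2, dotProduct_sum, ha, hb, Finset.mul_sum, ← Finset.sum_sub_distrib]
    refine Finset.sum_congr rfl fun j _ => ?_
    rw [dotProduct_smul, dotProduct_sub, dotProduct_smul, smul_eq_mul, smul_eq_mul]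
    ring
  -- Cauchy–Schwarz over the columns, then between the forms of `V` and `V⁻¹` in each column.
  have haa : a ^ 2 ≤ (X * √Q * R) ^ 2 := by
    rw [mul_pow, mul_pow, Real.sq_sqrt hQ0, mul_assoc]
    refine sq_le_mul_of_le ((Finset.sum_mul_sq_le_sq_mul_sq _ _ _).trans_eq (by rw [hX2]))
      (sq_nonneg _) ?_
    calc _ ≤ ∑ j, Q * selfNorm P.γ (regr P h) (noiseCoord P h j) t :=
          Finset.sum_le_sum fun j _ => sq_dotProduct_le hpos _ _
      _ ≤ _ := by rw [← Finset.mul_sum]; gcongr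
  have hyy : P.γ * (y ⬝ᵥ y) ≤ Q := by
    rw [hQdef, hV, dotProduct_gram]
    exact le_add_of_nonneg_right (Finset.sum_nonneg fun _ _ => sq_nonneg _)
  -- One factor `γ` is spent on `γ |y|² ≤ Q`; the other yields the `√γ` in front of the Frobenius
  -- norm.
  have hbb : (P.γ * b) ^ 2 ≤ (X * √Q * (√P.γ * F)) ^ 2 := by
    have h1 : b ^ 2 ≤ X ^ 2 * ((y ⬝ᵥ y) * F ^ 2) := by
      refine sq_le_mul_of_le ((Finset.sum_mul_sq_le_sq_mul_sq _ _ _).trans_eq (by rw [hX2]))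
        (sq_nonneg _) ?_
      rw [hF, frobNorm_sq, Finset.mul_sum]
      refine Finset.sum_le_sum fun j _ => ?_
      have := Finset.sum_mul_sq_le_sq_mul_sq Finset.univ y (P.θ₀.col j)
      simpa [dotProduct, sq] using this
    calc (P.γ * b) ^ 2 = P.γ ^ 2 * b ^ 2 := by ring
      _ ≤ P.γ ^ 2 * (X ^ 2 * ((y ⬝ᵥ y) * F ^ 2)) := by gcongr
      _ = X ^ 2 * P.γ * F ^ 2 * (P.γ * (y ⬝ᵥ y)) := by ring
      _ ≤ X ^ 2 * P.γ * F ^ 2 * Q := by gcongr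
      _ = _ := by
        rw [mul_pow, mul_pow, mul_pow, Real.sq_sqrt hQ0, Real.sq_sqrt hγ.le]; ring
  have hX0 : 0 ≤ X := norm_nonneg _
  have ha' := le_of_abs_le (abs_le_of_sq_le_sq haa (by positivity))
  have hb' := neg_le_of_abs_le (abs_le_of_sq_le_sq hbb (by positivity))
  have hsq : √Q * √Q ≤ √Q * (X * (√P.γ * F + R)) := by
    rw [Real.mul_self_sqrt hQ0]
    nlinarith
  have hroot : √Q ≤ X * (√P.γ * F + R) := by
    rcases (Real.sqrt_nonneg Q).eq_or_lt with h0 | h0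
    · rw [← h0]; positivity
    · exact le_of_mul_le_mul_left hsq h0
  have hfin : √l * ‖(WithLp.toLp 2 y : Vec d)‖ ≤ √Q := by
    refine Real.le_sqrt_of_sq_le ?_
    rw [mul_pow, Real.sq_sqrt hl.le, sq_norm_toLp]
    exact hlow y
  have hl' : 0 < √l := Real.sqrt_pos.2 hl
  rw [one_div, mul_assoc, inv_mul_eq_div, le_div_iff₀ hl', mul_comm]
  linarith

/-- Take logarithms and use `det V / γ ^ d ≤ (β / γ) ^ d`. For `σ = 0` the mixture would carry no
information on the self-normalised sum. -/
theorem selfNorm_le_of_mixture_lt {γ σ β η : ℝ} (hγ : 0 < γ) (hσ : σ ≠ 0) (hη : 0 < η)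
    (z : ℕ → Fin d → ℝ) (w : ℕ → ℝ) (t : ℕ)
    (hβ : ∀ x : Fin d → ℝ, x ⬝ᵥ gram γ z t *ᵥ x ≤ β * (x ⬝ᵥ x))
    (h : mixture γ σ z w t < η) :
    selfNorm γ z w t ≤ 2 * σ ^ 2 * (Real.log η + (d : ℝ) / 2 * Real.log (β * γ⁻¹)) := by
  have hA := gram_posDef hγ z t
  have hD : 0 < (gram γ z t).det / γ ^ Fintype.card (Fin d) := div_pos hA.det_pos (by positivity)
  have hdet := det_le_pow hA hβ
  rw [mixture, div_lt_iff₀ (Real.sqrt_pos.2 hD)] at h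
  have h1 := Real.log_lt_log (Real.exp_pos _) h
  rw [Real.log_exp, Real.log_mul hη.ne' (Real.sqrt_pos.2 hD).ne', Real.log_sqrt hD.le] at h1
  have h2 : Real.log ((gram γ z t).det / γ ^ Fintype.card (Fin d)) ≤ d * Real.log (β * γ⁻¹) := by
    rw [← Real.log_pow]
    refine Real.log_le_log hD ?_
    rw [mul_pow, inv_pow, ← div_eq_mul_inv, Fintype.card_fin] at *
    gcongr
  have h3 : selfNorm γ z w t / (2 * σ ^ 2) ≤ Real.log η + (d : ℝ) / 2 * Real.log (β * γ⁻¹) := by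
    linarith
  rwa [div_le_iff₀ (by positivity), mul_comm] at h3

end Error

/-! ### Bounds on the trajectory -/

section Trajectory

variable {P : Plant n m q d} {B : BoundData}

/-- Pathwise, the feedback controls are a particular control sequence, so the deterministic
input-to-state bound applies to the closed loop. -/
theorem state_eq_flow (x₀ : P.𝕏) (s : ℕ → P.𝕊) (w : ℕ+ → P.𝕎) (t : ℕ) :
    P.state x₀ s w t = P.flow x₀ (P.control x₀ s w) w t := by
  induction t with
  | zero => rfl
  | succ t ih =>
    refine Subtype.ext ?_
    rw [state_succ, ih]
    rfl

theorem noiseBound_mono (hn : 0 < n) {δ : ℝ} (hδ : 0 < δ) {i t : ℕ} (hit : i < t) :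
    noiseBound n B (i + 1) δ ≤ noiseBound n B t δ := by
  obtain ⟨k, rfl⟩ : ∃ k, t = k + 1 := ⟨t - 1, by omega⟩
  have hn' : (0 : ℝ) < n := by exact_mod_cast hn
  rw [← NNReal.coe_le_coe, noiseBound_succ, noiseBound_succ]
  have : (i : ℝ) ≤ k := by exact_mod_cast (by omega : i ≤ k)
  gcongr

theorem nnnorm_state_le (hn : 0 < n) (hc : ConstrainedControls P B) (hI : InputToStateBound P B)
    {δ : ℝ} (hδ : 0 < δ) (x₀ : P.𝕏) (s : ℕ → P.𝕊) (w : ℕ+ → P.𝕎)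
    (hw : ∀ t : ℕ, ‖(w t.succPNat : Vec n)‖ ≤ noiseBound n B (t + 1) δ) (t : ℕ) :
    ‖(P.state x₀ s w t : Vec n)‖₊ ≤ stateBound n B t δ x₀ := by
  rw [state_eq_flow]
  refine (hI.bound t x₀ _ w).trans ?_
  unfold stateBound
  have h3 : B.χ₃ (∑ i ∈ Finset.range t, B.σ₁ ‖(P.control x₀ s w i : Vec m)‖₊)
      ≤ B.χ₃ (t * B.σ₁ B.uMax) := by
    refine hI.χ₃.1.1.2.1.monotone ((Finset.sum_le_card_nsmul _ _ (B.σ₁ B.uMax) fun i _ => ?_).trans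
      (by simp))
    rw [control_eq]
    exact hI.σ₁.1.2.1.monotone (hc _ _ _)
  have h4 : B.χ₄ (∑ i ∈ Finset.range t, B.σ₂ ‖(w i.succPNat : Vec n)‖₊)
      ≤ B.χ₄ (t * B.σ₂ (noiseBound n B t δ)) := by
    refine hI.χ₄.1.1.2.1.monotone ((Finset.sum_le_card_nsmul _ _ (B.σ₂ (noiseBound n B t δ))
      fun i hi => ?_).trans (by simp))
    refine hI.σ₂.1.1.2.1.monotone (le_trans ?_ (noiseBound_mono hn hδ (Finset.mem_range.1 hi)))
    exact_mod_cast hw i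
  gcongr

theorem norm_regressor_le (hn : 0 < n) (hc : ConstrainedControls P B) (hI : InputToStateBound P B)
    (hb : PolyBasis P B) {δ : ℝ} (hδ : 0 < δ) (x₀ : P.𝕏) (s : ℕ → P.𝕊) (w : ℕ+ → P.𝕎)
    (hw : ∀ t : ℕ, ‖(w t.succPNat : Vec n)‖ ≤ noiseBound n B (t + 1) δ) (t : ℕ) :
    ‖P.regressor (P.path x₀ s w) t‖ ≤ regressorBound n B t δ x₀ := by
  have hx := nnnorm_state_le hn hc hI hδ x₀ s w hw (t - 1)
  have hu : ‖(P.control x₀ s w (t - 1) : Vec m)‖₊ ≤ B.uMax := by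
    rw [control_eq]
    exact hc _ _ _
  have h : ‖P.regressor (P.path x₀ s w) t‖₊ ≤ regressorBound n B t δ x₀ := by
    refine (hb.bound _ _).trans (hb.mono (NNReal.sqrt_le_sqrt.2 ?_))
    exact add_le_add (pow_le_pow_left' hx 2) (pow_le_pow_left' hu 2)
  exact_mod_cast h

theorem sum_sq_norm_regressor_le (hn : 0 < n) (hc : ConstrainedControls P B)
    (hI : InputToStateBound P B) (hb : PolyBasis P B) {δ : ℝ} (hδ : 0 < δ) (x₀ : P.𝕏)
    (s : ℕ → P.𝕊) (w : ℕ+ → P.𝕎)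
    (hw : ∀ t : ℕ, ‖(w t.succPNat : Vec n)‖ ≤ noiseBound n B (t + 1) δ) (t : ℕ) :
    ∑ k ∈ Finset.Icc 1 t, ‖P.regressor (P.path x₀ s w) k‖ ^ 2 ≤ regressorSum n B t δ x₀ := by
  refine Finset.sum_le_sum fun k _ => ?_
  gcongr
  exact norm_regressor_le hn hc hI hb hδ x₀ s w hw k

end Trajectory

/-! ### Nets and the smallest eigenvalue of the Gram matrix -/

section Net

/-- A net of the unit sphere that is fine enough for a quadratic form of trace at most `K`. -/
theorem exists_net_quadratic (d : ℕ) {K r : ℝ} (hK : 0 ≤ K) (hr : 0 < r) :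
    ∃ s : Finset (Vec d), (∀ x ∈ s, ‖x‖ = 1) ∧ (s.card : ℝ) ≤ (1 + 16 * K / r) ^ d ∧
      ∀ x : Vec d, ‖x‖ = 1 → ∃ y ∈ s, 8 * ‖x - y‖ * K ≤ r := by
  -- For `K = 0` the radius `r / (8 K)` is meaningless, but any single point of the sphere works;
  -- the sphere is empty when `d = 0`.
  rcases hK.eq_or_lt with rfl | hK
  · by_cases h : ∃ x : Vec d, ‖x‖ = 1
    · obtain ⟨x, hx⟩ := h
      exact ⟨{x}, by simpa using hx, by simp, fun _ _ => ⟨x, by simp, by simpa using hr.le⟩⟩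
    · push Not at h
      exact ⟨∅, by simp, by simp, fun x hx => absurd hx (h x)⟩
  -- With this radius `1 + 2 / ε = 1 + 16 K / r`, the source of the 16 in the burn-in inequality.
  · obtain ⟨s, h1, h2, h3⟩ := exists_net_sphere d (ε := r / (8 * K)) (by positivity)
    refine ⟨s, h1, h2.trans_eq ?_, fun x hx => ?_⟩
    · congr 2
      field_simp
      norm_num
    · obtain ⟨y, hy, hxy⟩ := h3 x hx
      refine ⟨y, hy, ?_⟩
      rw [le_div_iff₀ (by positivity)] at hxy
      linarith

/-- The difference of squares factors as `⟨y - x, z⟩⟨y + x, z⟩ ≤ 2 ‖x - y‖ ‖z‖²`. The total loss is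
at most `2 ‖x - y‖ K ≤ r / 4`, so half of `r` on the net leaves a quarter everywhere. -/
theorem sum_inner_sq_ge_of_net {ι : Type*} (I : Finset ι) (z : ι → Vec d) {K r : ℝ}
    (hK : ∑ i ∈ I, ‖z i‖ ^ 2 ≤ K) {x y : Vec d} (hx : ‖x‖ = 1) (hy : ‖y‖ = 1)
    (hxy : 8 * ‖x - y‖ * K ≤ r) (h : r / 2 ≤ ∑ i ∈ I, (inner ℝ y (z i)) ^ 2) :
    r / 4 ≤ ∑ i ∈ I, (inner ℝ x (z i)) ^ 2 := by
  have h1 : ∑ i ∈ I, (inner ℝ y (z i)) ^ 2 - ∑ i ∈ I, (inner ℝ x (z i)) ^ 2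
      ≤ ∑ i ∈ I, 2 * ‖x - y‖ * ‖z i‖ ^ 2 := by
    rw [← Finset.sum_sub_distrib]
    refine Finset.sum_le_sum fun i _ => ?_
    have e : (inner ℝ y (z i)) ^ 2 - (inner ℝ x (z i)) ^ 2
        = inner ℝ (y - x) (z i) * inner ℝ (y + x) (z i) := by
      rw [inner_sub_left, inner_add_left]; ring
    rw [e]
    calc _ ≤ |inner ℝ (y - x) (z i)| * |inner ℝ (y + x) (z i)| := by
          rw [← abs_mul]; exact le_abs_self _
      _ ≤ (‖y - x‖ * ‖z i‖) * (‖y + x‖ * ‖z i‖) := by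
          gcongr <;> exact abs_real_inner_le_norm _ _
      _ ≤ (‖y - x‖ * ‖z i‖) * (2 * ‖z i‖) := by
          gcongr
          refine (norm_add_le _ _).trans ?_
          rw [hx, hy]; norm_num
      _ = _ := by rw [norm_sub_rev]; ring
  rw [← Finset.mul_sum] at h1
  have h2 : 2 * ‖x - y‖ * ∑ i ∈ I, ‖z i‖ ^ 2 ≤ 2 * ‖x - y‖ * K := by gcongr
  linarith

theorem regr_dotProduct (P : Plant n m q d) (h : ℕ → P.𝕏 × P.𝕌) (s : ℕ) (x : Vec d) :
    regr P h s ⬝ᵥ WithLp.ofLp x = inner ℝ x (P.regressor h s) := by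
  rw [EuclideanSpace.inner_eq_star_dotProduct]
  simp [regr]

theorem le_dotProduct_gram {P : Plant n m q d} (h : ℕ → P.𝕏 × P.𝕌) (t : ℕ) {l : ℝ}
    (hl : ∀ x : Vec d, ‖x‖ = 1 → l ≤ ∑ s ∈ Finset.Icc 1 t, (inner ℝ x (P.regressor h s)) ^ 2)
    (y : Fin d → ℝ) :
    (l + P.γ) * (y ⬝ᵥ y) ≤ y ⬝ᵥ Matrix.mulVec (gram P.γ (regr P h) t) y := by
  have hd : ∀ s, regr P h s ⬝ᵥ y = inner ℝ (WithLp.toLp 2 y) (P.regressor h s) :=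
    fun s => regr_dotProduct P h s (WithLp.toLp 2 y)
  rw [dotProduct_gram, ← sq_norm_toLp]
  simp_rw [hd]
  set x : Vec d := WithLp.toLp 2 y
  have key : l * ‖x‖ ^ 2 ≤ ∑ s ∈ Finset.Icc 1 t, (inner ℝ x (P.regressor h s)) ^ 2 := by
    rcases eq_or_ne x 0 with hx | hx
    · simp [hx]
    · have h0 : ‖x‖ ≠ 0 := norm_ne_zero_iff.2 hx
      have h1 := hl (‖x‖⁻¹ • x) (by rw [norm_smul, norm_inv, norm_norm, inv_mul_cancel₀ h0])
      simp_rw [real_inner_smul_left, mul_pow] at h1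
      rw [← Finset.mul_sum, inv_pow, inv_mul_eq_div, le_div_iff₀ (by positivity)] at h1
      exact h1
  linarith

theorem dotProduct_gram_le {P : Plant n m q d} (h : ℕ → P.𝕏 × P.𝕌) (t : ℕ) {K : ℝ}
    (hK : ∑ s ∈ Finset.Icc 1 t, ‖P.regressor h s‖ ^ 2 ≤ K) (y : Fin d → ℝ) :
    y ⬝ᵥ Matrix.mulVec (gram P.γ (regr P h) t) y ≤ (K + P.γ) * (y ⬝ᵥ y) := by
  have hd : ∀ s, regr P h s ⬝ᵥ y = inner ℝ (WithLp.toLp 2 y) (P.regressor h s) :=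
    fun s => regr_dotProduct P h s (WithLp.toLp 2 y)
  rw [dotProduct_gram, ← sq_norm_toLp]
  simp_rw [hd]
  set x : Vec d := WithLp.toLp 2 y
  have key : ∑ s ∈ Finset.Icc 1 t, (inner ℝ x (P.regressor h s)) ^ 2 ≤ ‖x‖ ^ 2 * K := by
    refine le_trans ?_ (mul_le_mul_of_nonneg_left hK (sq_nonneg _))
    rw [Finset.mul_sum]
    refine Finset.sum_le_sum fun s _ => ?_
    rw [← mul_pow, ← sq_abs]
    gcongr
    exact abs_real_inner_le_norm _ _
  linarith

end Net

/-! ### Sequences of polynomial growth -/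

/-- A sequence bounded by a multiple of a power of `t + 1`. -/
def PolyGrowth (a : ℕ → ℝ) : Prop :=
  ∃ (C : ℝ) (k : ℕ), 0 ≤ C ∧ ∀ t : ℕ, |a t| ≤ C * ((t : ℝ) + 1) ^ k

namespace PolyGrowth

variable {a b : ℕ → ℝ}

theorem const (c : ℝ) : PolyGrowth fun _ => c := ⟨|c|, 0, abs_nonneg c, fun t => by simp⟩

theorem natCast : PolyGrowth fun t => (t : ℝ) :=
  ⟨1, 1, zero_le_one, fun t => by rw [Nat.abs_cast]; linarith⟩

theorem mono (hb : PolyGrowth b) (h : ∀ t, |a t| ≤ |b t|) : PolyGrowth a := by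
  obtain ⟨C, k, hC, hb⟩ := hb
  exact ⟨C, k, hC, fun t => (h t).trans (hb t)⟩

theorem add (ha : PolyGrowth a) (hb : PolyGrowth b) : PolyGrowth fun t => a t + b t := by
  obtain ⟨C, k, hC, ha⟩ := ha
  obtain ⟨D, l, hD, hb⟩ := hb
  refine ⟨C + D, k + l, by positivity, fun t => (abs_add_le _ _).trans ?_⟩
  have h1 : (1 : ℝ) ≤ (t : ℝ) + 1 := by linarith [(Nat.cast_nonneg t : (0 : ℝ) ≤ t)]
  rw [add_mul]
  refine add_le_add ((ha t).trans ?_) ((hb t).trans ?_)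
  · gcongr
    omega
  · gcongr
    omega

theorem mul (ha : PolyGrowth a) (hb : PolyGrowth b) : PolyGrowth fun t => a t * b t := by
  obtain ⟨C, k, hC, ha⟩ := ha
  obtain ⟨D, l, hD, hb⟩ := hb
  refine ⟨C * D, k + l, by positivity, fun t => ?_⟩
  rw [abs_mul, pow_add, mul_mul_mul_comm]
  exact mul_le_mul (ha t) (hb t) (abs_nonneg _) (by positivity)

theorem pow (ha : PolyGrowth a) (k : ℕ) : PolyGrowth fun t => a t ^ k := by
  induction k with
  | zero => simpa using const 1
  | succ k ih => simpa [pow_succ] using ih.mul ha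

theorem pred (ha : PolyGrowth a) : PolyGrowth fun t => a (t - 1) := by
  obtain ⟨C, k, hC, ha⟩ := ha
  refine ⟨C, k, hC, fun t => (ha (t - 1)).trans ?_⟩
  have : ((t - 1 : ℕ) : ℝ) ≤ t := by exact_mod_cast Nat.sub_le t 1
  gcongr

theorem sum_Icc (ha : PolyGrowth a) : PolyGrowth fun t => ∑ i ∈ Finset.Icc 1 t, a i := by
  obtain ⟨C, k, hC, ha⟩ := ha
  refine ⟨C, k + 1, hC, fun t => ?_⟩
  calc |∑ i ∈ Finset.Icc 1 t, a i| ≤ ∑ i ∈ Finset.Icc 1 t, |a i| := Finset.abs_sum_le_sum_abs _ _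
    _ ≤ ∑ _i ∈ Finset.Icc 1 t, C * ((t : ℝ) + 1) ^ k := by
        refine Finset.sum_le_sum fun i hi => (ha i).trans ?_
        have : (i : ℝ) ≤ t := by exact_mod_cast (Finset.mem_Icc.1 hi).2
        gcongr
    _ = t * (C * ((t : ℝ) + 1) ^ k) := by simp
    _ ≤ ((t : ℝ) + 1) * (C * ((t : ℝ) + 1) ^ k) := by gcongr; linarith
    _ = _ := by ring

/-- The polynomial bound on `h` holds only beyond some `R`; monotonicity allows evaluating it at `r
t + R`. -/
theorem comp_apb {h : ℝ≥0 → ℝ≥0} (hm : Monotone h) (hh : IsAPB h) {r : ℕ → ℝ≥0}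
    (hr : PolyGrowth fun t => r t) : PolyGrowth fun t => h (r t) := by
  obtain ⟨k, hk⟩ := hh
  obtain ⟨C, hC, hb⟩ := hk.exists_pos
  obtain ⟨R, hR⟩ := eventually_atTop.1 hb.bound
  refine ((const C).mul ((hr.add (const R)).pow k)).mono fun t => ?_
  have h1 := hR (r t + R) le_add_self
  simp only [Real.norm_eq_abs, abs_pow, NNReal.abs_eq] at h1
  rw [NNReal.abs_eq, abs_mul, abs_of_pos hC, ← NNReal.coe_add, abs_pow, NNReal.abs_eq]
  exact le_trans (by exact_mod_cast hm le_self_add) h1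

theorem nnreal_sqrt {r : ℕ → ℝ≥0} (hr : PolyGrowth fun t => r t) :
    PolyGrowth fun t => (NNReal.sqrt (r t) : ℝ) := by
  refine (hr.add (const 1)).mono fun t => ?_
  have h1 : (0 : ℝ) ≤ r t + 1 := by positivity
  rw [NNReal.abs_eq, abs_of_nonneg h1, Real.coe_sqrt]
  refine Real.sqrt_le_iff.2 ⟨h1, ?_⟩
  nlinarith [(r t).coe_nonneg]

/-- The logarithm of a sequence of polynomial growth is `O(log t)`. -/
theorem log_one_add_le (ha : PolyGrowth a) :
    ∃ C, 0 ≤ C ∧ ∀ t : ℕ, 2 ≤ t → Real.log (1 + |a t|) ≤ C * Real.log t := by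
  obtain ⟨C, k, hC, ha⟩ := ha
  have hl2 : 0 < Real.log 2 := Real.log_pos one_lt_two
  have hC1 : 0 ≤ Real.log (1 + C) := Real.log_nonneg (by linarith)
  -- For `t ≥ 2`, `t + 1 ≤ t²` gives the factor 2, and `log t ≥ log 2` absorbs the constant.
  refine ⟨Real.log (1 + C) / Real.log 2 + k * 2, by positivity, fun t ht => ?_⟩
  have ht' : (2 : ℝ) ≤ t := by exact_mod_cast ht
  have h1 : 1 + |a t| ≤ (1 + C) * ((t : ℝ) ^ 2) ^ k := by
    have h2 : (1 : ℝ) ≤ ((t : ℝ) ^ 2) ^ k := one_le_pow₀ (by nlinarith)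
    have h3 : ((t : ℝ) + 1) ^ k ≤ ((t : ℝ) ^ 2) ^ k := by gcongr; nlinarith
    calc 1 + |a t| ≤ 1 + C * ((t : ℝ) + 1) ^ k := by linarith [ha t]
      _ ≤ ((t : ℝ) ^ 2) ^ k + C * ((t : ℝ) ^ 2) ^ k := by gcongr
      _ = _ := by ring
  refine (Real.log_le_log (by positivity) h1).trans ?_
  rw [Real.log_mul (by positivity) (by positivity), Real.log_pow, Real.log_pow, add_mul]
  have h4 : Real.log 2 ≤ Real.log t := Real.log_le_log two_pos ht'
  have h5 : Real.log (1 + C) ≤ Real.log (1 + C) / Real.log 2 * Real.log t := by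
    rw [div_mul_eq_mul_div, le_div_iff₀ hl2]
    gcongr
  push_cast
  linarith

end PolyGrowth

/-! ### Asymptotics of the bounds -/

section Asymptotics

variable {P : Plant n m q d} {B : BoundData}

theorem polyGrowth_noiseBound (hn : 0 < n) {δ : ℝ} (hδ : 0 < δ) (hδ1 : δ < 1) :
    PolyGrowth fun t => (noiseBound n B t δ : ℝ) := by
  have h : PolyGrowth fun t : ℕ => (B.σw : ℝ) *
      (1 + 2 * n * (n * Real.pi ^ 2 / (3 * δ) * (t : ℝ) ^ 2)) :=
    (PolyGrowth.const _).mul ((PolyGrowth.const _).add ((PolyGrowth.const _).mul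
      ((PolyGrowth.const _).mul (PolyGrowth.natCast.pow 2))))
  refine h.mono fun t => ?_
  have h0 : 0 ≤ (B.σw : ℝ) * (1 + 2 * n * (n * Real.pi ^ 2 / (3 * δ) * (t : ℝ) ^ 2)) := by
    positivity
  rw [NNReal.abs_eq, abs_of_nonneg h0]
  cases t with
  | zero => simp [noiseBound]
  | succ t =>
    rw [noiseBound_succ]
    have hL := log_noiseBound_pos hn t hδ hδ1
    set y := (n : ℝ) * Real.pi ^ 2 * ((t : ℝ) + 1) ^ 2 / (3 * δ) with hy
    have hy0 : 0 < y := by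
      have : (0 : ℝ) < n := by exact_mod_cast hn
      positivity
    have h1 : Real.log y ≤ y := (Real.log_le_sub_one_of_pos hy0).trans (by linarith)
    have h2 : √(2 * n * Real.log y) ≤ 1 + 2 * n * y := by
      have h3 : 2 * n * Real.log y ≤ 2 * n * y := by gcongr
      have h4 : 0 ≤ 2 * n * Real.log y := by positivity
      refine (Real.sqrt_le_sqrt h3).trans (Real.sqrt_le_iff.2 ⟨by positivity, ?_⟩)
      nlinarith
    have h5 : (n : ℝ) * Real.pi ^ 2 / (3 * δ) * ((t + 1 : ℕ) : ℝ) ^ 2 = y := by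
      rw [hy]; push_cast; ring
    rw [h5]
    gcongr

theorem polyGrowth_stateBound (hn : 0 < n) (hI : PolyInputToStateBound P B) {δ : ℝ} (hδ : 0 < δ)
    (hδ1 : δ < 1) (x₀ : Vec n) : PolyGrowth fun t => (stateBound n B t δ x₀ : ℝ) := by
  have hσ₂ := PolyGrowth.comp_apb hI.σ₂.1.1.2.1.monotone hI.apb_σ₂
    (polyGrowth_noiseBound (B := B) hn hδ hδ1)
  have h1 := PolyGrowth.comp_apb hI.χ₁.1.1.2.1.monotone hI.apb_χ₁ (r := fun t => (t : ℝ≥0))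
    (by simpa using PolyGrowth.natCast)
  have h3 := PolyGrowth.comp_apb hI.χ₃.1.1.2.1.monotone hI.apb_χ₃
    (r := fun t => (t : ℝ≥0) * B.σ₁ B.uMax)
    (by simpa using PolyGrowth.natCast.mul (PolyGrowth.const _))
  have h4 := PolyGrowth.comp_apb hI.χ₄.1.1.2.1.monotone hI.apb_χ₄
    (r := fun t => (t : ℝ≥0) * B.σ₂ (noiseBound n B t δ))
    (by simpa using PolyGrowth.natCast.mul hσ₂)
  simp only [stateBound, NNReal.coe_add]
  exact (((h1.add (PolyGrowth.const _)).add h3).add h4).add (PolyGrowth.const _)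

theorem polyGrowth_regressorSum (hn : 0 < n) (hI : PolyInputToStateBound P B)
    (hb : PolyBasis P B) {δ : ℝ} (hδ : 0 < δ) (hδ1 : δ < 1) (x₀ : Vec n) :
    PolyGrowth fun t => regressorSum n B t δ x₀ := by
  refine PolyGrowth.sum_Icc (PolyGrowth.pow (PolyGrowth.comp_apb hb.mono hb.apb ?_) 2)
  refine PolyGrowth.nnreal_sqrt ?_
  simp only [NNReal.coe_add, NNReal.coe_pow]
  exact ((polyGrowth_stateBound hn hI hδ hδ1 x₀).pred.pow 2).add (PolyGrowth.const _)

theorem regressorSum_nonneg (n : ℕ) (B : BoundData) (t : ℕ) (δ : ℝ) (x₀ : Vec n) :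
    0 ≤ regressorSum n B t δ x₀ := Finset.sum_nonneg fun _ _ => sq_nonneg _

theorem eventually_log_le (a b : ℝ) : ∀ᶠ t : ℕ in atTop, a * Real.log t + b ≤ t := by
  have h1 : (fun x : ℝ => a * Real.log x + b) =o[atTop] fun x : ℝ => x :=
    (Real.isLittleO_log_id_atTop.const_mul_left a).add (isLittleO_const_id_atTop b)
  have h2 := (h1.comp_tendsto tendsto_natCast_atTop_atTop).bound one_pos
  filter_upwards [h2] with t ht
  simp only [Function.comp_apply, one_mul, Real.norm_eq_abs, Nat.abs_cast] at ht
  exact (le_abs_self _).trans ht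

/-- The candidate `T` also occurs inside the inequality, but `t - T + 1 ≤ t` bounds its left side by
a multiple of `log t` plus a constant, uniformly in `T`. Any `T` past which `t` dominates will do.
-/
theorem exists_burnIn (hn : 0 < n) (hI : PolyInputToStateBound P B) (hb : PolyBasis P B)
    (hc : 0 < B.cPE) (hp : 0 < B.pPE) {δ : ℝ} (hδ : 0 < δ) (hδ1 : δ < 1) (x₀ : Vec n) :
    ∃ T : ℕ, 1 ≤ T ∧ ∀ t : ℕ, T ≤ t → BurnInIneq n d B T t δ x₀ := by
  have hlog : 0 < 1 - Real.log 2 := by linarith [Real.log_two_lt_d9]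
  have hK := polyGrowth_regressorSum hn hI hb (δ := δ / 3) (by positivity) (by linarith) x₀
  obtain ⟨C, hC, hCt⟩ :=
    (hK.mul (PolyGrowth.const (16 / (B.cPE * B.pPE)))).log_one_add_le
  set A := 2 / ((1 - Real.log 2) * B.pPE) with hA
  have hA0 : 0 < A := by positivity
  obtain ⟨T, hT⟩ := eventually_atTop.1 (eventually_log_le (A * (d * C + 2))
    (A * Real.log (Real.pi ^ 2 / (2 * δ)) + 1))
  -- The 2 ensures `t - 1 ≥ 1`, which keeps the quotient meaningful.
  refine ⟨max T 2, by simp, fun t ht => ?_⟩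
  have ht2 : 2 ≤ t := (le_max_right _ _).trans ht
  have ht2' : (2 : ℝ) ≤ t := by exact_mod_cast ht2
  have htT : ((max T 2 : ℕ) : ℝ) ≤ t := by exact_mod_cast ht
  have hTT : (2 : ℝ) ≤ ((max T 2 : ℕ) : ℝ) := by exact_mod_cast le_max_right _ _
  have hlt := hT t ((le_max_left _ _).trans ht)
  have hKt := regressorSum_nonneg n B t (δ / 3) x₀
  unfold BurnInIneq
  have h1 : Real.log (1 + 16 * regressorSum n B t (δ / 3) x₀ / (B.cPE * B.pPE * ((t : ℝ) - 1)))
      ≤ C * Real.log t := by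
    have ht1 : (0 : ℝ) < (t : ℝ) - 1 := by linarith
    refine (Real.log_le_log (by positivity) ?_).trans (hCt t ht2)
    rw [abs_of_nonneg (by positivity)]
    have : 16 * regressorSum n B t (δ / 3) x₀ / (B.cPE * B.pPE * ((t : ℝ) - 1))
        ≤ 16 * regressorSum n B t (δ / 3) x₀ / (B.cPE * B.pPE * 1) := by
      gcongr
      linarith
    refine (add_le_add le_rfl this).trans_eq ?_
    rw [mul_one]
    ring
  have h2 : Real.log (Real.pi ^ 2 * ((t : ℝ) - (max T 2 : ℕ) + 1) ^ 2 / (2 * δ))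
      ≤ Real.log (Real.pi ^ 2 / (2 * δ)) + 2 * Real.log t := by
    have h3 : (0 : ℝ) < (t : ℝ) - (max T 2 : ℕ) + 1 := by linarith
    have h4 : (2 : ℝ) * Real.log t = Real.log ((t : ℝ) ^ 2) := by rw [Real.log_pow]; norm_num
    rw [h4, ← Real.log_mul (by positivity) (by positivity)]
    refine Real.log_le_log (by positivity) ?_
    rw [div_mul_eq_mul_div]
    gcongr
    linarith
  calc _ ≤ A * (d * (C * Real.log t) + (Real.log (Real.pi ^ 2 / (2 * δ)) + 2 * Real.log t)) + 1 := by
        gcongr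
    _ = A * (d * C + 2) * Real.log t + (A * Real.log (Real.pi ^ 2 / (2 * δ)) + 1) := by ring
    _ ≤ t := hlt

/-- The numerator is `O(√(log t))`, with constants absorbed by `log t ≥ log 2`; the denominator is
at least `√(c p t / 8)`, because `t - 1 ≥ t / 2`. -/
theorem isBigO_errorBound (hn : 0 < n) (hI : PolyInputToStateBound P B) (hb : PolyBasis P B)
    (hγ : 0 < P.γ) (hc : 0 < B.cPE) (hp : 0 < B.pPE) {δ : ℝ} (hδ : 0 < δ) (hδ1 : δ < 1)
    (x₀ : Vec n) :
    (fun t : ℕ => errorBound P B t δ x₀) =O[atTop] (fun t : ℕ => √(Real.log t / t)) := by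
  have hK := polyGrowth_regressorSum hn hI hb (δ := δ / 3) (by positivity) (by linarith) x₀
  obtain ⟨C, hC, hCt⟩ := (hK.mul (PolyGrowth.const P.γ⁻¹)).log_one_add_le
  have hl2 : 0 < Real.log 2 := Real.log_pos one_lt_two
  have hn1 : (1 : ℝ) ≤ n := by exact_mod_cast hn
  have hη : 0 ≤ Real.log (3 * n / δ) := by
    refine Real.log_nonneg ?_
    rw [le_div_iff₀ hδ]
    linarith
  set F := √P.γ * frobNorm P.θ₀ with hF
  have hF0 : 0 ≤ F := mul_nonneg (Real.sqrt_nonneg _) (Real.sqrt_nonneg _)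
  set D := 2 * n * (Real.log (3 * n / δ) / Real.log 2 + (d : ℝ) / 2 * C) with hD
  have hD0 : 0 ≤ D := by positivity
  refine IsBigO.of_bound (1 / √(B.cPE * B.pPE / 8) * (F / √(Real.log 2) + B.σw * √D)) ?_
  filter_upwards [eventually_ge_atTop 2] with t ht
  have ht' : (2 : ℝ) ≤ t := by exact_mod_cast ht
  have hlt : Real.log 2 ≤ Real.log t := Real.log_le_log two_pos ht'
  have hlt0 : 0 < Real.log t := hl2.trans_le hlt
  have hKt := regressorSum_nonneg n B t (δ / 3) x₀
  have h0 : 0 ≤ errorBound P B t δ x₀ := by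
    unfold errorBound
    positivity
  rw [Real.norm_of_nonneg h0, Real.norm_of_nonneg (Real.sqrt_nonneg _)]
  have h1 : 1 / √(B.cPE * B.pPE / 4 * ((t : ℝ) - 1) + P.γ)
      ≤ 1 / √(B.cPE * B.pPE / 8) * (1 / √t) := by
    rw [one_div_mul_one_div, ← Real.sqrt_mul (by positivity)]
    refine one_div_le_one_div_of_le (by positivity) (Real.sqrt_le_sqrt ?_)
    have : B.cPE * B.pPE / 8 * t ≤ B.cPE * B.pPE / 8 * (2 * (t - 1)) := by
      gcongr
      linarith
    linarith
  have h2 : F ≤ F / √(Real.log 2) * √(Real.log t) := by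
    rw [div_mul_eq_mul_div, le_div_iff₀ (by positivity)]
    gcongr
  have h3 : √(2 * n * (Real.log (3 * n / δ) + (d : ℝ) / 2 *
      Real.log (gramBound n B P.γ t (δ / 3) x₀ * P.γ⁻¹))) ≤ √D * √(Real.log t) := by
    rw [← Real.sqrt_mul hD0]
    refine Real.sqrt_le_sqrt ?_
    have h4 : Real.log (gramBound n B P.γ t (δ / 3) x₀ * P.γ⁻¹) ≤ C * Real.log t := by
      have h := hCt t ht
      rw [abs_of_nonneg (by positivity)] at h
      rwa [gramBound, add_mul, mul_inv_cancel₀ hγ.ne', add_comm]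
    have h5 : Real.log (3 * n / δ) ≤ Real.log (3 * n / δ) / Real.log 2 * Real.log t := by
      rw [div_mul_eq_mul_div, le_div_iff₀ hl2]
      gcongr
    calc _ ≤ 2 * n * (Real.log (3 * n / δ) / Real.log 2 * Real.log t
          + (d : ℝ) / 2 * (C * Real.log t)) := by gcongr
      _ = _ := by rw [hD]; ring
  calc errorBound P B t δ x₀
      ≤ 1 / √(B.cPE * B.pPE / 8) * (1 / √t) *
        (F / √(Real.log 2) * √(Real.log t) + B.σw * (√D * √(Real.log t))) := by
        unfold errorBound
        gcongr
    _ = _ := by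
        rw [Real.sqrt_div hlt0.le]
        ring

theorem tendsto_sqrt_log_div : Tendsto (fun t : ℕ => √(Real.log t / t)) atTop (𝓝 0) := by
  have h := (Real.isLittleO_log_id_atTop.tendsto_div_nhds_zero).comp tendsto_natCast_atTop_atTop
  have h' := (Real.continuous_sqrt.tendsto 0).comp h
  rwa [Real.sqrt_zero] at h'

end Asymptotics

/-! ### The error bound along good trajectories -/

section Good

variable {P : Plant n m q d} {B : BoundData}

/-- The regressor of time `k + 1` is generated at time `k`. The one generated at time 0 is dropped,
since the fixed initial state contains no fresh noise; hence `t - 1` in the excitation bounds. -/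
theorem sum_inner_regressor_ge (h : ℕ → P.𝕏 × P.𝕌) (x : Vec d) {t : ℕ} (ht : 1 ≤ t) :
    ∑ k ∈ Finset.Icc 1 (t - 1), (inner ℝ x (P.ψ (h k).1 (h k).2)) ^ 2
      ≤ ∑ s ∈ Finset.Icc 1 t, (inner ℝ x (P.regressor h s)) ^ 2 := by
  have h1 : ∑ k ∈ Finset.Icc 1 (t - 1), (inner ℝ x (P.ψ (h k).1 (h k).2)) ^ 2
      = ∑ s ∈ Finset.Icc 2 t, (inner ℝ x (P.regressor h s)) ^ 2 := by
    refine Finset.sum_bij (fun k _ => k + 1) ?_ ?_ ?_ ?_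
    · intro k hk; simp only [Finset.mem_Icc] at hk ⊢; omega
    · intro a _ b _ hab; omega
    · intro s hs
      simp only [Finset.mem_Icc] at hs
      exact ⟨s - 1, by simp only [Finset.mem_Icc]; omega, by omega⟩
    · intro k _; rfl
  rw [h1]
  exact Finset.sum_le_sum_of_subset_of_nonneg (Finset.Icc_subset_Icc_left (by omega))
    fun _ _ _ => sq_nonneg _

/-- The error bound holds at time `t` if the noise is bounded, the mixture supermartingales are
small and the regressors are exciting in every direction of a fine net. -/
theorem opNorm_thetaHat_sub_le (hn : 0 < n) (hγ : 0 < P.γ) (hcont : ConstrainedControls P B)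
    (hI : InputToStateBound P B) (hb : PolyBasis P B) (hc : 0 < B.cPE) (hp : 0 < B.pPE)
    {δ : ℝ} (hδ : 0 < δ) (hδ1 : δ < 1) (x₀ : P.𝕏) (s : ℕ → P.𝕊) (w : ℕ+ → P.𝕎)
    (hw : ∀ t : ℕ, ‖(w t.succPNat : Vec n)‖ ≤ noiseBound n B (t + 1) (δ / 3))
    {t : ℕ} (ht : 1 ≤ t)
    (hmix : ∀ j, mixture P.γ B.σw (regr P (P.path x₀ s w)) (noiseCoord P (P.path x₀ s w) j) t
      < (δ / (3 * n))⁻¹)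
    {net : Finset (Vec d)} (hnet : ∀ y ∈ net, ‖y‖ = 1)
    (hfine : ∀ x : Vec d, ‖x‖ = 1 → ∃ y ∈ net, 8 * ‖x - y‖ * regressorSum n B t (δ / 3) x₀
      ≤ B.cPE * B.pPE * ((t : ℝ) - 1))
    (hexc : ∀ y ∈ net, B.cPE * B.pPE * ((t - 1 : ℕ) : ℝ) / 2
      ≤ ∑ k ∈ Finset.Icc 1 (t - 1),
        (inner ℝ y (P.ψ (P.path x₀ s w k).1 (P.path x₀ s w k).2)) ^ 2) :
    opNorm (P.thetaHat x₀ s w t - P.θ₀) ≤ errorBound P B t δ x₀ := by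
  set h := P.path x₀ s w with hh
  have hn' : (0 : ℝ) < n := by exact_mod_cast hn
  have hn1 : (1 : ℝ) ≤ n := by exact_mod_cast hn
  have hK := sum_sq_norm_regressor_le hn hcont hI hb (δ := δ / 3) (by positivity) x₀ s w hw t
  have hK0 := regressorSum_nonneg n B t (δ / 3) x₀
  have ht1 : (1 : ℝ) ≤ t := by exact_mod_cast ht
  have hcast : ((t - 1 : ℕ) : ℝ) = (t : ℝ) - 1 := by rw [Nat.cast_sub ht, Nat.cast_one]
  have hlow := le_dotProduct_gram (P := P) h t (l := B.cPE * B.pPE / 4 * ((t : ℝ) - 1))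
    fun x hx => by
      obtain ⟨y, hy, hxy⟩ := hfine x hx
      have h1 := (hexc y hy).trans (sum_inner_regressor_ge h y ht)
      rw [hcast] at h1
      have h2 := sum_inner_sq_ge_of_net (Finset.Icc 1 t) (P.regressor h) hK hx (hnet y hy) hxy h1
      linarith
  have hl : 0 < B.cPE * B.pPE / 4 * ((t : ℝ) - 1) + P.γ := by
    have : 0 ≤ (t : ℝ) - 1 := by linarith
    positivity
  have hη : 0 ≤ Real.log (3 * n / δ) := by
    refine Real.log_nonneg ?_
    rw [le_div_iff₀ hδ]
    linarith
  have hβ : 0 ≤ Real.log (gramBound n B P.γ t (δ / 3) x₀ * P.γ⁻¹) := by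
    refine Real.log_nonneg ?_
    rw [gramBound, add_mul, mul_inv_cancel₀ hγ.ne']
    have : 0 ≤ regressorSum n B t (δ / 3) x₀ * P.γ⁻¹ := by positivity
    linarith
  set L := Real.log (3 * n / δ)
    + (d : ℝ) / 2 * Real.log (gramBound n B P.γ t (δ / 3) x₀ * P.γ⁻¹) with hL
  have hL0 : 0 ≤ L := by positivity
  refine opNorm_estimate_sub_le P hγ h (by omega) hl (by positivity) hlow ?_
  have hQ : ∀ j, selfNorm P.γ (regr P h) (noiseCoord P h j) t ≤ 2 * (B.σw : ℝ) ^ 2 * L := by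
    intro j
    -- For `σw = 0` the mixture says nothing, but the noise bound is 0 and forces the noise to
    -- vanish.
    rcases eq_or_ne B.σw 0 with hσ | hσ
    · have hz : weightedSum (regr P h) (noiseCoord P h j) t = 0 := by
        refine Finset.sum_eq_zero fun k hk => ?_
        obtain ⟨i, rfl⟩ : ∃ i, k = i + 1 := ⟨k - 1, by have := (Finset.mem_Icc.1 hk).1; omega⟩
        have h0 := hw i
        rw [noiseBound_succ, hσ, NNReal.coe_zero, zero_mul, norm_le_zero_iff] at h0
        rw [hh, noiseCoord_path, h0]
        simp
      rw [selfNorm, hz, zero_dotProduct, hσ]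
      simp
    · have h1 := selfNorm_le_of_mixture_lt hγ (NNReal.coe_ne_zero.2 hσ) (by positivity) _ _ t
        (dotProduct_gram_le h t hK) (hmix j)
      rwa [inv_div] at h1
  calc _ ≤ ∑ _j : Fin n, 2 * (B.σw : ℝ) ^ 2 * L := Finset.sum_le_sum fun j _ => hQ j
    _ = _ := by
      rw [mul_pow, Real.sq_sqrt (by positivity), Finset.sum_const, Finset.card_univ,
        Fintype.card_fin, nsmul_eq_mul]
      ring

end Good

/-! ### The burn-in time -/

section BurnIn

variable {B : BoundData}

/-- At `t = T = 1` the quotient by zero evaluates to 0, yet `log (π² / (2 δ)) > 0` still makes the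
inequality false. -/
theorem two_le_of_burnIn {T : ℕ} (hT : 1 ≤ T) (hp : 0 < B.pPE) {δ : ℝ} (hδ : 0 < δ) (hδ1 : δ < 1)
    {x₀ : Vec n} (h : BurnInIneq n d B T T δ x₀) : 2 ≤ T := by
  by_contra hlt
  obtain rfl : T = 1 := by omega
  have hlog : 0 < 1 - Real.log 2 := by linarith [Real.log_two_lt_d9]
  have h1 : 0 < Real.log (Real.pi ^ 2 / (2 * δ)) := by
    refine Real.log_pos ?_
    rw [lt_div_iff₀ (by positivity)]
    nlinarith [Real.pi_gt_three]
  have h2 : 0 < 2 / ((1 - Real.log 2) * B.pPE) * Real.log (Real.pi ^ 2 / (2 * δ)) := by positivity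
  simp only [BurnInIneq, Nat.cast_one, sub_self, mul_zero, div_zero, add_zero, Real.log_one,
    zero_add, one_pow, mul_one] at h
  linarith

/-- The exponentiated burn-in inequality: the Chernoff exponent pays for the net and for `π² (t - T
+ 1)² / (2 δ)`, whose inverse is the term of index `t - T` in the series with sum `δ / 3`. -/
theorem card_mul_exp_le {T t : ℕ} (hTt : T ≤ t) (ht : 2 ≤ t) (hc : 0 < B.cPE) (hp : 0 < B.pPE)
    {δ : ℝ} (hδ : 0 < δ) {x₀ : Vec n} (h : BurnInIneq n d B T t δ x₀) {N : ℝ}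
    (hN : N ≤ (1 + 16 * regressorSum n B t (δ / 3) x₀ / (B.cPE * B.pPE * ((t : ℝ) - 1))) ^ d) :
    N * Real.exp (-((1 - Real.log 2) * B.pPE * ((t - 1 : ℕ) : ℝ) / 2))
      ≤ 6 * (δ / 3) / Real.pi ^ 2 * (1 / (((t - T : ℕ) : ℝ) + 1) ^ 2) := by
  have hlog : 0 < 1 - Real.log 2 := by linarith [Real.log_two_lt_d9]
  have hcast : ((t - 1 : ℕ) : ℝ) = (t : ℝ) - 1 := by rw [Nat.cast_sub (by omega), Nat.cast_one]
  have hcast' : ((t - T : ℕ) : ℝ) = (t : ℝ) - T := Nat.cast_sub hTt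
  have ht2 : (2 : ℝ) ≤ t := by exact_mod_cast ht
  have hTt' : (T : ℝ) ≤ t := by exact_mod_cast hTt
  have ht1 : (0 : ℝ) < (t : ℝ) - 1 := by linarith
  have hT1 : (0 : ℝ) < (t : ℝ) - T + 1 := by linarith
  have hK0 := regressorSum_nonneg n B t (δ / 3) x₀
  rw [hcast, hcast']
  unfold BurnInIneq at h
  set M := 1 + 16 * regressorSum n B t (δ / 3) x₀ / (B.cPE * B.pPE * ((t : ℝ) - 1)) with hM
  have hM0 : 0 < M := by positivity
  set Y := Real.pi ^ 2 * ((t : ℝ) - T + 1) ^ 2 / (2 * δ) with hY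
  have hY0 : 0 < Y := by positivity
  have h1 : d * Real.log M + Real.log Y ≤ (1 - Real.log 2) * B.pPE * ((t : ℝ) - 1) / 2 := by
    have h2 : 2 / ((1 - Real.log 2) * B.pPE) * (d * Real.log M + Real.log Y) ≤ (t : ℝ) - 1 := by
      linarith
    rw [div_mul_eq_mul_div, div_le_iff₀ (by positivity)] at h2
    linarith
  have h3 : M ^ d * Y ≤ Real.exp ((1 - Real.log 2) * B.pPE * ((t : ℝ) - 1) / 2) := by
    rw [← Real.exp_log (by positivity : 0 < M ^ d * Y), Real.log_mul (by positivity) hY0.ne',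
      Real.log_pow]
    exact Real.exp_le_exp.2 h1
  rw [Real.exp_neg, ← div_eq_mul_inv, div_le_iff₀ (Real.exp_pos _)]
  have h4 : 6 * (δ / 3) / Real.pi ^ 2 * (1 / ((t : ℝ) - T + 1) ^ 2) = Y⁻¹ := by
    rw [hY]
    field_simp
    norm_num
  rw [h4]
  calc N ≤ M ^ d := hN
    _ = Y⁻¹ * (M ^ d * Y) := by field_simp
    _ ≤ _ := by gcongr

end BurnIn

/-! ### The union bounds and the two time bounds. -/

section Probability

variable {P : Plant n m q d} {B : BoundData} {Ω : Type*} [MeasurableSpace Ω] {μ : Measure Ω}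
  {S : ℕ → Ω → P.𝕊} {W : ℕ+ → Ω → P.𝕎} {μs : Measure P.𝕊} {μw : Measure P.𝕎}

/-- With high probability the excitation is sufficient in all directions of nets of the unit sphere,
at all times after the burn-in. -/
theorem measure_exists_small_excitation_le [IsProbabilityMeasure μ]
    (hN : NoiseModel μ P S W μs μw B.σw) (hm : MeasurableMaps P) (hγ : 0 < P.γ) (x₀ : P.𝕏)
    (hE : GloballyExcited P μs μw B.cPE B.pPE) {δ : ℝ} (hδ : 0 < δ) {T : ℕ} (hT : 2 ≤ T)
    (hburn : ∀ t, T ≤ t → BurnInIneq n d B T t δ x₀) (net : ℕ → Finset (Vec d))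
    (hnet : ∀ t, T ≤ t → ∀ y ∈ net t, ‖y‖ = 1)
    (hcard : ∀ t, T ≤ t → ((net t).card : ℝ) ≤ (1 + 16 * regressorSum n B t (δ / 3) x₀
      / (B.cPE * B.pPE * ((t : ℝ) - 1))) ^ d) :
    μ {ω | ∃ t, T ≤ t ∧ ∃ y ∈ net t, ∑ k ∈ Finset.Icc 1 (t - 1),
        (inner ℝ y (P.ψ (P.path x₀ (fun k => S k ω) (fun k => W k ω) k).1
          (P.path x₀ (fun k => S k ω) (fun k => W k ω) k).2)) ^ 2
        < B.cPE * B.pPE * ((t - 1 : ℕ) : ℝ) / 2} ≤ ENNReal.ofReal (δ / 3) := by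
  set bad : ℕ → Vec d → Set Ω := fun t y => {ω | ∑ k ∈ Finset.Icc 1 (t - 1),
        (inner ℝ y (P.ψ (P.path x₀ (fun k => S k ω) (fun k => W k ω) k).1
          (P.path x₀ (fun k => S k ω) (fun k => W k ω) k).2)) ^ 2
        < B.cPE * B.pPE * ((t - 1 : ℕ) : ℝ) / 2} with hbad
  -- Reindexing by `k = t - T` matches the series, which starts at the burn-in time.
  have hsub : {ω | ∃ t, T ≤ t ∧ ∃ y ∈ net t, ω ∈ bad t y}
      ⊆ ⋃ k : ℕ, ⋃ y ∈ net (T + k), bad (T + k) y := by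
    rintro ω ⟨t, ht, y, hy, hω⟩
    obtain ⟨k, rfl⟩ := Nat.exists_eq_add_of_le ht
    simp only [Set.mem_iUnion]
    exact ⟨k, y, hy, hω⟩
  refine (measure_mono hsub).trans ((measure_iUnion_le _).trans ?_)
  rw [← tsum_ofReal_inv_sq (by positivity : 0 < δ / 3)]
  refine ENNReal.tsum_le_tsum fun k => (measure_biUnion_finset_le _ _).trans ?_
  have hTk : T ≤ T + k := Nat.le_add_right _ _
  have h1 := card_mul_exp_le hTk (by omega) hE.1 hE.2.1 hδ (hburn _ hTk) (hcard _ hTk)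
  rw [Nat.add_sub_cancel_left] at h1
  refine le_trans ?_ (ENNReal.ofReal_le_ofReal h1)
  rw [ENNReal.ofReal_mul (Nat.cast_nonneg _), ENNReal.ofReal_natCast, ← nsmul_eq_mul]
  exact Finset.sum_le_card_nsmul _ _ _ fun y hy =>
    measure_small_excitation_le hN hm hγ x₀ hE (hnet _ hTk y hy) (T + k - 1)

theorem measurable_opNorm_thetaHat_sub (hN : NoiseModel μ P S W μs μw B.σw)
    (hm : MeasurableMaps P) (hγ : 0 < P.γ) (x₀ : P.𝕏) (t : ℕ) :
    Measurable fun ω => opNorm (P.thetaHat x₀ (fun k => S k ω) (fun k => W k ω) t - P.θ₀) := by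
  have h1 : Continuous fun A : Mat d n => opNorm (A - P.θ₀) := by
    let L : Mat d n →ₗ[ℝ] (Vec n →L[ℝ] Vec d) :=
      (LinearMap.toContinuousLinearMap (𝕜 := ℝ) (E := Vec n) (F' := Vec d)).toLinearMap ∘ₗ
        (Matrix.toEuclideanLin (𝕜 := ℝ) (m := Fin d) (n := Fin n)).toLinearMap
    have hL : Continuous L := L.continuous_of_finiteDimensional
    exact (hL.comp (continuous_id.sub continuous_const)).norm
  exact h1.measurable.comp ((measurable_estimate hm hγ t).comp (measurable_path hm hγ hN x₀))

/-- Admissible candidates are natural numbers, so the infimum is attained and the burn-in time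
satisfies its own inequalities. -/
theorem exists_tBurnIn_eq {δ : ℝ} {x₀ : Vec n}
    (h : ∃ T : ℕ, 1 ≤ T ∧ ∀ t : ℕ, T ≤ t → BurnInIneq n d B T t δ x₀) :
    ∃ T : ℕ, (1 ≤ T ∧ ∀ t : ℕ, T ≤ t → BurnInIneq n d B T t δ x₀) ∧ tBurnIn n d B δ x₀ = T := by
  classical
  refine ⟨Nat.find h, Nat.find_spec h, le_antisymm (iInf₂_le (Nat.find h) (Nat.find_spec h)) ?_⟩
  exact le_iInf₂ fun T hT => by exact_mod_cast Nat.find_min' h hT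

/-- When the exciting region is the whole state space, noise-free successors never leave it, and
every time is admissible. -/
theorem tExcited_eq_top (P : Plant n m q d) (B : BoundData) (δ : ℝ) (x₀ : Vec n) :
    tExcited P B P.𝕏 δ x₀ = ⊤ := by
  rw [tExcited, ENat.eq_top_iff_forall_ge]
  intro k
  have hk : 1 ≤ k + 1 ∧ reachable P B
      (Metric.closedBall 0 (stateBound n B (k + 1 - 1) (δ / 3) x₀) ∩ P.𝕏) ⊆ P.𝕏 := by
    refine ⟨by omega, ?_⟩
    rintro y ⟨x, u, -, -, rfl⟩
    exact P.maps_to x u 0 (Set.mem_insert _ _)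
  exact le_trans (by exact_mod_cast Nat.le_succ k) (le_iSup₂_of_le (k + 1) hk le_rfl)

/-- Union bound over large noise, large mixtures (`n` coordinates at `δ / (3 n)`) and poor
excitation on the nets; outside these events the error bound is deterministic. -/
theorem measure_error_le [IsProbabilityMeasure μ] (hn : 0 < n) (hγ : 0 < P.γ)
    (hN : NoiseModel μ P S W μs μw B.σw) (hm : MeasurableMaps P) (hcont : ConstrainedControls P B)
    (hb : PolyBasis P B) (hE : GloballyExcited P μs μw B.cPE B.pPE) (hI : InputToStateBound P B)
    (x₀ : P.𝕏) {δ : ℝ} (hδ : 0 < δ) (hδ1 : δ < 1) {T : ℕ} (hT : 2 ≤ T)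
    (hburn : ∀ t, T ≤ t → BurnInIneq n d B T t δ x₀) :
    μ {ω | ∀ t : ℕ, T ≤ t →
        opNorm (P.thetaHat x₀ (fun k => S k ω) (fun k => W k ω) t - P.θ₀)
          ≤ errorBound P B t δ x₀}ᶜ ≤ ENNReal.ofReal δ := by
  have hn' : (0 : ℝ) < n := by exact_mod_cast hn
  -- The fineness of the nets is set by the deterministic `regressorSum`, not by the realised
  -- regressors, so they do not depend on `ω` and the union bound applies.
  have hnets : ∀ t : ℕ, ∃ s : Finset (Vec d), T ≤ t → (∀ x ∈ s, ‖x‖ = 1) ∧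
      (s.card : ℝ) ≤ (1 + 16 * regressorSum n B t (δ / 3) x₀
        / (B.cPE * B.pPE * ((t : ℝ) - 1))) ^ d ∧
      ∀ x : Vec d, ‖x‖ = 1 → ∃ y ∈ s, 8 * ‖x - y‖ * regressorSum n B t (δ / 3) x₀
        ≤ B.cPE * B.pPE * ((t : ℝ) - 1) := by
    intro t
    by_cases ht : T ≤ t
    · have ht2 : (2 : ℝ) ≤ t := by exact_mod_cast hT.trans ht
      have hr : 0 < B.cPE * B.pPE * ((t : ℝ) - 1) :=
        mul_pos (mul_pos hE.1 hE.2.1) (by linarith)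
      obtain ⟨s, hs⟩ := exists_net_quadratic d (regressorSum_nonneg n B t (δ / 3) x₀) hr
      exact ⟨s, fun _ => hs⟩
    · exact ⟨∅, fun h => absurd h ht⟩
  choose net hnet using hnets
  set bA : Set Ω := {ω | ∃ t : ℕ, (noiseBound n B (t + 1) (δ / 3) : ℝ)
    < ‖(W t.succPNat ω : Vec n)‖}
  set bB : Fin n → Set Ω := fun j => {ω | ∃ t, (δ / (3 * n))⁻¹ ≤ mixture P.γ B.σw
    (regr P (P.path x₀ (fun k => S k ω) (fun k => W k ω)))
    (noiseCoord P (P.path x₀ (fun k => S k ω) (fun k => W k ω)) j) t}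
  set bC : Set Ω := {ω | ∃ t, T ≤ t ∧ ∃ y ∈ net t, ∑ k ∈ Finset.Icc 1 (t - 1),
        (inner ℝ y (P.ψ (P.path x₀ (fun k => S k ω) (fun k => W k ω) k).1
          (P.path x₀ (fun k => S k ω) (fun k => W k ω) k).2)) ^ 2
        < B.cPE * B.pPE * ((t - 1 : ℕ) : ℝ) / 2}
  have hA : μ bA ≤ ENNReal.ofReal (δ / 3) :=
    measure_exists_noise_gt_le hn hN (by positivity) (by linarith)
  have hB : μ (⋃ j ∈ (Finset.univ : Finset (Fin n)), bB j) ≤ ENNReal.ofReal (δ / 3) := by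
    refine (measure_biUnion_finset_le _ _).trans ((Finset.sum_le_card_nsmul _ _ _ fun j _ =>
      measure_loopMixture_ge_le hN hm hγ x₀ j (η := δ / (3 * n)) (by positivity)).trans_eq ?_)
    rw [Finset.card_univ, Fintype.card_fin, nsmul_eq_mul, ← ENNReal.ofReal_natCast,
      ← ENNReal.ofReal_mul (by positivity)]
    congr 1
    field_simp
  have hC : μ bC ≤ ENNReal.ofReal (δ / 3) :=
    measure_exists_small_excitation_le hN hm hγ x₀ hE hδ hT hburn net
      (fun t ht => (hnet t ht).1) (fun t ht => (hnet t ht).2.1)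
  have hsub : {ω | ∀ t : ℕ, T ≤ t →
        opNorm (P.thetaHat x₀ (fun k => S k ω) (fun k => W k ω) t - P.θ₀)
          ≤ errorBound P B t δ x₀}ᶜ
      ⊆ bA ∪ (⋃ j ∈ (Finset.univ : Finset (Fin n)), bB j) ∪ bC := by
    intro ω hω
    by_contra hcon
    simp only [Set.mem_union, not_or] at hcon
    obtain ⟨⟨h1, h2⟩, h3⟩ := hcon
    refine hω fun t ht => ?_
    simp only [Finset.mem_univ, Set.iUnion_true, Set.mem_iUnion, not_exists] at h2
    refine opNorm_thetaHat_sub_le hn hγ hcont hI hb hE.1 hE.2.1 hδ hδ1 x₀ _ _ (fun k => ?_)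
      (by omega) (fun j => ?_) (hnet t ht).1 (hnet t ht).2.2 fun y hy => ?_
    · by_contra! hlt
      exact h1 ⟨k, hlt⟩
    · by_contra! hlt
      exact h2 j ⟨t, hlt⟩
    · by_contra! hlt
      exact h3 ⟨t, ht, y, hy, hlt⟩
  calc _ ≤ μ bA + μ (⋃ j ∈ (Finset.univ : Finset (Fin n)), bB j) + μ bC :=
        (measure_mono hsub).trans ((measure_union_le _ _).trans
          (add_le_add (measure_union_le _ _) le_rfl))
    _ ≤ ENNReal.ofReal (δ / 3) + ENNReal.ofReal (δ / 3) + ENNReal.ofReal (δ / 3) := by gcongr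
    _ = ENNReal.ofReal δ := by
        rw [← ENNReal.ofReal_add (by positivity) (by positivity),
          ← ENNReal.ofReal_add (by positivity) (by positivity)]
        congr 1
        ring

end Probability

end SysId
end

theorem corollary2 {Ω : Type*} [MeasurableSpace Ω] (μ : Measure Ω) [IsProbabilityMeasure μ]
    {n m q d : ℕ} (hn : 0 < n) (hd : 0 < d)
    (P : Plant n m q d) (hγ : 0 < P.γ)
    (S : ℕ → Ω → P.𝕊) (W : ℕ+ → Ω → P.𝕎) (μs : Measure P.𝕊) (μw : Measure P.𝕎)
    (B : BoundData)
    (h_noise : NoiseModel μ P S W μs μw B.σw)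
    (h_meas : MeasurableMaps P)
    (h_control : ConstrainedControls P B)
    (h_basis : PolyBasis P B)
    (h_excited : GloballyExcited P μs μw B.cPE B.pPE)
    (h_poly : PolyInputToStateBound P B)
    (x₀ : P.𝕏) (δ : ℝ) (hδ : δ ∈ Set.Ioo (0 : ℝ) 1) :
    tBurnIn n d B δ x₀ < ⊤ ∧
    tExcited P B P.𝕏 δ x₀ = ⊤ ∧
    (MeasurableSet {ω | ∀ t : ℕ, tBurnIn n d B δ x₀ ≤ t →
        opNorm (P.thetaHat x₀ (fun k => S k ω) (fun k => W k ω) t - P.θ₀)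
          ≤ errorBound P B t δ x₀} ∧
      ENNReal.ofReal (1 - δ) ≤ μ {ω | ∀ t : ℕ, tBurnIn n d B δ x₀ ≤ t →
        opNorm (P.thetaHat x₀ (fun k => S k ω) (fun k => W k ω) t - P.θ₀)
          ≤ errorBound P B t δ x₀}) ∧
    Tendsto (fun t : ℕ => errorBound P B t δ x₀) atTop (𝓝 0) ∧
    (fun t : ℕ => errorBound P B t δ x₀) =O[atTop] (fun t : ℕ => √(Real.log t / t)) := by
  have hδ0 : 0 < δ := hδ.1
  have hδ1 : δ < 1 := hδ.2
  have hc := h_excited.1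
  have hp := h_excited.2.1
  obtain ⟨T, ⟨hT1, hT⟩, hTeq⟩ :=
    exists_tBurnIn_eq (exists_burnIn (d := d) hn h_poly h_basis hc hp hδ0 hδ1 x₀)
  have hO := isBigO_errorBound hn h_poly h_basis hγ hc hp hδ0 hδ1 (x₀ : Vec n)
  -- Needed also below, to pass from the probability of the complement to that of the event.
  have hset : MeasurableSet {ω | ∀ t : ℕ, T ≤ t →
        opNorm (P.thetaHat x₀ (fun k => S k ω) (fun k => W k ω) t - P.θ₀)
          ≤ errorBound P B t δ x₀} := by
    simp only [Set.ofPred_forall]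
    exact MeasurableSet.iInter fun t => MeasurableSet.iInter fun _ =>
      measurableSet_le (measurable_opNorm_thetaHat_sub h_noise h_meas hγ x₀ t) measurable_const
  simp only [hTeq, Nat.cast_le]
  refine ⟨ENat.natCast_lt_top T, tExcited_eq_top P B δ x₀, ⟨hset, ?_⟩,
    hO.trans_tendsto tendsto_sqrt_log_div, hO⟩
  have hbad := measure_error_le hn hγ h_noise h_meas h_control h_basis h_excited
    h_poly.toInputToStateBound x₀ hδ0 hδ1 (two_le_of_burnIn hT1 hp hδ0 hδ1 (hT T le_rfl)) hT
  rw [prob_compl_eq_one_sub hset, tsub_le_iff_left] at hbad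
  rw [ENNReal.ofReal_sub _ hδ0.le, ENNReal.ofReal_one]
  exact tsub_le_iff_right.2 hbad
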